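/- Let $\mathcal H=L_2(0,\infty)$ (complex-valued functions) and let $q\in C^\infty([0,\infty))$ be real-valued, such that $-\frac{d^2}{dx^2}+q$ is in the limit point case at infinity and the operator $L_0y=-y''+qy$ in $\mathcal H$, with $$\mathrm{Dom}\,L_0=\{y\in\mathcal H\cap H^2_{\rm loc}([0,\infty)) : y(0)=y'(0)=0,\ -y''+qy\in\mathcal H\},$$ is positive definite: $(L_0y,y)\ge\varkappa\|y\|^2$ on $\mathrm{Dom}\,L_0$ for some $\varkappa>0$. Let $L$ be the Friedrichs extension of $L_0$, $\mathcal K=\mathrm{Ker}\,L_0^*$, and $\Gamma_1=L^{-1}L_0^*-I$ on $\mathrm{Dom}\,L_0^*$. For $T\ge 0$ let $\mathcal U^T$ be the set of states $u^h(T)$, where $h\in C^\infty([0,\infty);\mathcal K)$ vanishes near $t=0$ and $u^h\in C^\infty([0,\infty);\mathcal H)$ is the classical solution of $$u_{tt}+L_0^*u=0\ (t>0),\qquad u(0)=u_t(0)=0,\qquad \Gamma_1u(t)=h(t)\ (t\ge 0).$$ For a closed subspace $\mathcal G\subseteq\mathcal H$ put $I^0\mathcal G=\mathcal G$ and, for $t>0$,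 let $I^t\mathcal G$ be the closure of $$\Big\{\int_0^tL^{-1/2}\sin\big[(t-s)L^{1/2}\big]g(s)\,ds : g\in L_2^{\rm loc}([0,\infty);\mathcal G)\Big\}.$$ Let $\mathfrak L$ be the smallest family of closed subspaces of $\mathcal H$ that contains all the reachable subspaces $\overline{\mathcal U^T}$, $T\ge0$, contains $\{0\}$ and $\mathcal H$, is closed under $\mathcal A\vee\mathcal B=\overline{\mathcal A+\mathcal B}$, $\mathcal A\wedge\mathcal B=\mathcal A\cap\mathcal B$ and $\mathcal A\mapsto\mathcal A^\perp$, and is invariant under $I^t$ for all $t\ge0$. Equip the set of closed subspaces of $\mathcal H$ with the topology of strong convergence of orthogonal projections ($\mathcal A_j\to\mathcal A$ iff $P_{\mathcal A_j}x\to P_{\mathcal A}x$ for every $x\in\mathcal H$). For a Lebesgue measurable set $E\subseteq[0,\infty)$ put $L_2(E)=\{y\in\mathcal H : y=0 \text{ a.e. outside } E\}$, and let $m$ be Lebesgue measure. Then $$\overline{\mathfrak L}=\{L_2(E) : E\subseteq[0,\infty)\ \text{Lebesgue measurable}\}.$$ Moreover, for Lebesgue measurable sets $E_n,E\subseteq[0,\infty)$,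 one has $L_2(E_n)\to L_2(E)$ as $n\to\infty$ if and only if $m((E_n\triangle E)\cap(0,R))\to0$ for every $R>0$. -/

import Mathlib

open MeasureTheory Set Filter Topology
open scoped ContDiff InnerProductSpace

namespace WaveSpectrum

/-! ### The lattice of closed subspaces of a Hilbert space -/

section Lattice

variable {E : Type*} [NormedAddCommGroup E] [InnerProductSpace ℂ E] [CompleteSpace E]

/-- The topology of the lattice of closed subspaces given by strong operator convergence of
orthogonal projections: the coarsest topology for which `A ↦ P_A x` is continuous for every `x`. -/
noncomputable instance strongTopology : TopologicalSpace (ClosedSubmodule ℂ E) :=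
  TopologicalSpace.induced
    (fun (A : ClosedSubmodule ℂ E) (x : E) => A.toSubmodule.starProjection x) inferInstance

/-- A family of closed subspaces that is a lattice: it contains the least and the greatest
subspace and is invariant under `∨` (closed sum), `∧` (intersection) and orthogonal complement. -/
structure IsSubspaceLattice (S : Set (ClosedSubmodule ℂ E)) : Prop where
  bot_mem : ⊥ ∈ S
  top_mem : ⊤ ∈ S
  sup_mem : ∀ A ∈ S, ∀ B ∈ S, A ⊔ B ∈ S
  inf_mem : ∀ A ∈ S, ∀ B ∈ S, A ⊓ B ∈ S
  orthogonal_mem : ∀ A ∈ S, Aᗮ ∈ S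

/-- The minimal lattice of closed subspaces that contains the family `M` and is invariant under
the maps `I t`, `t ≥ 0`. -/
def minimalLattice (I : ℝ → ClosedSubmodule ℂ E → ClosedSubmodule ℂ E)
    (M : Set (ClosedSubmodule ℂ E)) : Set (ClosedSubmodule ℂ E) :=
  ⋂₀ {S | IsSubspaceLattice S ∧ M ⊆ S ∧ ∀ t : ℝ, 0 ≤ t → ∀ A ∈ S, I t A ∈ S}

end Lattice

/-! ### Positive definite operators and the Friedrichs extension -/

section Operator

variable {E : Type*} [NormedAddCommGroup E] [InnerProductSpace ℂ E]

/-- `(A y, y) ≥ κ ‖y‖²` on the domain of `A`, for some `κ > 0`; in particular `(A y, y)` is real. -/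
def IsPositiveDefinite (A : E →ₗ.[ℂ] E) : Prop :=
  ∃ κ : ℝ, 0 < κ ∧ ∀ y : A.domain,
    (⟪A y, (y : E)⟫_ℂ).im = 0 ∧ κ * ‖(y : E)‖ ^ 2 ≤ (⟪A y, (y : E)⟫_ℂ).re

/-- The quadratic form `(A y, y)` on the domain of `A`. -/
noncomputable def quadForm (A : E →ₗ.[ℂ] E) (y : A.domain) : ℝ := (⟪A y, (y : E)⟫_ℂ).re

theorem quadForm_smul (A : E →ₗ.[ℂ] E) (c : ℂ) (y : A.domain) :
    quadForm A (c • y) = ‖c‖ ^ 2 * quadForm A y := by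
  have h : (starRingEnd ℂ) c * c = ((‖c‖ ^ 2 : ℝ) : ℂ) := by
    rw [mul_comm, Complex.mul_conj, Complex.normSq_eq_norm_sq]
  simp only [quadForm, LinearPMap.map_smul, Submodule.coe_smul, inner_smul_left,
    inner_smul_right]
  rw [← mul_assoc, mul_comm c, h, Complex.re_ofReal_mul]

theorem quadForm_add_le {A : E →ₗ.[ℂ] E} (hA : IsPositiveDefinite A) (x y : A.domain) :
    quadForm A (x + y) ≤ 2 * quadForm A x + 2 * quadForm A y := by
  have h0 : 0 ≤ quadForm A (x - y) := by
    obtain ⟨κ, hκ, h⟩ := hA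
    exact le_trans (by positivity) (h (x - y)).2
  have h1 : quadForm A (x + y) + quadForm A (x - y) = 2 * quadForm A x + 2 * quadForm A y := by
    simp only [quadForm, LinearPMap.map_add, LinearPMap.map_sub, Submodule.coe_add,
      Submodule.coe_sub, inner_add_left, inner_add_right, inner_sub_left, inner_sub_right,
      Complex.add_re, Complex.sub_re]
    ring
  linarith

theorem quadForm_nonneg {A : E →ₗ.[ℂ] E} (hA : IsPositiveDefinite A) (y : A.domain) :
    0 ≤ quadForm A y := by
  obtain ⟨κ, hκ, h⟩ := hA
  exact le_trans (by positivity) (h y).2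

/-- The domain of the closure of the quadratic form of `A`: limits `x` of sequences in the domain
of `A` that are Cauchy with respect to the form. -/
def formDomain (A : E →ₗ.[ℂ] E) (hA : IsPositiveDefinite A) : Submodule ℂ E where
  carrier := {x | ∃ a : ℕ → A.domain, Tendsto (fun n => (a n : E)) atTop (𝓝 x) ∧
    Tendsto (fun p : ℕ × ℕ => quadForm A (a p.1 - a p.2)) atTop (𝓝 0)}
  zero_mem' := ⟨fun _ => 0, by simp, by simp [quadForm]⟩
  add_mem' := by
    rintro x y ⟨a, ha, ha'⟩ ⟨b, hb, hb'⟩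
    refine ⟨fun n => a n + b n, by simpa using ha.add hb, ?_⟩
    have h := (ha'.const_mul 2).add (hb'.const_mul 2)
    simp only [mul_zero, add_zero] at h
    refine squeeze_zero (fun p => quadForm_nonneg hA _) (fun p => ?_) h
    rw [add_sub_add_comm]
    exact quadForm_add_le hA _ _
  smul_mem' := by
    rintro c x ⟨a, ha, ha'⟩
    refine ⟨fun n => c • a n, by simpa using ha.const_smul c, ?_⟩
    have h := ha'.const_mul (‖c‖ ^ 2)
    simp only [mul_zero] at h
    refine h.congr fun p => ?_
    rw [← smul_sub, quadForm_smul]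

variable [CompleteSpace E]

/-- The Friedrichs extension `L` of `A`: the restriction of the adjoint `A*` to
`Dom A* ∩ (form domain of A)`. -/
noncomputable def friedrichs (A : E →ₗ.[ℂ] E) (hA : IsPositiveDefinite A) : E →ₗ.[ℂ] E :=
  A.adjoint.domRestrict (formDomain A hA)

/-- `R` is the inverse of the operator `B`, bounded and defined on the whole space. -/
def IsBoundedInverse (B : E →ₗ.[ℂ] E) (R : E →L[ℂ] E) : Prop :=
  (∀ f : E, ∃ x : B.domain, (x : E) = R f ∧ B x = f) ∧ ∀ x : B.domain, R (B x) = x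

open scoped Classical in
/-- The inverse of `B` as a bounded operator on the whole space (`0` if there is none). -/
noncomputable def boundedInverse (B : E →ₗ.[ℂ] E) : E →L[ℂ] E :=
  if h : ∃ R : E →L[ℂ] E, IsBoundedInverse B R then h.choose else 0

/-! ### The dynamical system with boundary control, reachable sets -/

/-- The boundary operator `Γ₁ = L⁻¹ A* - 1` on the domain of `A*`. -/
noncomputable def boundaryOp (A : E →ₗ.[ℂ] E) (hA : IsPositiveDefinite A)
    (y : A.adjoint.domain) : E :=
  boundedInverse (friedrichs A hA) (A.adjoint y) - y

/-- Smooth controls with values in `Ker A*` that vanish near `t = 0`. -/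
def IsControl (A : E →ₗ.[ℂ] E) (h : ℝ → E) : Prop :=
  ContDiffOn ℝ ∞ h (Ici 0) ∧
  (∀ t, 0 ≤ t → ∃ y : A.adjoint.domain, (y : E) = h t ∧ A.adjoint y = 0) ∧
  ∃ δ > 0, ∀ t, 0 ≤ t → t ≤ δ → h t = 0

/-- `u` is a classical (smooth) solution of `u_tt + A* u = 0` (`t > 0`),
`u(0) = u_t(0) = 0`, `Γ₁ u = h` (`t ≥ 0`). -/
structure IsSmoothWave (A : E →ₗ.[ℂ] E) (hA : IsPositiveDefinite A) (h u : ℝ → E) : Prop where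
  smooth : ContDiffOn ℝ ∞ u (Ici 0)
  equation : ∀ t, 0 < t → ∃ y : A.adjoint.domain, (y : E) = u t ∧
    iteratedDerivWithin 2 u (Ici 0) t + A.adjoint y = 0
  initial : u 0 = 0
  initial_deriv : derivWithin u (Ici 0) 0 = 0
  boundary : ∀ t, 0 ≤ t → ∃ y : A.adjoint.domain, (y : E) = u t ∧ boundaryOp A hA y = h t

/-- The states `u^h(T)` reachable at time `T`. -/
def reachableSet (A : E →ₗ.[ℂ] E) (hA : IsPositiveDefinite A) (T : ℝ) : Set E :=
  {x | ∃ h u : ℝ → E, IsControl A h ∧ IsSmoothWave A hA h u ∧ u T = x}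

/-- The reachable subspace: the closure of the reachable set.  (The reachable set is already
linear, since the system is; taking the span adds nothing.) -/
def reachableSubspace (A : E →ₗ.[ℂ] E) (hA : IsPositiveDefinite A) (T : ℝ) :
    ClosedSubmodule ℂ E :=
  (Submodule.span ℂ (reachableSet A hA T)).closure

/-- The family of all reachable subspaces. -/
def reachableSubspaces (A : E →ₗ.[ℂ] E) (hA : IsPositiveDefinite A) :
    Set (ClosedSubmodule ℂ E) :=
  {B | ∃ T : ℝ, 0 ≤ T ∧ B = reachableSubspace A hA T}

/-! ### The wave isotony -/

/-- The bounded operator `L^{-1/2} sin (t L^{1/2})`, obtained by the continuous functional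
calculus of the bounded positive operator `L⁻¹`: in terms of `μ = λ⁻¹`, the function
`λ^{-1/2} sin (t λ^{1/2})` is `√μ sin (t / √μ)`, which is continuous on `[0, ∞)` with value `0`
at `μ = 0`. -/
noncomputable def sineOp (A : E →ₗ.[ℂ] E) (hA : IsPositiveDefinite A) (t : ℝ) : E →L[ℂ] E :=
  cfc (fun μ : ℝ => √μ * Real.sin (t / √μ)) (boundedInverse (friedrichs A hA))

/-- The solution `v^g(t) = ∫₀ᵗ L^{-1/2} sin ((t - s) L^{1/2}) g(s) ds` of
`v_tt + L v = g`, `v(0) = v_t(0) = 0`. -/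
noncomputable def sourceWave (A : E →ₗ.[ℂ] E) (hA : IsPositiveDefinite A) (g : ℝ → E) (t : ℝ) :
    E :=
  ∫ s in (0 : ℝ)..t, sineOp A hA (t - s) (g s)

/-- The states `v^g(t)` for sources `g ∈ L₂^loc([0,∞); G)`. -/
def sourceReachableSet (A : E →ₗ.[ℂ] E) (hA : IsPositiveDefinite A) (t : ℝ)
    (G : ClosedSubmodule ℂ E) : Set E :=
  {x | ∃ g : ℝ → E, (∀ T : ℝ, 0 < T → MemLp g 2 (volume.restrict (Ioc 0 T))) ∧
    (∀ s, 0 ≤ s → g s ∈ G) ∧ sourceWave A hA g t = x}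

open scoped Classical in
/-- The wave isotony: `I⁰ = id`, and `Iᵗ G` is the closure of the set of states `v^g(t)` with
`G`-valued sources for `t > 0`.  (That set is already linear; taking the span adds nothing.) -/
noncomputable def waveIsotony (A : E →ₗ.[ℂ] E) (hA : IsPositiveDefinite A) (t : ℝ)
    (G : ClosedSubmodule ℂ E) : ClosedSubmodule ℂ E :=
  if t = 0 then G else (Submodule.span ℂ (sourceReachableSet A hA t G)).closure

/-- The lattice determined by the operator `A`: the minimal lattice that contains all reachable
subspaces and is invariant under the wave isotony. -/
noncomputable def operatorLattice (A : E →ₗ.[ℂ] E) (hA : IsPositiveDefinite A) :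
    Set (ClosedSubmodule ℂ E) :=
  minimalLattice (waveIsotony A hA) (reachableSubspaces A hA)

end Operator

/-! ### The Sturm-Liouville operator on the half-line -/

/-- The complex Hilbert space `L₂(0, ∞)`. -/
abbrev HalfLine : Type := Lp ℂ 2 (volume.restrict (Ioi (0 : ℝ)))

/-- `Y` is of class `H²_loc` on the closed half-line `[0, ∞)`, with first and second derivatives
`Y₁` and `Y₂`: `Y` is `C¹` up to `0`, `Y₁ = Y'` is locally absolutely continuous, and `Y₂ = Y''`
is square integrable on every bounded interval `(0, R)`. -/
structure IsH2Loc (Y Y₁ Y₂ : ℝ → ℂ) : Prop where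
  memLp : ∀ R : ℝ, 0 < R → MemLp Y₂ 2 (volume.restrict (Ioc 0 R))
  deriv_eq : ∀ x : ℝ, 0 ≤ x → Y₁ x = Y₁ 0 + ∫ s in (0 : ℝ)..x, Y₂ s
  eq : ∀ x : ℝ, 0 ≤ x → Y x = Y 0 + ∫ s in (0 : ℝ)..x, Y₁ s

theorem IsH2Loc.intervalIntegrable₂ {Y Y₁ Y₂ : ℝ → ℂ} (h : IsH2Loc Y Y₁ Y₂) {x : ℝ}
    (hx : 0 ≤ x) : IntervalIntegrable Y₂ volume 0 x := by
  rcases hx.eq_or_lt with rfl | hx'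
  · simp
  rw [intervalIntegrable_iff_integrableOn_Ioc_of_le hx]
  exact (h.memLp x hx').integrable (by norm_num)

theorem continuousOn_of_eq_primitive {F f : ℝ → ℂ}
    (hf : ∀ R : ℝ, 0 ≤ R → IntervalIntegrable f volume 0 R)
    (h : ∀ x : ℝ, 0 ≤ x → F x = F 0 + ∫ s in (0 : ℝ)..x, f s) : ContinuousOn F (Ici 0) := by
  have key : ∀ R : ℝ, 0 ≤ R → ContinuousOn F (Icc 0 R) := by
    intro R hR
    have h1 := intervalIntegral.continuousOn_primitive_interval (μ := volume) (f := f) (a := 0)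
      (b := R) (by
        rw [uIcc_of_le hR, integrableOn_Icc_iff_integrableOn_Ioc,
          ← intervalIntegrable_iff_integrableOn_Ioc_of_le hR]
        exact hf R hR)
    rw [uIcc_of_le hR] at h1
    exact (continuousOn_const.add h1).congr fun x hx => h x hx.1
  intro x hx
  have hx0 : (0 : ℝ) ≤ x := hx
  refine (key (x + 1) (by linarith) x ⟨hx0, by linarith⟩).mono_of_mem_nhdsWithin ?_
  rw [← Ici_inter_Iic]
  exact inter_mem_nhdsWithin _ (Iic_mem_nhds (by linarith))

theorem IsH2Loc.continuousOn₁ {Y Y₁ Y₂ : ℝ → ℂ} (h : IsH2Loc Y Y₁ Y₂) :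
    ContinuousOn Y₁ (Ici 0) :=
  continuousOn_of_eq_primitive (fun _ hR => h.intervalIntegrable₂ hR) h.deriv_eq

theorem IsH2Loc.intervalIntegrable₁ {Y Y₁ Y₂ : ℝ → ℂ} (h : IsH2Loc Y Y₁ Y₂) {x : ℝ}
    (hx : 0 ≤ x) : IntervalIntegrable Y₁ volume 0 x := by
  refine ContinuousOn.intervalIntegrable ?_
  rw [uIcc_of_le hx]
  exact h.continuousOn₁.mono Icc_subset_Ici_self

theorem IsH2Loc.add {Y Y₁ Y₂ Z Z₁ Z₂ : ℝ → ℂ} (h : IsH2Loc Y Y₁ Y₂) (k : IsH2Loc Z Z₁ Z₂) :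
    IsH2Loc (Y + Z) (Y₁ + Z₁) (Y₂ + Z₂) where
  memLp R hR := (h.memLp R hR).add (k.memLp R hR)
  deriv_eq x hx := by
    simp only [Pi.add_apply]
    rw [intervalIntegral.integral_add (h.intervalIntegrable₂ hx) (k.intervalIntegrable₂ hx),
      h.deriv_eq x hx, k.deriv_eq x hx]
    ring
  eq x hx := by
    simp only [Pi.add_apply]
    rw [intervalIntegral.integral_add (h.intervalIntegrable₁ hx) (k.intervalIntegrable₁ hx),
      h.eq x hx, k.eq x hx]
    ring

theorem IsH2Loc.smul {Y Y₁ Y₂ : ℝ → ℂ} (h : IsH2Loc Y Y₁ Y₂) (c : ℂ) :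
    IsH2Loc (c • Y) (c • Y₁) (c • Y₂) where
  memLp R hR := (h.memLp R hR).const_smul c
  deriv_eq x hx := by
    simp only [Pi.smul_apply]
    rw [intervalIntegral.integral_smul, h.deriv_eq x hx, smul_add]
  eq x hx := by
    simp only [Pi.smul_apply]
    rw [intervalIntegral.integral_smul, h.eq x hx, smul_add]

/-- The graph of the operator `L₀`: pairs `(y, z)` of elements of `L₂(0, ∞)` such that `y` is of
class `H²_loc[0, ∞)`, `y(0) = y'(0) = 0` and `z = -y'' + q y`. -/
def slGraph (q : ℝ → ℝ) : Submodule ℂ (HalfLine × HalfLine) where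
  carrier := {p | ∃ Y Y₁ Y₂ : ℝ → ℂ, IsH2Loc Y Y₁ Y₂ ∧ Y 0 = 0 ∧ Y₁ 0 = 0 ∧
    p.1 =ᵐ[volume.restrict (Ioi (0 : ℝ))] Y ∧
    p.2 =ᵐ[volume.restrict (Ioi (0 : ℝ))] fun x => -Y₂ x + (q x : ℂ) * Y x}
  zero_mem' := by
    refine ⟨0, 0, 0, ⟨fun R _ => MemLp.zero, by simp, by simp⟩, rfl, rfl, Lp.coeFn_zero _ _ _, ?_⟩
    filter_upwards [Lp.coeFn_zero ℂ 2 (volume.restrict (Ioi (0 : ℝ)))] with x hx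
    simpa using hx
  add_mem' := by
    rintro ⟨y, z⟩ ⟨y', z'⟩ ⟨Y, Y₁, Y₂, h, h0, h1, hy, hz⟩ ⟨Z, Z₁, Z₂, k, k0, k1, ky, kz⟩
    refine ⟨_, _, _, h.add k, by simp [h0, k0], by simp [h1, k1], ?_, ?_⟩
    · exact (Lp.coeFn_add y y').trans (hy.add ky)
    · refine (Lp.coeFn_add z z').trans ?_
      filter_upwards [hz, kz] with x h1 h2
      simp only [Pi.add_apply] at *
      rw [h1, h2]
      ring
  smul_mem' := by
    rintro c ⟨y, z⟩ ⟨Y, Y₁, Y₂, h, h0, h1, hy, hz⟩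
    refine ⟨_, _, _, h.smul c, by simp [h0], by simp [h1], ?_, ?_⟩
    · refine (Lp.coeFn_smul c y).trans ?_
      filter_upwards [hy] with x h1
      simp only [Pi.smul_apply] at *
      rw [h1]
    · refine (Lp.coeFn_smul c z).trans ?_
      filter_upwards [hz] with x h1
      simp only [Pi.smul_apply, smul_eq_mul] at *
      rw [h1]
      ring

/-- A primitive that vanishes on the half-line has an almost everywhere vanishing integrand. -/
theorem ae_zero_of_integral_zero {f : ℝ → ℂ}
    (hf : ∀ R : ℝ, 0 ≤ R → IntervalIntegrable f volume 0 R)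
    (h0 : ∀ x : ℝ, 0 ≤ x → ∫ s in (0 : ℝ)..x, f s = 0) :
    ∀ᵐ x ∂(volume.restrict (Ioi (0 : ℝ))), f x = 0 := by
  have h1 : ∀ᵐ x : ℝ, ∀ n : ℕ, x ∈ uIcc (0 : ℝ) n → ∀ c ∈ uIcc (0 : ℝ) n,
      HasDerivAt (fun x => ∫ t in c..x, f t) (f x) x :=
    ae_all_iff.2 fun n => (hf n n.cast_nonneg).ae_hasDerivAt_integral
  rw [ae_restrict_iff' measurableSet_Ioi]
  filter_upwards [h1] with x hx hx0
  obtain ⟨n, hn⟩ := exists_nat_ge x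
  have hx0' : (0 : ℝ) < x := hx0
  have h2 := hx n (by rw [uIcc_of_le n.cast_nonneg]; exact ⟨hx0'.le, hn⟩) 0 left_mem_uIcc
  have h3 : HasDerivAt (fun x => ∫ t in (0 : ℝ)..x, f t) 0 x := by
    refine (hasDerivAt_const x (0 : ℂ)).congr_of_eventuallyEq ?_
    filter_upwards [Ioi_mem_nhds hx0'] with y hy
    exact h0 y (le_of_lt hy)
  exact h2.unique h3

theorem slGraph_single_valued (q : ℝ → ℝ) :
    ∀ p ∈ slGraph q, p.1 = 0 → p.2 = 0 := by
  rintro ⟨y, z⟩ ⟨Y, Y₁, Y₂, h, h0, h1, hy, hz⟩ (rfl : y = 0)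
  have hY : ∀ᵐ x ∂(volume.restrict (Ioi (0 : ℝ))), Y x = 0 := by
    filter_upwards [hy, Lp.coeFn_zero ℂ 2 (volume.restrict (Ioi (0 : ℝ)))] with x h1 h2
    rw [← h1]
    simpa using h2
  have hYc : ContinuousOn Y (Ici 0) :=
    continuousOn_of_eq_primitive (fun _ hR => h.intervalIntegrable₁ hR) h.eq
  have hY0 : EqOn Y 0 (Ioi 0) :=
    Measure.eqOn_open_of_ae_eq hY isOpen_Ioi (hYc.mono Ioi_subset_Ici_self) continuousOn_const
  have hI₁ : ∀ x : ℝ, 0 ≤ x → ∫ s in (0 : ℝ)..x, Y₁ s = 0 := by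
    intro x hx
    have h2 := h.eq x hx
    rcases hx.eq_or_lt with rfl | hx'
    · simp
    · rw [hY0 hx', h0] at h2
      simpa using h2.symm
  have hY₁ := ae_zero_of_integral_zero (fun R hR => h.intervalIntegrable₁ hR) hI₁
  have hY₁0 : EqOn Y₁ 0 (Ioi 0) :=
    Measure.eqOn_open_of_ae_eq hY₁ isOpen_Ioi (h.continuousOn₁.mono Ioi_subset_Ici_self)
      continuousOn_const
  have hI₂ : ∀ x : ℝ, 0 ≤ x → ∫ s in (0 : ℝ)..x, Y₂ s = 0 := by
    intro x hx
    have h2 := h.deriv_eq x hx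
    rcases hx.eq_or_lt with rfl | hx'
    · simp
    · rw [hY₁0 hx', h1] at h2
      simpa using h2.symm
  have hY₂ := ae_zero_of_integral_zero (fun R hR => h.intervalIntegrable₂ hR) hI₂
  apply Lp.ext
  filter_upwards [hz, hY, hY₂, Lp.coeFn_zero ℂ 2 (volume.restrict (Ioi (0 : ℝ)))]
    with x e1 e2 e3 e4
  rw [e4]
  refine e1.trans ?_
  simp [e2, e3]

/-- The operator `L₀ y = -y'' + q y` in `L₂(0, ∞)` with domain
`{y ∈ L₂ ∩ H²_loc[0, ∞) | y(0) = y'(0) = 0, -y'' + q y ∈ L₂}`. -/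
noncomputable def slOperator (q : ℝ → ℝ) : HalfLine →ₗ.[ℂ] HalfLine :=
  (slGraph q).toLinearPMap

theorem slOperator_graph (q : ℝ → ℝ) : (slOperator q).graph = slGraph q :=
  Submodule.toLinearPMap_graph_eq _ (slGraph_single_valued q)

/-- The limit point case (at infinity) for `-y'' + q y`: for some `λ`, not every solution of
`-y'' + q y = λ y` on the half-line is square integrable.  (By Weyl's alternative this does not
depend on `λ`.) -/
def IsLimitPoint (q : ℝ → ℝ) : Prop :=
  ∃ (l : ℂ) (Y Y₁ : ℝ → ℂ),
    (∀ x : ℝ, 0 ≤ x → HasDerivWithinAt Y (Y₁ x) (Ici 0) x) ∧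
    (∀ x : ℝ, 0 ≤ x → HasDerivWithinAt Y₁ (((q x : ℂ) - l) * Y x) (Ici 0) x) ∧
    ¬ MemLp Y 2 (volume.restrict (Ioi (0 : ℝ)))

/-- The subspace `L₂(E) = {y ∈ L₂(0, ∞) | y = 0 a.e. outside E}`. -/
def L2On (E : Set ℝ) : ClosedSubmodule ℂ HalfLine where
  carrier := {y | ∀ᵐ x ∂(volume.restrict (Ioi (0 : ℝ))), x ∉ E → y x = 0}
  zero_mem' := by
    filter_upwards [Lp.coeFn_zero ℂ 2 (volume.restrict (Ioi (0 : ℝ)))] with x hx _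
    simpa using hx
  add_mem' := by
    intro y z hy hz
    filter_upwards [hy, hz, Lp.coeFn_add y z] with x h1 h2 h3 hx
    rw [h3, Pi.add_apply, h1 hx, h2 hx, add_zero]
  smul_mem' := by
    intro c y hy
    filter_upwards [hy, Lp.coeFn_smul c y] with x h1 h2 hx
    rw [h2, Pi.smul_apply, h1 hx, smul_zero]
  isClosed' := by
    refine IsSeqClosed.isClosed fun y z hy hyz => ?_
    obtain ⟨ns, -, hns⟩ := (tendstoInMeasure_of_tendsto_Lp hyz).exists_seq_tendsto_ae
    have h1 : ∀ᵐ x ∂(volume.restrict (Ioi (0 : ℝ))), ∀ n, x ∉ E → y n x = 0 :=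
      ae_all_iff.2 hy
    filter_upwards [h1, hns] with x h2 h3 hx
    refine tendsto_nhds_unique h3 ?_
    simp [fun n => h2 n hx]

/-- The Lebesgue measurable subsets of the closed half-line. -/
def halfLineLeb : Set (Set ℝ) := {E | NullMeasurableSet E volume ∧ E ⊆ Ici 0}

end WaveSpectrum

/-! Write R = L⁻¹ and S(t) = L^{-1/2} sin(t L^{1/2}). Both are bounded, and S is a norm-continuous
function of t. A subspace defined as the closure of a set of wave states is found by describing its
orthogonal complement, and each complement is governed by the one-dimensional wave equation through
finite speed of propagation and unique continuation.

Boundary control. One vector k represents f ↦ (L⁻¹f)'(0), and it spans Ker L₀*. A vector y is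
orthogonal to all states at time T iff ⟨k, S(s)y⟩ is linear in s, equal to s⟨k, y⟩, on [0, T].
Unique continuation from x = 0 turns this into y = 0 on (0, T), and finite speed gives the converse
(`reachableSubspace_slOperator`). Interior sources. A vector y is orthogonal to Iᵗ L₂(A) iff S(s)y
vanishes on A for 0 ≤ s ≤ t, iff y vanishes at all points closer than t to the essential support of
A (`waveIsotony_L2On`). Only Cauchy data at a support point of A are needed, since zeros
accumulating at a point kill both value and derivative there.

The states are merely square integrable, so the wave equation is not applied to S(s)y itself. One
works with the pointwise values of L⁻¹f, represented by vectors e_x = `evalVec` that are C¹ in x and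
odd, which absorbs the Dirichlet condition. For unique continuation y is also replaced by S(ε)⁶y,
which lies in the range of R²; this costs time 6ε, and ε⁻⁶S(ε)⁶y → y as ε → 0. The classical
ingredient is uniqueness in a characteristic triangle (`eq_zero_of_wave`), used with time or with
space as the evolution variable.

Lattice. The family of all L₂(A) is a lattice, contains the reachable subspaces, is invariant under
the isotony, and is closed, because its members are exactly the subspaces whose projections commute
with multiplication by indicators (`exists_eq_L2On_of_commute`). Hence it contains the closure of
the lattice. Conversely, the sets A with L₂(A) in the lattice form an algebra that generates the
Borel sets, so every Borel set is approximated locally in measure (`L2On_mem_closure`). Convergence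
is read off from ‖1_F f − 1_E f‖² = ∫_{F △ E} |f|². -/

namespace WaveSpectrum

/-! ### The Friedrichs extension and its inverse. -/

section Friedrichs

variable {E : Type*} [NormedAddCommGroup E] [InnerProductSpace ℂ E]

/-- Over ℂ a real-valued quadratic form is Hermitian. Polarization with `x + y` compares the
imaginary parts, and with `x + i y` the real parts. -/
theorem IsPositiveDefinite.inner_map_comm {A : E →ₗ.[ℂ] E} (hA : IsPositiveDefinite A)
    (x y : A.domain) : ⟪A x, (y : E)⟫_ℂ = ⟪(x : E), A y⟫_ℂ := by
  obtain ⟨κ, -, h⟩ := hA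
  have h0 := fun z => (h z).1
  have h1 := h0 (x + y)
  have h2 := h0 (x + Complex.I • y)
  simp only [LinearPMap.map_add, LinearPMap.map_smul, Submodule.coe_add, Submodule.coe_smul,
    inner_add_left, inner_add_right, inner_smul_left, inner_smul_right, Complex.add_im, h0,
    Complex.conj_I] at h1 h2
  have h3 := inner_conj_symm (𝕜 := ℂ) (x : E) (A y)
  simp only [Complex.mul_im, Complex.mul_re, Complex.neg_re, Complex.neg_im, Complex.I_re,
    Complex.I_im, Complex.add_re, Complex.add_im, h0] at h1 h2
  apply Complex.ext
  · rw [← h3, Complex.conj_re]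
    linarith
  · rw [← h3, Complex.conj_im]
    linarith

/-- The domain of a positive definite operator, with the inner product `(x, A y)`. -/
def FormSpace (A : E →ₗ.[ℂ] E) (_ : IsPositiveDefinite A) : Type _ := A.domain

variable (A : E →ₗ.[ℂ] E) (hA : IsPositiveDefinite A)

instance : AddCommGroup (FormSpace A hA) := inferInstanceAs (AddCommGroup A.domain)
instance : Module ℂ (FormSpace A hA) := inferInstanceAs (Module ℂ A.domain)

/-- The identity map from the form space to the domain. -/
def FormSpace.toDomain : FormSpace A hA →ₗ[ℂ] A.domain := LinearMap.id

/-- The inner product `(x, A y)`. -/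
noncomputable instance formCore : InnerProductSpace.Core ℂ (FormSpace A hA) where
  inner x y := ⟪((FormSpace.toDomain A hA x : A.domain) : E), A (FormSpace.toDomain A hA y)⟫_ℂ
  conj_inner_symm x y := by
    rw [inner_conj_symm, hA.inner_map_comm]
  re_inner_nonneg x := by
    rw [← hA.inner_map_comm]
    exact quadForm_nonneg hA _
  add_left x y z := by
    simp only [map_add, Submodule.coe_add, inner_add_left]
  smul_left x y r := by
    simp only [map_smul, Submodule.coe_smul, inner_smul_left]
  definite x hx := by
    obtain ⟨κ, hκ, h⟩ := id hA
    have h1 := (h (FormSpace.toDomain A hA x)).2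
    rw [hA.inner_map_comm, hx] at h1
    have h2 : ‖((FormSpace.toDomain A hA x : A.domain) : E)‖ = 0 := by
      by_contra hne
      have : 0 < ‖((FormSpace.toDomain A hA x : A.domain) : E)‖ ^ 2 := by positivity
      simp at h1
      nlinarith
    rw [norm_eq_zero] at h2
    exact Subtype.ext h2

noncomputable instance : NormedAddCommGroup (FormSpace A hA) :=
  (formCore A hA).toNormedAddCommGroup

noncomputable instance : InnerProductSpace ℂ (FormSpace A hA) :=
  InnerProductSpace.ofCore (formCore A hA).toCore

theorem FormSpace.inner_eq (x y : FormSpace A hA) : ⟪x, y⟫_ℂ =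
    ⟪((FormSpace.toDomain A hA x : A.domain) : E), A (FormSpace.toDomain A hA y)⟫_ℂ := rfl

theorem FormSpace.norm_sq (x : FormSpace A hA) :
    ‖x‖ ^ 2 = quadForm A (FormSpace.toDomain A hA x) := by
  rw [← inner_self_eq_norm_sq (𝕜 := ℂ), FormSpace.inner_eq, ← hA.inner_map_comm]
  rfl

theorem FormSpace.exists_bound : ∃ C : ℝ, ∀ x : FormSpace A hA,
    ‖((FormSpace.toDomain A hA x : A.domain) : E)‖ ≤ C * ‖x‖ := by
  obtain ⟨κ, hκ, h⟩ := id hA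
  refine ⟨√(κ⁻¹), fun x => ?_⟩
  have h1 := (h (FormSpace.toDomain A hA x)).2
  have h2 := FormSpace.norm_sq A hA x
  rw [quadForm] at h2
  rw [← h2] at h1
  refine abs_le_of_sq_le_sq' ?_ (by positivity) |>.2
  rw [mul_pow, Real.sq_sqrt (by positivity)]
  field_simp
  linarith

/-- The embedding of the form space into the Hilbert space. -/
noncomputable def formEmbedding : FormSpace A hA →L[ℂ] E :=
  (A.domain.subtype.comp (FormSpace.toDomain A hA)).mkContinuousOfExistsBound
    (FormSpace.exists_bound A hA)

variable [CompleteSpace E]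

/-- The extension of the embedding to the completion of the form space. -/
noncomputable def formEmbeddingExt : UniformSpace.Completion (FormSpace A hA) →L[ℂ] E :=
  (formEmbedding A hA).extend (UniformSpace.Completion.toComplL)

theorem formEmbeddingExt_coe (x : FormSpace A hA) :
    formEmbeddingExt A hA (x : UniformSpace.Completion (FormSpace A hA)) =
      ((FormSpace.toDomain A hA x : A.domain) : E) := by
  exact ContinuousLinearMap.extend_eq (f := formEmbedding A hA)
    (e := UniformSpace.Completion.toComplL) UniformSpace.Completion.denseRange_coe
      (UniformSpace.Completion.isUniformInducing_coe _) x

/-- The inverse of the Friedrichs extension, constructed from the completed form space. -/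
noncomputable def friedrichsInverse : E →L[ℂ] E :=
  (formEmbeddingExt A hA).comp (ContinuousLinearMap.adjoint (formEmbeddingExt A hA))

theorem inner_adjoint_formEmbeddingExt (f : E) (a : FormSpace A hA) :
    ⟪ContinuousLinearMap.adjoint (formEmbeddingExt A hA) f,
      (a : UniformSpace.Completion (FormSpace A hA))⟫_ℂ =
      ⟪f, ((FormSpace.toDomain A hA a : A.domain) : E)⟫_ℂ := by
  rw [ContinuousLinearMap.adjoint_inner_left, formEmbeddingExt_coe]

/-- Both sides are continuous in `ξ` and agree on the dense form space. This is how the adjoint of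
`A` is recognised from the form. -/
theorem inner_formEmbeddingExt (ξ : UniformSpace.Completion (FormSpace A hA))
    (a : FormSpace A hA) :
    ⟪formEmbeddingExt A hA ξ, A (FormSpace.toDomain A hA a)⟫_ℂ =
      ⟪ξ, (a : UniformSpace.Completion (FormSpace A hA))⟫_ℂ := by
  induction ξ using UniformSpace.Completion.induction_on with
  | hp => exact isClosed_eq (by fun_prop) (by fun_prop)
  | ih x => rw [formEmbeddingExt_coe, UniformSpace.Completion.inner_coe, FormSpace.inner_eq]

/-- A form-Cauchy sequence in the domain is a Cauchy sequence of the completion. Together with the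
next lemma, this identifies the form domain with the range of the extended embedding. -/
theorem formEmbeddingExt_mem (ξ : UniformSpace.Completion (FormSpace A hA)) :
    formEmbeddingExt A hA ξ ∈ formDomain A hA := by
  have h := UniformSpace.Completion.denseRange_coe (α := FormSpace A hA) ξ
  obtain ⟨u, hu, hlim⟩ := mem_closure_iff_seq_limit.1 h
  choose a ha using hu
  refine ⟨fun n => FormSpace.toDomain A hA (a n), ?_, ?_⟩
  · have h1 := ((formEmbeddingExt A hA).continuous.tendsto ξ).comp hlim
    refine h1.congr fun n => ?_
    rw [Function.comp_apply, ← ha n, formEmbeddingExt_coe]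
  · have h1 : Tendsto (fun p : ℕ × ℕ => u p.1 - u p.2) atTop (𝓝 (ξ - ξ)) := by
      rw [← prod_atTop_atTop_eq]
      exact (hlim.comp tendsto_fst).sub (hlim.comp tendsto_snd)
    have h2 := h1.norm.pow 2
    simp only [sub_self, norm_zero, ne_eq, OfNat.ofNat_ne_zero, not_false_eq_true, zero_pow] at h2
    refine h2.congr fun p => ?_
    rw [← map_sub, ← FormSpace.norm_sq, ← ha, ← ha, ← UniformSpace.Completion.coe_sub,
      UniformSpace.Completion.norm_coe]

theorem exists_of_mem_formDomain {x : E} (hx : x ∈ formDomain A hA) :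
    ∃ ξ, formEmbeddingExt A hA ξ = x := by
  obtain ⟨a', ha, hq⟩ := hx
  obtain ⟨a, rfl⟩ : ∃ a : ℕ → FormSpace A hA, a' = fun n => FormSpace.toDomain A hA (a n) :=
    ⟨a', rfl⟩
  let b : ℕ → UniformSpace.Completion (FormSpace A hA) := fun n => a n
  have hc : CauchySeq b := by
    rw [Metric.cauchySeq_iff]
    intro ε hε
    have h1 := (hq.eventually_lt_const (pow_pos hε 2))
    rw [eventually_atTop] at h1
    obtain ⟨⟨N, M⟩, hN⟩ := h1
    refine ⟨max N M, fun m hm n hn => ?_⟩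
    have h2 := hN (m, n) ⟨(le_max_left _ _).trans hm, (le_max_right _ _).trans hn⟩
    have h3 : dist (b m) (b n) ^ 2 = quadForm A (FormSpace.toDomain A hA (a m) -
        FormSpace.toDomain A hA (a n)) := by
      simp only [b]
      rw [dist_eq_norm, ← UniformSpace.Completion.coe_sub, UniformSpace.Completion.norm_coe,
        FormSpace.norm_sq, map_sub]
    rw [← h3] at h2
    exact lt_of_pow_lt_pow_left₀ 2 hε.le h2
  obtain ⟨ξ, hξ⟩ := cauchySeq_tendsto_of_complete hc
  refine ⟨ξ, tendsto_nhds_unique (((formEmbeddingExt A hA).continuous.tendsto ξ).comp hξ) ?_⟩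
  refine ha.congr fun n => ?_
  simp only [Function.comp_apply, b]
  rw [formEmbeddingExt_coe]

theorem friedrichs_apply {x : E} (h : x ∈ formDomain A hA) (h' : x ∈ A.adjoint.domain) :
    friedrichs A hA ⟨x, h, h'⟩ = A.adjoint ⟨x, h'⟩ :=
  LinearPMap.domRestrict_apply rfl

/-- With J the extended embedding, ⟨f, a⟩ = ⟨J*f, a⟩_form = ⟨JJ*f, Aa⟩, so A*(JJ*f) = f, and JJ*f
lies in the form domain because the range of J does. Conversely, if x = Jξ and A*x = f, the same
identities give J*f = ξ by density, hence JJ*f = x. -/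
theorem friedrichsInverse_isBoundedInverse (hd : Dense (A.domain : Set E)) :
    IsBoundedInverse (friedrichs A hA) (friedrichsInverse A hA) := by
  constructor
  · intro f
    have h1 : ∀ a : A.domain, ⟪f, (a : E)⟫_ℂ = ⟪friedrichsInverse A hA f, A a⟫_ℂ := by
      intro a
      exact ((inner_formEmbeddingExt A hA
        (ContinuousLinearMap.adjoint (formEmbeddingExt A hA) f) a).trans
        (inner_adjoint_formEmbeddingExt A hA f a)).symm
    have hm : friedrichsInverse A hA f ∈ A.adjoint.domain :=
      LinearPMap.mem_adjoint_domain_of_exists _ ⟨f, h1⟩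
    refine ⟨⟨friedrichsInverse A hA f, formEmbeddingExt_mem A hA _, hm⟩, rfl, ?_⟩
    exact (friedrichs_apply A hA (formEmbeddingExt_mem A hA _) hm).trans
      (LinearPMap.adjoint_apply_eq hd _ h1)
  · rintro ⟨x, hx, hx'⟩
    obtain ⟨ξ, rfl⟩ := exists_of_mem_formDomain A hA hx
    rw [friedrichs_apply A hA hx hx']
    set f := A.adjoint ⟨_, hx'⟩ with hf
    change formEmbeddingExt A hA (ContinuousLinearMap.adjoint (formEmbeddingExt A hA) f) = _
    congr 1
    refine UniformSpace.Completion.denseRange_coe.eq_of_inner_left ℂ ?_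
    intro a
    rw [inner_adjoint_formEmbeddingExt, ← inner_formEmbeddingExt]
    exact LinearPMap.adjoint_isFormalAdjoint hd ⟨_, hx'⟩ (FormSpace.toDomain A hA a)

variable {A} {hA}

omit [CompleteSpace E] in
theorem IsBoundedInverse.unique {B : E →ₗ.[ℂ] E} {R R' : E →L[ℂ] E} (h : IsBoundedInverse B R)
    (h' : IsBoundedInverse B R') : R = R' := by
  ext f
  obtain ⟨x, hx, hBx⟩ := h.1 f
  rw [← hx, ← h'.2 x, hBx]

theorem boundedInverse_eq (hd : Dense (A.domain : Set E)) :
    boundedInverse (friedrichs A hA) = friedrichsInverse A hA := by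
  have h : ∃ R : E →L[ℂ] E, IsBoundedInverse (friedrichs A hA) R :=
    ⟨_, friedrichsInverse_isBoundedInverse A hA hd⟩
  rw [boundedInverse, dif_pos h]
  exact h.choose_spec.unique (friedrichsInverse_isBoundedInverse A hA hd)

theorem boundedInverse_isPositive (hd : Dense (A.domain : Set E)) :
    (boundedInverse (friedrichs A hA)).IsPositive := by
  rw [boundedInverse_eq hd]
  exact ContinuousLinearMap.isPositive_self_comp_adjoint _

theorem boundedInverse_mem_formDomain (hd : Dense (A.domain : Set E)) (f : E) :
    boundedInverse (friedrichs A hA) f ∈ formDomain A hA := by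
  rw [boundedInverse_eq hd]
  exact formEmbeddingExt_mem A hA _

theorem adjoint_boundedInverse (hd : Dense (A.domain : Set E)) (f : E) :
    ∃ y : A.adjoint.domain, (y : E) = boundedInverse (friedrichs A hA) f ∧ A.adjoint y = f := by
  rw [boundedInverse_eq hd]
  obtain ⟨⟨x, hx, hx'⟩, h1, h2⟩ := (friedrichsInverse_isBoundedInverse A hA hd).1 f
  refine ⟨⟨x, hx'⟩, h1, ?_⟩
  rw [← h2, friedrichs_apply A hA hx hx']

theorem boundedInverse_map (hd : Dense (A.domain : Set E)) (y : A.domain) :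
    boundedInverse (friedrichs A hA) (A y) = y := by
  rw [boundedInverse_eq hd]
  have hs : ∀ a : A.domain, ⟪A y, (a : E)⟫_ℂ = ⟪(y : E), A a⟫_ℂ := hA.inner_map_comm y
  have hm : (y : E) ∈ A.adjoint.domain :=
    LinearPMap.mem_adjoint_domain_of_exists _ ⟨A y, hs⟩
  have hf : (y : E) ∈ formDomain A hA := ⟨fun _ => y, by simp, by simp [quadForm]⟩
  have h := (friedrichsInverse_isBoundedInverse A hA hd).2 ⟨y, hf, hm⟩
  rw [friedrichs_apply A hA hf hm,
    LinearPMap.adjoint_apply_eq hd ⟨_, hm⟩ hs] at h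
  exact h

end Friedrichs

/-! ### Wave operators as functions of L⁻¹. -/

section FunctionalCalculus

/-- At `ν = 0` the value assigned to `t / 0` is irrelevant, because `|ν φ(t/ν)| ≤ |ν|`. This makes
the symbols of the wave operators continuous up to the point 0 of the spectrum of L⁻¹. -/
theorem continuous_mul_comp_div {φ : ℝ → ℝ} (hφ : Continuous φ) (hb : ∀ x, |φ x| ≤ 1) (t : ℝ) :
    Continuous fun ν : ℝ => ν * φ (t / ν) := by
  rw [continuous_iff_continuousAt]
  intro ν
  rcases eq_or_ne ν 0 with rfl | hν
  · have h : Tendsto (fun ν : ℝ => ν * φ (t / ν)) (𝓝 0) (𝓝 0) := by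
      refine squeeze_zero_norm (a := fun ν => |ν|) (fun ν => ?_) ?_
      · rw [Real.norm_eq_abs, abs_mul]
        exact mul_le_of_le_one_right (abs_nonneg _) (hb _)
      · simpa using (continuous_abs.tendsto (0 : ℝ))
    simpa [ContinuousAt] using h
  · exact continuousAt_id.mul (hφ.continuousAt.comp (continuousAt_const.div continuousAt_id hν))

theorem continuous_sqrt_mul_comp_div {φ : ℝ → ℝ} (hφ : Continuous φ) (hb : ∀ x, |φ x| ≤ 1)
    (t : ℝ) : Continuous fun μ : ℝ => √μ * φ (t / √μ) :=
  (continuous_mul_comp_div hφ hb t).comp Real.continuous_sqrt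

theorem abs_sin_add_sub_le (a b : ℝ) :
    |Real.sin (a + b) - Real.sin a - b * Real.cos a| ≤ 2 * b ^ 2 := by
  have h1 : |b - Real.sin b| ≤ b ^ 2 := by
    rcases le_total |b| 2 with hb | hb
    · refine (Real.abs_sub_sin_le b).trans ?_
      have := abs_nonneg b
      rw [← sq_abs b]
      nlinarith [mul_nonneg this this]
    -- For |b| ≥ 2 the crude bound 2|b| is already at most b².
    · have h2 : |b - Real.sin b| ≤ |b| + |Real.sin b| := abs_sub _ _
      have h3 : |Real.sin b| ≤ |b| := Real.abs_sin_le_abs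
      rw [← sq_abs b]
      nlinarith
  have h2 : |1 - Real.cos b| ≤ b ^ 2 := by
    rw [abs_of_nonneg (by linarith [Real.cos_le_one b])]
    nlinarith [Real.one_sub_sq_div_two_le_cos (x := b), sq_nonneg b]
  have h3 : Real.sin (a + b) - Real.sin a - b * Real.cos a =
      -(Real.sin a * (1 - Real.cos b) + Real.cos a * (b - Real.sin b)) := by
    rw [Real.sin_add]
    ring
  rw [h3, abs_neg]
  refine (abs_add_le _ _).trans ?_
  rw [abs_mul, abs_mul]
  have h4 := mul_le_mul (Real.abs_sin_le_one a) h2 (abs_nonneg _) zero_le_one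
  have h5 := mul_le_mul (Real.abs_cos_le_one a) h1 (abs_nonneg _) zero_le_one
  linarith

theorem abs_cos_add_sub_le (a b : ℝ) :
    |Real.cos (a + b) - Real.cos a + b * Real.sin a| ≤ 2 * b ^ 2 := by
  have h := abs_sin_add_sub_le (a + Real.pi / 2) b
  rw [Real.cos_add_pi_div_two, add_right_comm, Real.sin_add_pi_div_two,
    Real.sin_add_pi_div_two] at h
  simpa using h

variable {E : Type*} [NormedAddCommGroup E] [InnerProductSpace ℂ E] [CompleteSpace E]

/-- The functional calculus is norm-contractive, so a quadratic remainder bound uniform over the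
spectrum becomes differentiability in operator norm. -/
theorem hasDerivAt_cfc {R : E →L[ℂ] E} {f : ℝ → ℝ → ℝ} {g : ℝ → ℝ}
    {s C : ℝ} (hC : 0 ≤ C)
    (hf : ∀ t, ContinuousOn (f t) (spectrum ℝ R)) (hg : ContinuousOn g (spectrum ℝ R))
    (h : ∀ r, ∀ μ ∈ spectrum ℝ R, |f (s + r) μ - f s μ - r * g μ| ≤ C * r ^ 2) :
    HasDerivAt (fun t => cfc (f t) R) (cfc g R) s := by
  rw [hasDerivAt_iff_isLittleO_nhds_zero]
  refine Asymptotics.IsBigO.trans_isLittleO (g := fun r : ℝ => r ^ 2) ?_ ?_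
  · refine Asymptotics.IsBigO.of_bound C (Eventually.of_forall fun r => ?_)
    have h1 : cfc (f (s + r)) R - cfc (f s) R - r • cfc g R =
        cfc (fun μ => f (s + r) μ - f s μ - r * g μ) R := by
      rw [cfc_sub (fun μ => f (s + r) μ - f s μ) (fun μ => r * g μ) R ((hf _).sub (hf _))
        (continuousOn_const.mul hg), cfc_sub _ _ R (hf _) (hf _), cfc_const_mul r g R hg]
    rw [h1, Real.norm_of_nonneg (sq_nonneg r)]
    exact norm_cfc_le (by positivity) fun μ hμ => h r μ hμ
  · exact Asymptotics.isLittleO_pow_id one_lt_two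

/-- The operator `R^{1/2} sin (t R^{-1/2})`. -/
noncomputable def sineFun (R : E →L[ℂ] E) (t : ℝ) : E →L[ℂ] E :=
  cfc (fun μ : ℝ => √μ * Real.sin (t / √μ)) R

/-- The operator `R cos (t R^{-1/2})`. -/
noncomputable def cosFun (R : E →L[ℂ] E) (t : ℝ) : E →L[ℂ] E :=
  cfc (fun μ : ℝ => √μ * (√μ * Real.cos (t / √μ))) R

theorem continuousOn_sineFun (t : ℝ) (s : Set ℝ) :
    ContinuousOn (fun μ : ℝ => √μ * Real.sin (t / √μ)) s :=
  (continuous_sqrt_mul_comp_div Real.continuous_sin Real.abs_sin_le_one t).continuousOn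

theorem continuousOn_cosFun (t : ℝ) (s : Set ℝ) :
    ContinuousOn (fun μ : ℝ => √μ * (√μ * Real.cos (t / √μ))) s :=
  (Real.continuous_sqrt.mul
    (continuous_sqrt_mul_comp_div Real.continuous_cos Real.abs_cos_le_one t)).continuousOn

variable {R : E →L[ℂ] E}

theorem sineFun_zero : sineFun R 0 = 0 := by
  simp [sineFun, cfc_const_zero]

theorem sineFun_neg (t : ℝ) : sineFun R (-t) = -sineFun R t := by
  rw [sineFun, sineFun, ← cfc_neg]
  simp [neg_div]

theorem isSelfAdjoint_sineFun (t : ℝ) : IsSelfAdjoint (sineFun R t) := cfc_predicate _ _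

theorem sineFun_inner (t : ℝ) (x y : E) : ⟪sineFun R t x, y⟫_ℂ = ⟪x, sineFun R t y⟫_ℂ :=
  (ContinuousLinearMap.isSelfAdjoint_iff_isSymmetric.1 (isSelfAdjoint_sineFun t)) x y

theorem norm_sineFun_sub_le (s t : ℝ) : ‖sineFun R s - sineFun R t‖ ≤ |s - t| := by
  rw [sineFun, sineFun, ← cfc_sub _ _ _ (continuousOn_sineFun _ _) (continuousOn_sineFun _ _)]
  refine norm_cfc_le (abs_nonneg _) fun μ _ => ?_
  rw [← mul_sub, norm_mul, Real.norm_of_nonneg (Real.sqrt_nonneg μ)]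
  rcases eq_or_ne (√μ) 0 with h | h
  · simp [h]
  · have hp : 0 < √μ := lt_of_le_of_ne (Real.sqrt_nonneg μ) h.symm
    refine (mul_le_mul_of_nonneg_left (Real.abs_sin_sub_sin_le _ _) hp.le).trans_eq ?_
    rw [← sub_div, abs_div, abs_of_pos hp]
    field_simp

theorem norm_sineFun_le (t : ℝ) : ‖sineFun R t‖ ≤ |t| := by
  simpa [sineFun_zero] using norm_sineFun_sub_le (R := R) t 0

theorem continuous_sineFun : Continuous (sineFun R) :=
  (LipschitzWith.of_dist_le' (K := 1) fun s t => by
    rw [dist_eq_norm, Real.dist_eq, one_mul]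
    exact norm_sineFun_sub_le s t).continuous

theorem cfc_sqrt_mul_sqrt (hR : R.IsPositive) : cfc (fun μ : ℝ => √μ * √μ) R = R := by
  have h : (spectrum ℝ R).EqOn (fun μ : ℝ => √μ * √μ) id := fun μ hμ =>
    Real.mul_self_sqrt (SpectrumRestricts.nnreal_iff.1 hR.spectrumRestricts μ hμ)
  rw [cfc_congr h]
  exact cfc_id ℝ R hR.isSelfAdjoint

theorem cosFun_zero (hR : R.IsPositive) : cosFun R 0 = R := by
  simpa [cosFun] using cfc_sqrt_mul_sqrt hR

theorem commute_sineFun (hR : R.IsPositive) (t : ℝ) : Commute R (sineFun R t) := by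
  conv_lhs => rw [← cfc_sqrt_mul_sqrt hR]
  exact cfc_commute_cfc _ _ R

/-- Without the prefactor μ the remainder of cos(t/√μ) would blow up as μ → 0; with it the bound is
2r², independent of μ. -/
theorem hasDerivAt_cosFun (s : ℝ) :
    HasDerivAt (cosFun R) (-sineFun R s) s := by
  rw [sineFun, ← cfc_neg]
  refine hasDerivAt_cfc zero_le_two (fun t => continuousOn_cosFun t _)
    (continuousOn_sineFun s _).neg fun r μ _ => ?_
  rcases eq_or_ne (√μ) 0 with h | h
  · simp only [h]
    simp
    positivity
  · have h1 := abs_cos_add_sub_le (s / √μ) (r / √μ)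
    have h2 : √μ * (√μ * Real.cos ((s + r) / √μ)) - √μ * (√μ * Real.cos (s / √μ)) -
        r * -(√μ * Real.sin (s / √μ)) = √μ ^ 2 * (Real.cos (s / √μ + r / √μ) -
          Real.cos (s / √μ) + r / √μ * Real.sin (s / √μ)) := by
      rw [add_div]
      field_simp
      ring
    rw [h2, abs_mul, abs_of_nonneg (sq_nonneg _)]
    refine (mul_le_mul_of_nonneg_left h1 (sq_nonneg _)).trans_eq ?_
    field_simp

theorem hasDerivAt_mul_sineFun (hR : R.IsPositive) (s : ℝ) :
    HasDerivAt (fun t => R * sineFun R t) (cosFun R s) s := by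
  have h0 : (fun t => R * sineFun R t) =
      fun t => cfc (fun μ : ℝ => √μ * √μ * (√μ * Real.sin (t / √μ))) R := by
    funext t
    rw [cfc_mul (fun μ : ℝ => √μ * √μ) _ R (by fun_prop) (continuousOn_sineFun t _),
      cfc_sqrt_mul_sqrt hR, sineFun]
  rw [h0]
  -- The remainder is at most 2√μ r², and `‖R‖ ‖1‖` bounds the spectrum; keeping `‖1‖` covers the
  -- trivial space as well.
  refine hasDerivAt_cfc (C := 2 * √(‖R‖ * ‖(1 : E →L[ℂ] E)‖)) (by positivity)
    (fun t => ContinuousOn.mul (by fun_prop) (continuousOn_sineFun t _))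
    (continuousOn_cosFun s _) fun r μ hμ => ?_
  have hμR : √μ ≤ √(‖R‖ * ‖(1 : E →L[ℂ] E)‖) := Real.sqrt_le_sqrt
    ((le_abs_self μ).trans (spectrum.norm_le_norm_mul_of_mem hμ))
  rcases eq_or_ne (√μ) 0 with h | h
  · simp only [h]
    simp
    positivity
  · have h1 := abs_sin_add_sub_le (s / √μ) (r / √μ)
    have h2 : √μ * √μ * (√μ * Real.sin ((s + r) / √μ)) - √μ * √μ * (√μ * Real.sin (s / √μ)) -
        r * (√μ * (√μ * Real.cos (s / √μ))) = √μ ^ 3 * (Real.sin (s / √μ + r / √μ) -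
          Real.sin (s / √μ) - r / √μ * Real.cos (s / √μ)) := by
      rw [add_div]
      field_simp
    rw [h2, abs_mul, abs_of_nonneg (by positivity)]
    refine (mul_le_mul_of_nonneg_left h1 (by positivity)).trans ?_
    have h3 : √μ ^ 3 * (2 * (r / √μ) ^ 2) = 2 * √μ * r ^ 2 := by field_simp
    rw [h3]
    gcongr

/-- The product-to-sum formula for sin a cos b. It expresses the derivative of S(s)S(t) in t by S
alone, so information on ⟨v, S(·)y⟩ passes to S(t)y. -/
theorem hasDerivAt_sineFun_mul_sineFun (s t : ℝ) :
    HasDerivAt (fun t => sineFun R s * sineFun R t)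
      ((1 / 2 : ℝ) • (sineFun R (s + t) + sineFun R (s - t))) t := by
  have h0 : (fun t => sineFun R s * sineFun R t) = fun t =>
      cfc (fun μ : ℝ => √μ * Real.sin (s / √μ) * (√μ * Real.sin (t / √μ))) R := by
    funext t
    rw [cfc_mul _ _ R (continuousOn_sineFun s _) (continuousOn_sineFun t _), sineFun, sineFun]
  have h1 : (1 / 2 : ℝ) • (sineFun R (s + t) + sineFun R (s - t)) =
      cfc (fun μ : ℝ => 1 / 2 *
        (√μ * Real.sin ((s + t) / √μ) + √μ * Real.sin ((s - t) / √μ))) R := by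
    rw [cfc_const_mul (1 / 2) (fun μ : ℝ =>
        √μ * Real.sin ((s + t) / √μ) + √μ * Real.sin ((s - t) / √μ)) R
        ((continuousOn_sineFun (s + t) _).add (continuousOn_sineFun (s - t) _)),
      cfc_add (a := R) _ _ (continuousOn_sineFun (s + t) _) (continuousOn_sineFun (s - t) _),
      sineFun, sineFun]
  rw [h0, h1]
  refine hasDerivAt_cfc zero_le_two
    (fun t => (continuousOn_sineFun s _).mul (continuousOn_sineFun t _))
    (continuousOn_const.mul ((continuousOn_sineFun (s + t) _).add (continuousOn_sineFun (s - t) _)))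
    fun r μ hμ => ?_
  rcases eq_or_ne (√μ) 0 with h | h
  · simp only [h]
    simp
    positivity
  · have h1 := abs_sin_add_sub_le (t / √μ) (r / √μ)
    have h2 : √μ * Real.sin (s / √μ) * (√μ * Real.sin ((t + r) / √μ)) -
        √μ * Real.sin (s / √μ) * (√μ * Real.sin (t / √μ)) -
        r * (1 / 2 * (√μ * Real.sin ((s + t) / √μ) + √μ * Real.sin ((s - t) / √μ))) =
        √μ ^ 2 * Real.sin (s / √μ) * (Real.sin (t / √μ + r / √μ) -
          Real.sin (t / √μ) - r / √μ * Real.cos (t / √μ)) := by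
      rw [add_div, add_div, sub_div, Real.sin_add (s / √μ), Real.sin_sub (s / √μ)]
      field_simp
      ring
    rw [h2, abs_mul, abs_mul, abs_of_nonneg (sq_nonneg (√μ)), mul_assoc]
    have h3 := mul_le_mul (Real.abs_sin_le_one (s / √μ)) h1 (abs_nonneg _) zero_le_one
    refine (mul_le_mul_of_nonneg_left h3 (sq_nonneg _)).trans_eq ?_
    field_simp

/-- The symbol μ³ sin⁶(t/√μ) is μ² times μ sin⁶(t/√μ), which is still continuous at 0. Sixth powers
of S(t) therefore map into the range of R². -/
theorem exists_sineFun_pow_eq (hR : R.IsPositive) (t : ℝ) :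
    ∃ Q : E →L[ℂ] E, sineFun R t ^ 6 = R * R * Q := by
  have hc : Continuous fun μ : ℝ => √μ * Real.sin (t / √μ) ^ 6 :=
    continuous_sqrt_mul_comp_div (φ := fun x => Real.sin x ^ 6) (by fun_prop) (fun x => by
      rw [abs_pow]
      exact pow_le_one₀ (abs_nonneg _) (Real.abs_sin_le_one x)) t
  refine ⟨cfc (fun μ : ℝ => √μ * (√μ * Real.sin (t / √μ) ^ 6)) R, ?_⟩
  have h1 : R * R * cfc (fun μ : ℝ => √μ * (√μ * Real.sin (t / √μ) ^ 6)) R =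
      cfc (fun μ : ℝ => √μ * √μ) R * cfc (fun μ : ℝ => √μ * √μ) R *
        cfc (fun μ : ℝ => √μ * (√μ * Real.sin (t / √μ) ^ 6)) R := by
    rw [cfc_sqrt_mul_sqrt hR]
  rw [h1, sineFun, ← cfc_pow _ _ _ (continuousOn_sineFun t _) hR.isSelfAdjoint,
    ← cfc_mul _ _ R (by fun_prop) (by fun_prop), ← cfc_mul _ _ R (by fun_prop) (by fun_prop)]
  congr 1
  funext μ
  ring

omit [CompleteSpace E] in
theorem tendsto_of_dense {T : ℝ → E →L[ℂ] E} {l : Filter ℝ} (hT : ∀ᶠ r in l, ‖T r‖ ≤ 1)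
    {D : Set E} (hD : Dense D) (h : ∀ x ∈ D, Tendsto (fun r => T r x) l (𝓝 x)) (y : E) :
    Tendsto (fun r => T r y) l (𝓝 y) := by
  rw [Metric.tendsto_nhds]
  intro ε hε
  obtain ⟨x, hxy, hx⟩ := Metric.dense_iff.1 hD y (ε / 3) (by positivity)
  filter_upwards [hT, Metric.tendsto_nhds.1 (h x hx) (ε / 3) (by positivity)] with r h1 h2
  have h3 : dist (T r y) (T r x) ≤ dist y x := by
    rw [dist_eq_norm, dist_eq_norm, ← map_sub]
    exact (T r).le_of_opNorm_le h1 _ |>.trans_eq (one_mul _)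
  have h4 := dist_triangle4 (T r y) (T r x) x y
  rw [Metric.mem_ball, dist_comm] at hxy
  linarith [dist_comm x y]

theorem norm_inv_smul_sineFun_le (r : ℝ) : ‖r⁻¹ • sineFun R r‖ ≤ 1 := by
  rw [norm_smul, norm_inv, Real.norm_eq_abs]
  rcases eq_or_ne r 0 with rfl | hr
  · simp
  · have h := norm_sineFun_le (R := R) r
    have h1 : 0 < |r| := abs_pos.2 hr
    rw [inv_mul_le_iff₀ h1]
    simpa using h

/-- The operators S(r)/r have norm at most 1, so strong convergence to the identity need only be
checked on the range of R, where it is the derivative of RS(r) at r = 0. -/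
theorem tendsto_sineFun_div (hR : R.IsPositive) (hd : DenseRange R) (y : E) :
    Tendsto (fun r : ℝ => (r⁻¹ • sineFun R r) y) (𝓝[≠] 0) (𝓝 y) := by
  refine tendsto_of_dense (Eventually.of_forall norm_inv_smul_sineFun_le) hd ?_ y
  rintro _ ⟨x, rfl⟩
  have h := (hasDerivAt_iff_tendsto_slope_zero.1 (hasDerivAt_mul_sineFun hR 0))
  have h1 : Tendsto (fun r : ℝ => (r⁻¹ • (R * sineFun R r)) x) (𝓝[≠] 0) (𝓝 (R x)) := by
    rw [cosFun_zero hR] at h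
    simp only [zero_add, sineFun_zero, mul_zero, sub_zero] at h
    exact ((ContinuousLinearMap.apply ℂ E x).continuous.tendsto _).comp h
  refine h1.congr fun r => ?_
  rw [commute_sineFun hR r]
  rfl

theorem tendsto_sineFun_div_pow (hR : R.IsPositive) (hd : DenseRange R) (y : E) (n : ℕ) :
    Tendsto (fun r : ℝ => ((r⁻¹ • sineFun R r) ^ n) y) (𝓝[≠] 0) (𝓝 y) := by
  induction n with
  | zero => simp
  | succ n ih =>
    rw [tendsto_iff_norm_sub_tendsto_zero] at ih ⊢
    have h := tendsto_iff_norm_sub_tendsto_zero.1 (tendsto_sineFun_div hR hd y)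
    have h3 := ih.add h
    rw [add_zero] at h3
    refine squeeze_zero (fun r => norm_nonneg _) (fun r => ?_) h3
    have h1 : ((r⁻¹ • sineFun R r) ^ (n + 1)) y - y =
        (r⁻¹ • sineFun R r) (((r⁻¹ • sineFun R r) ^ n) y - y) + ((r⁻¹ • sineFun R r) y - y) := by
      rw [pow_succ', mul_apply_eq_comp, map_sub]
      abel
    rw [h1]
    refine (norm_add_le _ _).trans (add_le_add ?_ le_rfl)
    have h2 := ContinuousLinearMap.le_of_opNorm_le _ (norm_inv_smul_sineFun_le (R := R) r)
      (((r⁻¹ • sineFun R r) ^ n) y - y)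
    rwa [one_mul] at h2

end FunctionalCalculus

/-! ### Absolutely continuous primitives. -/

section Primitives

theorem absolutelyContinuousOnInterval_const (c : ℂ) (a b : ℝ) :
    AbsolutelyContinuousOnInterval (fun _ => c) a b :=
  (LipschitzWith.const c).lipschitzOnWith.absolutelyContinuousOnInterval

/-- Real and imaginary parts are treated separately and recombined with the constants 1 and i. -/
theorem absolutelyContinuousOnInterval_integral {f : ℝ → ℂ} {a b : ℝ}
    (hf : IntervalIntegrable f volume a b) :
    AbsolutelyContinuousOnInterval (fun x => ∫ s in a..x, f s) a b := by
  have hre : IntervalIntegrable (fun s => (f s).re) volume a b := ⟨hf.1.re, hf.2.re⟩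
  have him : IntervalIntegrable (fun s => (f s).im) volume a b := ⟨hf.1.im, hf.2.im⟩
  have h3 : AbsolutelyContinuousOnInterval (fun x => (∫ s in a..x, (f s).re) • (1 : ℂ) +
      (∫ s in a..x, (f s).im) • Complex.I) a b :=
    ((hre.absolutelyContinuousOnInterval_intervalIntegral left_mem_uIcc).smul
      (absolutelyContinuousOnInterval_const 1 a b)).add
    ((him.absolutelyContinuousOnInterval_intervalIntegral left_mem_uIcc).smul
      (absolutelyContinuousOnInterval_const Complex.I a b))
  have key : ∀ x ∈ uIcc a b, (∫ s in a..x, (f s).re) • (1 : ℂ) +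
      (∫ s in a..x, (f s).im) • Complex.I = ∫ s in a..x, f s := by
    intro x hx
    have hfx : IntervalIntegrable f volume a x := hf.mono_set (uIcc_subset_uIcc_left hx)
    simp only [Complex.real_smul, mul_one]
    have e1 : ∫ s in a..x, (f s).re = (∫ s in a..x, f s).re :=
      intervalIntegral.intervalIntegral_re hfx
    have e2 : ∫ s in a..x, (f s).im = (∫ s in a..x, f s).im :=
      intervalIntegral.intervalIntegral_im hfx
    rw [e1, e2, Complex.re_add_im]
  rw [absolutelyContinuousOnInterval_iff] at h3 ⊢
  intro ε hε
  obtain ⟨δ, hδ, h⟩ := h3 ε hε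
  refine ⟨δ, hδ, fun E hE hlt => ?_⟩
  refine lt_of_eq_of_lt (Finset.sum_congr rfl fun i hi => ?_) (h E hE hlt)
  rw [key _ (hE.1 i hi).1, key _ (hE.1 i hi).2]

/-- The product rule for primitives of integrable functions. -/
theorem mul_eq_integral_of_eq_primitive {F f G g : ℝ → ℂ} {a b : ℝ} (hab : a ≤ b)
    (hf : IntervalIntegrable f volume a b) (hg : IntervalIntegrable g volume a b)
    (hF : ∀ x ∈ Icc a b, F x = F a + ∫ s in a..x, f s)
    (hG : ∀ x ∈ Icc a b, G x = G a + ∫ s in a..x, g s) :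
    F b * G b = F a * G a + ∫ s in a..b, (f s * G s + F s * g s) := by
  let F' := fun x => F a + ∫ s in a..x, f s
  let G' := fun x => G a + ∫ s in a..x, g s
  have hFac : AbsolutelyContinuousOnInterval F' a b :=
    (absolutelyContinuousOnInterval_const _ a b).add (absolutelyContinuousOnInterval_integral hf)
  have hGac : AbsolutelyContinuousOnInterval G' a b :=
    (absolutelyContinuousOnInterval_const _ a b).add (absolutelyContinuousOnInterval_integral hg)
  have hint : IntervalIntegrable (fun s => f s * G' s + F' s * g s) volume a b :=
    (hf.mul_continuousOn hGac.continuousOn).add (hg.continuousOn_mul hFac.continuousOn)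
  -- The product minus the primitive of its almost everywhere derivative is absolutely continuous
  -- with vanishing derivative, hence constant.
  have hac : AbsolutelyContinuousOnInterval
      (fun x => F' x * G' x - ∫ s in a..x, (f s * G' s + F' s * g s)) a b :=
    (hFac.smul hGac).sub (absolutelyContinuousOnInterval_integral hint)
  obtain ⟨C, hC⟩ := hac.const_of_ae_hasDerivAt_zero (by
    filter_upwards [hf.ae_hasDerivAt_integral, hg.ae_hasDerivAt_integral,
      hint.ae_hasDerivAt_integral] with x h1 h2 h3 hx
    have e1 := (h1 hx a left_mem_uIcc).const_add (F a)
    have e2 := (h2 hx a left_mem_uIcc).const_add (G a)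
    have e3 := (e1.mul e2).sub (h3 hx a left_mem_uIcc)
    rwa [sub_self] at e3)
  have h1 := hC a left_mem_uIcc
  have h2 := hC b right_mem_uIcc
  have h3 : ∫ s in a..b, (f s * G s + F s * g s) = ∫ s in a..b, (f s * G' s + F' s * g s) := by
    refine intervalIntegral.integral_congr fun s hs => ?_
    rw [uIcc_of_le hab] at hs
    simp only [F', G', ← hF s hs, ← hG s hs]
  simp only [intervalIntegral.integral_same, sub_zero] at h1
  rw [h3, hF b ⟨hab, le_rfl⟩, hG b ⟨hab, le_rfl⟩]
  have h4 : F' a * G' a = F a * G a := by simp [F', G']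
  rw [← h4, h1, ← h2]
  simp [F', G']

end Primitives

/-! ### Calculus in H²_loc. -/

section H2Loc

variable {Y Y₁ Y₂ Z Z₁ Z₂ : ℝ → ℂ}

theorem IsH2Loc.continuousOn (h : IsH2Loc Y Y₁ Y₂) : ContinuousOn Y (Ici 0) :=
  continuousOn_of_eq_primitive (fun _ hR => h.intervalIntegrable₁ hR) h.eq

theorem IsH2Loc.conj (h : IsH2Loc Y Y₁ Y₂) :
    IsH2Loc (fun x => star (Y x)) (fun x => star (Y₁ x)) (fun x => star (Y₂ x)) where
  memLp R hR := (h.memLp R hR).star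
  deriv_eq x hx := by
    rw [h.deriv_eq x hx, star_add]
    exact congrArg _ (intervalIntegral.intervalIntegral_conj).symm
  eq x hx := by
    rw [h.eq x hx, star_add]
    exact congrArg _ (intervalIntegral.intervalIntegral_conj).symm

/-- Lagrange's identity. -/
theorem IsH2Loc.lagrange (h : IsH2Loc Y Y₁ Y₂) (k : IsH2Loc Z Z₁ Z₂) {N : ℝ} (hN : 0 ≤ N) :
    ∫ s in (0 : ℝ)..N, (Y₂ s * Z s - Y s * Z₂ s) =
      Y₁ N * Z N - Y N * Z₁ N - (Y₁ 0 * Z 0 - Y 0 * Z₁ 0) := by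
  have h1 := mul_eq_integral_of_eq_primitive hN (h.intervalIntegrable₂ hN)
    (k.intervalIntegrable₁ hN) (fun x hx => h.deriv_eq x hx.1) (fun x hx => k.eq x hx.1)
  have h2 := mul_eq_integral_of_eq_primitive hN (h.intervalIntegrable₁ hN)
    (k.intervalIntegrable₂ hN) (fun x hx => h.eq x hx.1) (fun x hx => k.deriv_eq x hx.1)
  have hYc := h.continuousOn.mono (Icc_subset_Ici_self : Icc 0 N ⊆ _)
  have hZc := k.continuousOn.mono (Icc_subset_Ici_self : Icc 0 N ⊆ _)
  have hY₁c := h.continuousOn₁.mono (Icc_subset_Ici_self : Icc 0 N ⊆ _)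
  have hZ₁c := k.continuousOn₁.mono (Icc_subset_Ici_self : Icc 0 N ⊆ _)
  rw [← uIcc_of_le hN] at hYc hZc hY₁c hZ₁c
  have i1 := ((h.intervalIntegrable₂ hN).mul_continuousOn hZc).add
    ((k.intervalIntegrable₁ hN).continuousOn_mul hY₁c)
  have i2 := ((h.intervalIntegrable₁ hN).mul_continuousOn hZ₁c).add
    ((k.intervalIntegrable₂ hN).continuousOn_mul hYc)
  rw [h1, h2]
  have h3 := intervalIntegral.integral_sub i1 i2
  have h4 : ∀ s, Y₂ s * Z s - Y s * Z₂ s = (Y₂ s * Z s + Y₁ s * Z₁ s) -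
      (Y₁ s * Z₁ s + Y s * Z₂ s) := fun s => by ring
  simp only [h4]
  rw [h3]
  ring

theorem isH2Loc_primitive {w : ℝ → ℂ} (hw : ∀ R : ℝ, 0 < R → MemLp w 2 (volume.restrict (Ioc 0 R)))
    (α β : ℂ) : IsH2Loc (fun x => α + ∫ t in (0 : ℝ)..x, (β + ∫ s in (0 : ℝ)..t, w s))
      (fun x => β + ∫ s in (0 : ℝ)..x, w s) w where
  memLp := hw
  deriv_eq x hx := by simp
  eq x hx := by simp

end H2Loc

/-! ### A second-order du Bois-Reymond lemma. -/

section MaximalOperator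

/-- Lebesgue measure on the half-line. -/
noncomputable abbrev halfLineMeasure : Measure ℝ := volume.restrict (Ioi (0 : ℝ))

theorem memLp_halfLine_of_eq_zero {f : ℝ → ℂ} {N : ℝ}
    (hf : MemLp f 2 (volume.restrict (Ioc 0 N))) (h0 : ∀ x, N < x → f x = 0) :
    MemLp f 2 halfLineMeasure := by
  have h1 := ((memLp_indicator_iff_restrict measurableSet_Ioc).2 hf).mono_measure
    (Measure.restrict_le_self (s := Ioi (0 : ℝ)))
  refine h1.ae_eq ?_
  filter_upwards [ae_restrict_mem measurableSet_Ioi] with x hx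
  rcases le_or_gt x N with hxN | hxN
  · exact indicator_of_mem (show x ∈ Ioc 0 N from ⟨hx, hxN⟩) _
  · rw [h0 x hxN]
    exact indicator_of_notMem (fun h => not_le_of_gt hxN h.2) _

theorem memLp_Ioc_of_continuousOn {f : ℝ → ℂ} {N : ℝ} (hf : ContinuousOn f (Icc 0 N)) :
    MemLp f 2 (volume.restrict (Ioc 0 N)) := by
  obtain ⟨C, hC⟩ := isCompact_Icc.exists_bound_of_continuousOn hf
  refine MemLp.of_bound ((hf.mono Ioc_subset_Icc_self).aestronglyMeasurable measurableSet_Ioc) C ?_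
  filter_upwards [ae_restrict_mem measurableSet_Ioc] with x hx
  exact hC x (Ioc_subset_Icc_self hx)

theorem memLp_Ioc_mul {f g : ℝ → ℂ} {N : ℝ} (hf : ContinuousOn f (Icc 0 N))
    (hg : MemLp g 2 (volume.restrict (Ioc 0 N))) :
    MemLp (fun x => f x * g x) 2 (volume.restrict (Ioc 0 N)) := by
  obtain ⟨C, hC⟩ := isCompact_Icc.exists_bound_of_continuousOn hf
  refine MemLp.of_le_mul (c := C) hg
    (((hf.mono Ioc_subset_Icc_self).aestronglyMeasurable measurableSet_Ioc).mul hg.1) ?_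
  filter_upwards [ae_restrict_mem measurableSet_Ioc] with x hx
  rw [norm_mul]
  exact mul_le_mul_of_nonneg_right (hC x (Ioc_subset_Icc_self hx)) (norm_nonneg _)

theorem memLp_Ioc (v : HalfLine) (N : ℝ) : MemLp v 2 (volume.restrict (Ioc 0 N)) :=
  (Lp.memLp v).mono_measure (Measure.restrict_mono_set _ Ioc_subset_Ioi_self)

theorem intervalIntegrable_mul {f g : ℝ → ℂ} {N : ℝ} (hN : 0 ≤ N)
    (hf : MemLp f 2 (volume.restrict (Ioc 0 N))) (hg : MemLp g 2 (volume.restrict (Ioc 0 N))) :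
    IntervalIntegrable (fun x => f x * g x) volume 0 N := by
  rw [intervalIntegrable_iff_integrableOn_Ioc_of_le hN]
  exact hf.integrable_mul hg

theorem inner_toLp_eq (f : HalfLine) {G : ℝ → ℂ} (hG : MemLp G 2 halfLineMeasure) {N : ℝ}
    (hN : 0 ≤ N) (h0 : ∀ x, N < x → G x = 0) :
    ⟪f, hG.toLp G⟫_ℂ = ∫ s in (0 : ℝ)..N, star (f s) * G s := by
  rw [L2.inner_def, intervalIntegral.integral_of_le hN,
    ← setIntegral_eq_of_subset_of_forall_sdiff_eq_zero measurableSet_Ioi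
      (Ioc_subset_Ioi_self : Ioc 0 N ⊆ Ioi 0)]
  · refine integral_congr_ae ?_
    filter_upwards [hG.coeFn_toLp] with x hx
    rw [hx, RCLike.inner_apply, mul_comm]
    rfl
  · intro x hx
    rw [h0 x (by
      by_contra hc
      exact hx.2 ⟨hx.1, not_lt.1 hc⟩), mul_zero]

theorem continuousOn_ofReal_comp {q : ℝ → ℝ} (hq : ContinuousOn q (Ici 0)) (N : ℝ) :
    ContinuousOn (fun x => (q x : ℂ)) (Icc 0 N) :=
  (Complex.continuous_ofReal.comp_continuousOn hq).mono Icc_subset_Ici_self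

/-- A function that is orthogonal to the second derivatives of all functions with vanishing Cauchy
data at both ends of an interval is affine. -/
theorem exists_affine_of_integral_eq_zero {d : ℝ → ℂ} {N : ℝ} (hN : 0 < N)
    (hd : MemLp d 2 (volume.restrict (Ioc 0 N)))
    (h : ∀ Z Z₁ Z₂ : ℝ → ℂ, IsH2Loc Z Z₁ Z₂ → Z 0 = 0 → Z₁ 0 = 0 →
      (∀ x, N ≤ x → Z x = 0) → (∀ x, N ≤ x → Z₁ x = 0) → (∀ x, N < x → Z₂ x = 0) →
      ∫ s in (0 : ℝ)..N, star (d s) * Z₂ s = 0) :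
    ∃ α β : ℂ, ∀ᵐ x ∂(volume.restrict (Ioc 0 N)), d x = α + β * x := by
  have memInd : ∀ {f : ℝ → ℂ}, MemLp f 2 (volume.restrict (Ioc 0 N)) →
      MemLp ((Ioc 0 N).indicator f) 2 halfLineMeasure := fun hf =>
    ((memLp_indicator_iff_restrict measurableSet_Ioc).2 hf).mono_measure Measure.restrict_le_self
  have indZero : ∀ (f : ℝ → ℂ) (x : ℝ), N < x → (Ioc 0 N).indicator f x = 0 := fun f x hx =>
    indicator_of_notMem (fun h => not_le_of_gt hx h.2) _
  have innerInd : ∀ {f : ℝ → ℂ} (hf : MemLp f 2 (volume.restrict (Ioc 0 N))) (g : HalfLine),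
      ⟪g, (memInd hf).toLp _⟫_ℂ = ∫ s in (0 : ℝ)..N, star (g s) * f s := by
    intro f hf g
    rw [inner_toLp_eq g (memInd hf) hN.le (indZero f)]
    refine intervalIntegral.integral_congr_ae (Eventually.of_forall fun x hx => ?_)
    rw [uIoc_of_le hN.le] at hx
    rw [indicator_of_mem hx]
  have m0 : MemLp (fun _ => (1 : ℂ)) 2 (volume.restrict (Ioc 0 N)) :=
    memLp_Ioc_of_continuousOn continuousOn_const
  have m1 : MemLp (fun x : ℝ => (x : ℂ)) 2 (volume.restrict (Ioc 0 N)) :=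
    memLp_Ioc_of_continuousOn Complex.continuous_ofReal.continuousOn
  let e0 : HalfLine := (memInd m0).toLp _
  let e1 : HalfLine := (memInd m1).toLp _
  let D : HalfLine := (memInd hd).toLp _
  -- A finite-dimensional span is its own double orthogonal complement. It suffices that every `g`
  -- orthogonal to 1 and x is, on (0, N), the second derivative of an admissible Z, namely of its
  -- double primitive.
  have hD : D ∈ Submodule.span ℂ {e0, e1} := by
    have : FiniteDimensional ℂ (Submodule.span ℂ {e0, e1}) :=
      FiniteDimensional.span_of_finite ℂ (toFinite _)
    rw [← Submodule.orthogonal_orthogonal (Submodule.span ℂ {e0, e1}), Submodule.mem_orthogonal]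
    intro g hg
    rw [Submodule.mem_orthogonal'] at hg
    have g0 := hg e0 (Submodule.subset_span (by simp))
    have g1 := hg e1 (Submodule.subset_span (by simp))
    rw [innerInd m0] at g0
    rw [innerInd m1] at g1
    have hG : ∀ R : ℝ, 0 < R → MemLp ((Ioc 0 N).indicator g) 2 (volume.restrict (Ioc 0 R)) :=
      fun R _ => ((memLp_indicator_iff_restrict measurableSet_Ioc).2
        (memLp_Ioc g N)).mono_measure Measure.restrict_le_self
    set G := (Ioc 0 N).indicator g with hGdef
    have hZ := isH2Loc_primitive hG 0 0
    simp only [zero_add] at hZ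
    -- Orthogonality to 1 makes the first primitive vanish from N on.
    have hZ1 : ∀ x, N ≤ x → ∫ s in (0 : ℝ)..x, G s = 0 := by
      intro x hx
      have e : ∫ s in (0 : ℝ)..x, G s = ∫ s in (0 : ℝ)..N, g s := by
        rw [intervalIntegral.integral_of_le (hN.le.trans hx), intervalIntegral.integral_of_le hN.le,
          hGdef, setIntegral_indicator measurableSet_Ioc,
          inter_eq_self_of_subset_right (Ioc_subset_Ioc_right hx)]
      rw [e]
      have := congrArg star g0
      rw [star_zero] at this
      rw [← this]
      simp only [mul_one]
      refine Eq.trans ?_ (intervalIntegral.intervalIntegral_conj)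
      simp
    -- Integration by parts against x: orthogonality to x makes the second primitive vanish at N.
    have hZ0 : ∫ s in (0 : ℝ)..N, (∫ t in (0 : ℝ)..s, G t) = 0 := by
      have h2 := mul_eq_integral_of_eq_primitive (F := fun x => ∫ t in (0 : ℝ)..x, G t) (f := G)
        (G := fun x => (x : ℂ)) (g := fun _ => 1) hN.le (hZ.intervalIntegrable₂ hN.le) (by simp)
        (fun x hx => by simp) (fun x hx => by simp)
      simp only [hZ1 N le_rfl, zero_mul, intervalIntegral.integral_same, zero_add, mul_one] at h2
      rw [intervalIntegral.integral_add] at h2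
      · have e : ∫ s in (0 : ℝ)..N, G s * (s : ℂ) = 0 := by
          have := congrArg star g1
          rw [star_zero] at this
          rw [← this]
          refine Eq.trans ?_ (intervalIntegral.intervalIntegral_conj)
          refine intervalIntegral.integral_congr_ae (Eventually.of_forall fun x hx => ?_)
          rw [uIoc_of_le hN.le] at hx
          simp [hGdef, indicator_of_mem hx]
        rw [e, zero_add] at h2
        exact h2.symm
      · exact (hZ.intervalIntegrable₂ hN.le).mul_continuousOn
          Complex.continuous_ofReal.continuousOn
      · exact hZ.intervalIntegrable₁ hN.le
    have hZ0' : ∀ x, N ≤ x → ∫ s in (0 : ℝ)..x, (∫ t in (0 : ℝ)..s, G t) = 0 := by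
      intro x hx
      rw [← intervalIntegral.integral_add_adjacent_intervals (hZ.intervalIntegrable₁ hN.le)
        ((hZ.intervalIntegrable₁ hN.le).symm.trans (hZ.intervalIntegrable₁ (hN.le.trans hx))),
        hZ0, zero_add]
      refine (intervalIntegral.integral_congr (g := fun _ => 0) fun s hs => ?_).trans (by simp)
      rw [uIcc_of_le hx] at hs
      exact hZ1 s hs.1
    have h3 := h _ _ _ hZ (by simp) (by simp) hZ0' hZ1 (indZero _)
    rw [innerInd hd]
    have h4 := congrArg star h3
    rw [star_zero] at h4
    rw [← h4]
    refine Eq.trans ?_ (intervalIntegral.intervalIntegral_conj)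
    refine intervalIntegral.integral_congr_ae (Eventually.of_forall fun x hx => ?_)
    rw [uIoc_of_le hN.le] at hx
    simp [hGdef, indicator_of_mem hx, mul_comm]
  obtain ⟨α, β, hαβ⟩ := Submodule.mem_span_pair.1 hD
  refine ⟨α, β, ?_⟩
  have hle := ae_mono (Measure.restrict_mono_set volume (Ioc_subset_Ioi_self : Ioc 0 N ⊆ Ioi 0))
  have h5 : D =ᵐ[halfLineMeasure] fun x => α * e0 x + β * e1 x := by
    rw [← hαβ]
    filter_upwards [Lp.coeFn_add (α • e0) (β • e1), Lp.coeFn_smul α e0, Lp.coeFn_smul β e1]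
      with x h1 h2 h3
    rw [h1, Pi.add_apply, h2, h3]
    rfl
  filter_upwards [hle h5, hle (memInd hd).coeFn_toLp, hle (memInd m0).coeFn_toLp,
    hle (memInd m1).coeFn_toLp, ae_restrict_mem measurableSet_Ioc] with x a1 a2 a3 a4 hx
  rw [a2, a3, a4, indicator_of_mem hx, indicator_of_mem hx, indicator_of_mem hx, mul_one] at a1
  exact a1

end MaximalOperator

/-! ### The adjoint operator and density of the domain. -/

section Maximal

variable {q : ℝ → ℝ}

theorem IsH2Loc.memLp_Ioc {Y Y₁ Y₂ : ℝ → ℂ} (h : IsH2Loc Y Y₁ Y₂) (N : ℝ) :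
    MemLp Y 2 (volume.restrict (Ioc 0 N)) :=
  memLp_Ioc_of_continuousOn (h.continuousOn.mono Icc_subset_Ici_self)

theorem toLp_mem_slGraph {Y Y₁ Y₂ : ℝ → ℂ} (h : IsH2Loc Y Y₁ Y₂) (h0 : Y 0 = 0) (h1 : Y₁ 0 = 0)
    (hY : MemLp Y 2 halfLineMeasure)
    (hz : MemLp (fun x => -Y₂ x + (q x : ℂ) * Y x) 2 halfLineMeasure) :
    (hY.toLp Y, hz.toLp _) ∈ slGraph q :=
  ⟨Y, Y₁, Y₂, h, h0, h1, hY.coeFn_toLp, hz.coeFn_toLp⟩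

theorem affine_unique {α β α' β' : ℂ}
    (h : ∀ᵐ x : ℝ ∂(volume.restrict (Ioc 0 1)), α + β * x = α' + β' * x) : α = α' ∧ β = β' := by
  have h1 : ∀ᵐ x : ℝ ∂(volume.restrict (Ioo 0 1)), α + β * x = α' + β' * x :=
    ae_mono (Measure.restrict_mono_set _ Ioo_subset_Ioc_self) h
  have h2 : EqOn (fun x : ℝ => α + β * x) (fun x : ℝ => α' + β' * x) (Ioo 0 1) :=
    Measure.eqOn_open_of_ae_eq h1 isOpen_Ioo (by fun_prop) (by fun_prop)
  have e1 := h2 (show (1 / 2 : ℝ) ∈ Ioo (0 : ℝ) 1 by constructor <;> norm_num)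
  have e2 := h2 (show (1 / 4 : ℝ) ∈ Ioo (0 : ℝ) 1 by constructor <;> norm_num)
  simp only [one_div, Complex.ofReal_inv, Complex.ofReal_ofNat] at e1 e2
  exact ⟨by linear_combination 2 * e2 - e1, by linear_combination 4 * e1 - 4 * e2⟩

/-- The adjoint of the minimal operator acts as `-y'' + q y`. -/
theorem exists_isH2Loc_of_inner_eq (hq : ContinuousOn q (Ici 0)) {v f : HalfLine}
    (h : ∀ p ∈ slGraph q, ⟪f, p.1⟫_ℂ = ⟪v, p.2⟫_ℂ) :
    ∃ Y Y₁ Y₂ : ℝ → ℂ, IsH2Loc Y Y₁ Y₂ ∧ v =ᵐ[halfLineMeasure] Y ∧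
      ∀ x, Y₂ x = (q x : ℂ) * v x - f x := by
  set w : ℝ → ℂ := fun x => (q x : ℂ) * v x - f x with hwdef
  have hqv : ∀ N, MemLp (fun x => (q x : ℂ) * v x) 2 (volume.restrict (Ioc 0 N)) := fun N =>
    memLp_Ioc_mul (continuousOn_ofReal_comp hq N) (memLp_Ioc v N)
  have hw : ∀ N, MemLp w 2 (volume.restrict (Ioc 0 N)) := fun N =>
    (hqv N).sub (memLp_Ioc f N)
  have hW := isH2Loc_primitive (fun R _ => hw R) 0 0
  simp only [zero_add] at hW
  -- W is a particular solution of W'' = q v − f, so v − W should be affine. Lagrange's identity for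
  -- W turns the hypothesis into orthogonality of v − W to all second derivatives of test functions.
  set W := fun x => ∫ t in (0 : ℝ)..x, (∫ s in (0 : ℝ)..t, w s) with hWdef
  have hd : ∀ N, MemLp (fun x => v x - W x) 2 (volume.restrict (Ioc 0 N)) := fun N =>
    (memLp_Ioc v N).sub (hW.memLp_Ioc N)
  have key : ∀ N, 0 < N → ∃ α β : ℂ, ∀ᵐ x ∂(volume.restrict (Ioc 0 N)),
      v x - W x = α + β * x := by
    intro N hN
    refine exists_affine_of_integral_eq_zero hN (hd N) ?_
    intro Z Z₁ Z₂ hZ hZ0 hZ1 hN0 hN1 hN2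
    have m1 : MemLp Z 2 halfLineMeasure :=
      memLp_halfLine_of_eq_zero (hZ.memLp_Ioc N) fun x hx => hN0 x hx.le
    have m2' : MemLp (fun x => -Z₂ x + (q x : ℂ) * Z x) 2 (volume.restrict (Ioc 0 N)) :=
      (hZ.memLp N hN).neg.add (memLp_Ioc_mul (continuousOn_ofReal_comp hq N) (hZ.memLp_Ioc N))
    have z2 : ∀ x, N < x → -Z₂ x + (q x : ℂ) * Z x = 0 := fun x hx => by
      rw [hN2 x hx, hN0 x hx.le]
      simp
    have m2 : MemLp (fun x => -Z₂ x + (q x : ℂ) * Z x) 2 halfLineMeasure :=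
      memLp_halfLine_of_eq_zero m2' z2
    have e1 := h _ (toLp_mem_slGraph hZ hZ0 hZ1 m1 m2)
    simp only at e1
    rw [inner_toLp_eq f m1 hN.le fun x hx => hN0 x hx.le, inner_toLp_eq v m2 hN.le z2] at e1
    have e2 := hW.conj.lagrange hZ hN.le
    rw [hN0 N le_rfl, hN1 N le_rfl, hZ0, hZ1] at e2
    simp only [mul_zero, sub_zero] at e2
    have i1 := intervalIntegrable_mul hN.le (memLp_Ioc f N).star (hZ.memLp_Ioc N)
    have i2 := intervalIntegrable_mul hN.le (memLp_Ioc v N).star m2'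
    have i3 := (intervalIntegrable_mul hN.le (hw N).star (hZ.memLp_Ioc N)).sub
      (intervalIntegrable_mul hN.le (hW.memLp_Ioc N).star (hZ.memLp N hN))
    have e3 := intervalIntegral.integral_add (i1.sub i2) i3
    have e4 : ∀ s, star (v s - W s) * Z₂ s = (star (f s) * Z s -
        star (v s) * (-Z₂ s + (q s : ℂ) * Z s)) +
        (star (w s) * Z s - star (W s) * Z₂ s) := by
      intro s
      have : star (q s : ℂ) = q s := Complex.conj_ofReal _
      simp only [hwdef, star_sub, star_mul', this]
      ring
    simp only [e4]
    refine e3.trans ((congrArg₂ (· + ·)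
      ((intervalIntegral.integral_sub i1 i2).trans (sub_eq_zero.2 e1)) e2).trans (by simp))
  obtain ⟨α, β, hαβ⟩ := key 1 one_pos
  -- An affine function is determined by its values on (0, 1), so the coefficients do not depend on
  -- the interval.
  have hall : ∀ n : ℕ, ∀ᵐ x ∂(volume.restrict (Ioc 0 ((n : ℝ) + 1))), v x - W x = α + β * x := by
    intro n
    obtain ⟨α', β', h'⟩ := key (n + 1) (by positivity)
    have h1 := ae_mono (Measure.restrict_mono_set volume
      (Ioc_subset_Ioc_right (by simp) : Ioc (0 : ℝ) 1 ⊆ Ioc 0 ((n : ℝ) + 1))) h'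
    obtain ⟨rfl, rfl⟩ := affine_unique (α := α) (β := β) (α' := α') (β' := β') (by
      filter_upwards [hαβ, h1] with x a b
      rw [← a, b])
    exact h'
  have hv : ∀ᵐ x ∂halfLineMeasure, v x - W x = α + β * x := by
    have h2 := ae_all_iff.2 fun n => (ae_restrict_iff' measurableSet_Ioc).1 (hall n)
    rw [ae_restrict_iff' measurableSet_Ioi]
    filter_upwards [h2] with x hx hx0
    obtain ⟨n, hn⟩ := exists_nat_ge x
    exact hx n ⟨hx0, by linarith⟩
  have hY := isH2Loc_primitive (fun R _ => hw R) α β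
  refine ⟨_, _, _, hY, ?_, fun x => rfl⟩
  filter_upwards [hv, ae_restrict_mem measurableSet_Ioi] with x hx hx0
  rw [sub_eq_iff_eq_add] at hx
  rw [hx, intervalIntegral.integral_add (by simp) (hW.intervalIntegrable₁ (le_of_lt hx0))]
  simp [hWdef]
  ring

theorem eq_of_ae_eq_of_continuousOn {F G : ℝ → ℂ} (hF : ContinuousOn F (Ici 0))
    (hG : ContinuousOn G (Ici 0)) (h : F =ᵐ[halfLineMeasure] G) {x : ℝ} (hx : 0 ≤ x) :
    F x = G x := by
  have h1 : EqOn F G (Ioi 0) := Measure.eqOn_open_of_ae_eq h isOpen_Ioi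
    (hF.mono Ioi_subset_Ici_self) (hG.mono Ioi_subset_Ici_self)
  exact h1.of_subset_closure hF hG Ioi_subset_Ici_self (by rw [closure_Ioi]) hx

theorem IsH2Loc.eqOn_zero_of_ae {Y Y₁ Y₂ : ℝ → ℂ} (h : IsH2Loc Y Y₁ Y₂)
    (h0 : Y =ᵐ[halfLineMeasure] 0) : (∀ x, 0 ≤ x → Y x = 0) ∧ ∀ x, 0 ≤ x → Y₁ x = 0 := by
  have hY : ∀ x, 0 ≤ x → Y x = 0 := fun x hx =>
    eq_of_ae_eq_of_continuousOn h.continuousOn continuousOn_const h0 hx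
  refine ⟨hY, fun x hx => eq_of_ae_eq_of_continuousOn (G := 0) h.continuousOn₁
    continuousOn_const ?_ hx⟩
  refine ae_zero_of_integral_zero (fun R hR => h.intervalIntegrable₁ hR) fun x hx => ?_
  have := h.eq x hx
  rw [hY x hx, hY 0 le_rfl, zero_add] at this
  exact this.symm

/-- If y is orthogonal to the domain, then (v, f) = (0, y) satisfies the adjoint relation. So y is
the differential expression applied to the zero function, which is zero. -/
theorem dense_slOperator_domain (hq : ContinuousOn q (Ici 0)) :
    Dense ((slOperator q).domain : Set HalfLine) := by
  rw [Submodule.dense_iff_topologicalClosure_eq_top,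
    Submodule.topologicalClosure_eq_top_iff, Submodule.eq_bot_iff]
  intro y hy
  rw [Submodule.mem_orthogonal'] at hy
  obtain ⟨Y, Y₁, Y₂, hY, h1, h2⟩ := exists_isH2Loc_of_inner_eq hq (v := 0) (f := y) (by
    intro p hp
    rw [inner_zero_left]
    refine hy p.1 ?_
    rw [← slOperator_graph] at hp
    exact LinearPMap.mem_domain_of_mem_graph hp)
  have h3 : Y =ᵐ[halfLineMeasure] 0 := h1.symm.trans (Lp.coeFn_zero _ _ _)
  obtain ⟨e0, e1⟩ := hY.eqOn_zero_of_ae h3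
  refine slGraph_single_valued q (0, y) ⟨Y, Y₁, Y₂, hY, e0 0 le_rfl, e1 0 le_rfl, h1, ?_⟩ rfl
  filter_upwards [Lp.coeFn_zero ℂ 2 halfLineMeasure, ae_restrict_mem measurableSet_Ioi]
    with x hx hx0
  rw [h2, hx, e0 x (le_of_lt hx0)]
  simp

end Maximal

/-! ### Local control of the derivative by the form. -/

section Dirichlet

theorem IsH2Loc.mul {Y Y₁ Y₂ Z Z₁ Z₂ : ℝ → ℂ} (h : IsH2Loc Y Y₁ Y₂) (k : IsH2Loc Z Z₁ Z₂) :
    IsH2Loc (fun x => Y x * Z x) (fun x => Y₁ x * Z x + Y x * Z₁ x)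
      (fun x => (Y₂ x * Z x + Y₁ x * Z₁ x) + (Y₁ x * Z₁ x + Y x * Z₂ x)) := by
  have c : ∀ {G : ℝ → ℂ}, ContinuousOn G (Ici 0) → ∀ N, ContinuousOn G (Icc 0 N) :=
    fun hG N => hG.mono Icc_subset_Ici_self
  have c' : ∀ {G : ℝ → ℂ}, ContinuousOn G (Ici 0) → ∀ {N}, 0 ≤ N → ContinuousOn G (uIcc 0 N) :=
    fun hG N hN => hG.mono (by rw [uIcc_of_le hN]; exact Icc_subset_Ici_self)
  have i1 : ∀ x, 0 ≤ x → IntervalIntegrable (fun x => Y₂ x * Z x + Y₁ x * Z₁ x) volume 0 x :=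
    fun x hx => ((h.intervalIntegrable₂ hx).mul_continuousOn (c' k.continuousOn hx)).add
      ((k.intervalIntegrable₁ hx).continuousOn_mul (c' h.continuousOn₁ hx))
  have i2 : ∀ x, 0 ≤ x → IntervalIntegrable (fun x => Y₁ x * Z₁ x + Y x * Z₂ x) volume 0 x :=
    fun x hx => ((h.intervalIntegrable₁ hx).mul_continuousOn (c' k.continuousOn₁ hx)).add
      ((k.intervalIntegrable₂ hx).continuousOn_mul (c' h.continuousOn hx))
  refine ⟨fun R hR => ?_, fun x hx => ?_, fun x hx => ?_⟩
  · have m1 := memLp_Ioc_mul (c k.continuousOn R) (h.memLp R hR)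
    have m2 := memLp_Ioc_mul (c h.continuousOn R) (k.memLp R hR)
    have m3 : MemLp (fun x => Y₁ x * Z₁ x) 2 (volume.restrict (Ioc 0 R)) :=
      memLp_Ioc_of_continuousOn ((c h.continuousOn₁ R).mul (c k.continuousOn₁ R))
    refine ((m1.add m3).add (m3.add m2)).ae_eq (Eventually.of_forall fun x => ?_)
    simp only [Pi.add_apply]
    ring
  · have h1 := mul_eq_integral_of_eq_primitive hx (h.intervalIntegrable₂ hx)
      (k.intervalIntegrable₁ hx) (fun x hx => h.deriv_eq x hx.1) (fun x hx => k.eq x hx.1)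
    have h2 := mul_eq_integral_of_eq_primitive hx (h.intervalIntegrable₁ hx)
      (k.intervalIntegrable₂ hx) (fun x hx => h.eq x hx.1) (fun x hx => k.deriv_eq x hx.1)
    rw [intervalIntegral.integral_add (i1 x hx) (i2 x hx), h1, h2]
    ring
  · exact mul_eq_integral_of_eq_primitive hx (h.intervalIntegrable₁ hx)
      (k.intervalIntegrable₁ hx) (fun x hx => h.eq x hx.1) (fun x hx => k.eq x hx.1)

theorem isH2Loc_of_contDiff {η : ℝ → ℝ} (hη : ContDiff ℝ 2 η) :
    IsH2Loc (fun x => (η x : ℂ)) (fun x => ((deriv η x : ℝ) : ℂ))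
      (fun x => ((deriv (deriv η) x : ℝ) : ℂ)) := by
  have h1 : ContDiff ℝ 1 (deriv η) := by
    have : ContDiff ℝ (1 + 1) η := by
      norm_num
      exact hη
    exact (contDiff_succ_iff_deriv.1 this).2.2
  have c2 : Continuous (deriv (deriv η)) := h1.continuous_deriv le_rfl
  have aux : ∀ {f : ℝ → ℝ}, ContDiff ℝ 1 f → ∀ x,
      (f x : ℂ) = (f 0 : ℂ) + ∫ s in (0 : ℝ)..x, ((deriv f s : ℝ) : ℂ) := by
    intro f hf x
    rw [intervalIntegral.integral_ofReal, intervalIntegral.integral_deriv_eq_sub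
      (fun x _ => hf.differentiable one_ne_zero x)
      ((hf.continuous_deriv le_rfl).intervalIntegrable _ _)]
    push_cast
    ring
  exact ⟨fun R _ => memLp_Ioc_of_continuousOn (Complex.continuous_ofReal.comp c2).continuousOn,
    fun x _ => aux h1 x, fun x _ => aux (hη.of_le one_le_two) x⟩

theorem norm_sq_eq_integral (y : HalfLine) : ‖y‖ ^ 2 = ∫ x, ‖y x‖ ^ 2 ∂halfLineMeasure := by
  have h := L2.inner_def (𝕜 := ℂ) y y
  have h1 : ∀ x, ⟪y x, y x⟫_ℂ = ((‖y x‖ ^ 2 : ℝ) : ℂ) := fun x => by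
    rw [inner_self_eq_norm_sq_to_K]
    norm_cast
  simp only [h1] at h
  rw [integral_complex_ofReal] at h
  have h2 := inner_self_eq_norm_sq (𝕜 := ℂ) y
  rw [h] at h2
  exact h2.symm

theorem integrable_norm_sq (y : HalfLine) :
    Integrable (fun x => ‖y x‖ ^ 2) halfLineMeasure :=
  (memLp_two_iff_integrable_sq_norm (Lp.aestronglyMeasurable y)).1 (Lp.memLp y)

variable {q : ℝ → ℝ}

/-- The localization formula: the form of `y` dominates the Dirichlet integral of `y` near `0`. -/
theorem exists_integral_norm_sq_le (hq : ContinuousOn q (Ici 0))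
    (hpos : IsPositiveDefinite (slOperator q)) : ∃ C : ℝ, ∀ (a : (slOperator q).domain)
      (Y Y₁ Y₂ : ℝ → ℂ), IsH2Loc Y Y₁ Y₂ → Y 0 = 0 → Y₁ 0 = 0 →
      (a : HalfLine) =ᵐ[halfLineMeasure] Y →
      (slOperator q a =ᵐ[halfLineMeasure] fun x => -Y₂ x + (q x : ℂ) * Y x) →
      ∫ x in (0 : ℝ)..1, ‖Y₁ x‖ ^ 2 ≤ quadForm (slOperator q) a + C * ‖(a : HalfLine)‖ ^ 2 := by
  -- The cutoff is 0 on (−∞, 1] and 1 on [2, ∞). The forms of y and of ηy differ only by an integral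
  -- over (0, 2), where q is bounded, so nothing is needed about q at infinity.
  let η : ℝ → ℝ := fun x => Real.smoothTransition (x - 1)
  have hη : ContDiff ℝ 2 η := Real.smoothTransition.contDiff.comp (contDiff_id.sub contDiff_const)
  have hη1 : ContDiff ℝ 1 (deriv η) := by
    have : ContDiff ℝ (1 + 1) η := by
      norm_num
      exact hη
    exact (contDiff_succ_iff_deriv.1 this).2.2
  have c2 : Continuous (deriv (deriv η)) := hη1.continuous_deriv le_rfl
  have hηle : ∀ x, η x ≤ 1 := fun x => Real.smoothTransition.le_one _
  have hηnn : ∀ x, 0 ≤ η x := fun x => Real.smoothTransition.nonneg _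
  have hηone : ∀ x, 2 ≤ x → η x = 1 := fun x hx =>
    Real.smoothTransition.one_of_one_le (by linarith)
  have hηzero : ∀ x, x ≤ 1 → η x = 0 := fun x hx =>
    Real.smoothTransition.zero_of_nonpos (by linarith)
  have hη1z : ∀ x, 2 < x → deriv η x = 0 := fun x hx => by
    have : η =ᶠ[𝓝 x] fun _ => 1 := by
      filter_upwards [Ioi_mem_nhds hx] with y hy using hηone y (le_of_lt hy)
    rw [this.deriv_eq, deriv_const]
  have hη2z : ∀ x, 2 < x → deriv (deriv η) x = 0 := fun x hx => by
    have : deriv η =ᶠ[𝓝 x] fun _ => 0 := by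
      filter_upwards [Ioi_mem_nhds hx] with y hy using hη1z y hy
    rw [this.deriv_eq, deriv_const]
  have hE := isH2Loc_of_contDiff hη
  let K : ℝ → ℝ := fun x => (1 - η x ^ 2) * q x + η x * deriv (deriv η) x
  have hKc : ContinuousOn K (Icc 0 2) :=
    ((continuous_const.sub (hη.continuous.pow 2)).continuousOn.mul
      (hq.mono Icc_subset_Ici_self)).add (hη.continuous.mul c2).continuousOn
  obtain ⟨C, hC⟩ := isCompact_Icc.exists_bound_of_continuousOn hKc
  refine ⟨C, fun a Y Y₁ Y₂ h h0 h1 hy hz => ?_⟩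
  have hC0 : 0 ≤ C := (norm_nonneg _).trans (hC 0 (by simp))
  set z := slOperator q a with hzdef
  have hYc := h.continuousOn.mono (Icc_subset_Ici_self : Icc (0 : ℝ) 2 ⊆ Ici 0)
  have hY₁c := h.continuousOn₁.mono (Icc_subset_Ici_self : Icc (0 : ℝ) 2 ⊆ Ici 0)
  -- the localized function
  have hP := hE.mul h
  have hbd : ∀ {g : HalfLine}, MemLp (fun x => (η x : ℂ) * g x) 2 halfLineMeasure := by
    intro g
    refine (Lp.memLp g).of_le_mul (c := 1)
      ((Complex.continuous_ofReal.comp hη.continuous).aestronglyMeasurable.mul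
        (Lp.aestronglyMeasurable g)) (Eventually.of_forall fun x => ?_)
    rw [norm_mul]
    refine mul_le_mul_of_nonneg_right ?_ (norm_nonneg _)
    rw [Complex.norm_real, Real.norm_of_nonneg (hηnn x)]
    exact hηle x
  have mY : MemLp (fun x => (η x : ℂ) * Y x) 2 halfLineMeasure := by
    refine (hbd (g := (a : HalfLine))).ae_eq ?_
    filter_upwards [hy] with x hx
    rw [hx]
  let X : ℝ → ℂ := fun x => ((deriv (deriv η) x : ℝ) : ℂ) * Y x + 2 * ((deriv η x : ℝ) : ℂ) * Y₁ x
  have mX : MemLp X 2 halfLineMeasure := by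
    refine memLp_halfLine_of_eq_zero (N := 2) (memLp_Ioc_of_continuousOn ?_) fun x hx => ?_
    · exact ((Complex.continuous_ofReal.comp c2).continuousOn.mul hYc).add
        ((continuousOn_const.mul (Complex.continuous_ofReal.comp hη1.continuous).continuousOn).mul
          hY₁c)
    · simp [X, hη1z x hx, hη2z x hx]
  have mZ : MemLp (fun x => -((((deriv (deriv η) x : ℝ) : ℂ) * Y x + ((deriv η x : ℝ) : ℂ) * Y₁ x) +
      (((deriv η x : ℝ) : ℂ) * Y₁ x + (η x : ℂ) * Y₂ x)) + (q x : ℂ) * ((η x : ℂ) * Y x)) 2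
      halfLineMeasure := by
    refine ((hbd (g := z)).sub mX).ae_eq ?_
    filter_upwards [hz] with x hx
    simp only [Pi.sub_apply, X]
    rw [hx]
    ring
  have hgr := toLp_mem_slGraph (q := q) hP (by simp [h0]) (by simp [h0, h1]) mY mZ
  rw [← slOperator_graph, LinearPMap.mem_graph_iff] at hgr
  obtain ⟨b, hb1, hb2⟩ := hgr
  -- Positivity is applied to ηy; discarding this nonnegative term leaves the local integral.
  have hbpos := quadForm_nonneg hpos b
  rw [quadForm, hb1, hb2] at hbpos
  -- the difference of the two forms
  have hdiff : ⟪z, (a : HalfLine)⟫_ℂ - ⟪mZ.toLp _, mY.toLp _⟫_ℂ =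
      ∫ x in (0 : ℝ)..2, (((1 - η x ^ 2) * ‖Y₁ x‖ ^ 2 + K x * ‖Y x‖ ^ 2 : ℝ) : ℂ) := by
    let G : ℝ → ℂ := fun x => (1 - (η x : ℂ) ^ 2) * (Y x * star (-Y₂ x + (q x : ℂ) * Y x)) +
      (η x : ℂ) * Y x * star (X x)
    have e1 : ⟪z, (a : HalfLine)⟫_ℂ - ⟪mZ.toLp _, mY.toLp _⟫_ℂ = ∫ x in (0 : ℝ)..2, G x := by
      rw [L2.inner_def, L2.inner_def,
        ← integral_sub (L2.integrable_inner _ _) (L2.integrable_inner _ _),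
        intervalIntegral.integral_of_le zero_le_two,
        ← inter_eq_self_of_subset_right (Ioc_subset_Ioi_self : Ioc (0 : ℝ) 2 ⊆ Ioi 0),
        ← setIntegral_indicator measurableSet_Ioc]
      refine integral_congr_ae ?_
      filter_upwards [hy, hz, mZ.coeFn_toLp, mY.coeFn_toLp, ae_restrict_mem measurableSet_Ioi]
        with x e1 e2 e3 e4 hx0
      simp only [e1, e2, e3, e4, RCLike.inner_apply, starRingEnd_apply]
      rcases le_or_gt x 2 with hx | hx
      · rw [indicator_of_mem (show x ∈ Ioc (0 : ℝ) 2 from ⟨hx0, hx⟩)]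
        simp only [G, X, ← starRingEnd_apply, map_add, map_mul, map_neg, Complex.conj_ofReal,
          map_ofNat]
        ring
      · rw [indicator_of_notMem (fun h => not_le_of_gt hx h.2)]
        simp only [hη1z x hx, hη2z x hx, hηone x hx.le]
        simp
    have hR := isH2Loc_of_contDiff (η := fun x => 1 - η x ^ 2) (contDiff_const.sub (hη.pow 2))
    have hRd : ∀ x, deriv (fun x => 1 - η x ^ 2) x = -(2 * η x * deriv η x) := by
      intro x
      have hd := (((hη.differentiable two_ne_zero x).hasDerivAt.pow 2).const_sub 1).deriv
      simpa using hd
    simp only [hRd] at hR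
    have hRY := hR.mul h
    -- Integration by parts of (1 − η²)Y against the conjugate of Y''. Both boundary terms vanish,
    -- since Y(0) = 0 and η(2) = 1.
    have e2 := mul_eq_integral_of_eq_primitive zero_le_two (hRY.intervalIntegrable₁ zero_le_two)
      (h.conj.intervalIntegrable₂ zero_le_two) (fun x hx => hRY.eq x hx.1)
      (fun x hx => h.conj.deriv_eq x hx.1)
    simp only [hηone 2 le_rfl, h0] at e2
    simp only [one_pow, sub_self, Complex.ofReal_zero, mul_zero, zero_mul, zero_add] at e2
    have c' : ∀ {G : ℝ → ℂ}, ContinuousOn G (Ici 0) → ContinuousOn G (uIcc 0 2) :=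
      fun hG => hG.mono (by rw [uIcc_of_le zero_le_two]; exact Icc_subset_Ici_self)
    have j1 : IntervalIntegrable G volume 0 2 := by
      refine IntervalIntegrable.add ?_ ?_
      · refine IntervalIntegrable.continuousOn_mul ?_ ?_
        · have m : MemLp (fun x => -Y₂ x + (q x : ℂ) * Y x) 2 (volume.restrict (Ioc 0 2)) :=
            (h.memLp 2 two_pos).neg.add (memLp_Ioc_mul (continuousOn_ofReal_comp hq 2)
              (h.memLp_Ioc 2))
          exact intervalIntegrable_mul zero_le_two (h.memLp_Ioc 2) m.star
        · exact (continuous_const.sub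
            ((Complex.continuous_ofReal.comp hη.continuous).pow 2)).continuousOn
      · exact intervalIntegrable_mul zero_le_two (hP.memLp_Ioc 2)
          (mX.mono_measure (Measure.restrict_mono_set _ Ioc_subset_Ioi_self)).star
    have j2 := ((hRY.intervalIntegrable₁ zero_le_two).mul_continuousOn
      (c' h.conj.continuousOn₁)).add
      ((h.conj.intervalIntegrable₂ zero_le_two).continuousOn_mul (c' hRY.continuousOn))
    have e3 := intervalIntegral.integral_add j1 j2
    rw [← e2, add_zero] at e3
    rw [e1, ← e3]
    refine intervalIntegral.integral_congr fun x _ => ?_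
    have n1 : ∀ w : ℂ, ((‖w‖ ^ 2 : ℝ) : ℂ) = w * star w := fun w => by
      rw [← starRingEnd_apply, Complex.mul_conj, Complex.normSq_eq_norm_sq]
    have n2 : (((1 - η x ^ 2) * ‖Y₁ x‖ ^ 2 + K x * ‖Y x‖ ^ 2 : ℝ) : ℂ) =
        (1 - (η x : ℂ) ^ 2) * (Y₁ x * star (Y₁ x)) + ((1 - (η x : ℂ) ^ 2) * (q x : ℂ) +
          (η x : ℂ) * ((deriv (deriv η) x : ℝ) : ℂ)) * (Y x * star (Y x)) := by
      rw [← n1, ← n1]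
      simp only [K]
      push_cast
      ring
    rw [n2]
    simp only [G, X, ← starRingEnd_apply, map_add, map_mul, map_neg, Complex.conj_ofReal,
      map_ofNat, Complex.ofReal_neg, Complex.ofReal_mul, Complex.ofReal_sub,
      Complex.ofReal_pow, Complex.ofReal_one, Complex.ofReal_ofNat]
    ring
  have hre := congrArg Complex.re hdiff
  rw [intervalIntegral.integral_ofReal, Complex.ofReal_re, Complex.sub_re] at hre
  have hq' : quadForm (slOperator q) a = (⟪z, (a : HalfLine)⟫_ℂ).re := rfl
  have i1 : IntervalIntegrable (fun x => (1 - η x ^ 2) * ‖Y₁ x‖ ^ 2) volume 0 2 := by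
    refine ContinuousOn.intervalIntegrable ?_
    rw [uIcc_of_le zero_le_two]
    exact (continuous_const.sub (hη.continuous.pow 2)).continuousOn.mul (hY₁c.norm.pow 2)
  have i2 : IntervalIntegrable (fun x => K x * ‖Y x‖ ^ 2) volume 0 2 := by
    refine ContinuousOn.intervalIntegrable ?_
    rw [uIcc_of_le zero_le_two]
    exact hKc.mul (hYc.norm.pow 2)
  have i3 : IntervalIntegrable (fun x => ‖Y x‖ ^ 2) volume 0 2 := by
    refine ContinuousOn.intervalIntegrable ?_
    rw [uIcc_of_le zero_le_two]
    exact hYc.norm.pow 2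
  rw [intervalIntegral.integral_add i1 i2] at hre
  have hnn : ∀ x, 0 ≤ (1 - η x ^ 2) * ‖Y₁ x‖ ^ 2 := fun x => by
    have : η x ^ 2 ≤ 1 := pow_le_one₀ (hηnn x) (hηle x)
    have : 0 ≤ 1 - η x ^ 2 := by linarith
    positivity
  have b1 : ∫ x in (0 : ℝ)..1, ‖Y₁ x‖ ^ 2 ≤ ∫ x in (0 : ℝ)..2, (1 - η x ^ 2) * ‖Y₁ x‖ ^ 2 := by
    have e : ∫ x in (0 : ℝ)..1, ‖Y₁ x‖ ^ 2 = ∫ x in (0 : ℝ)..1, (1 - η x ^ 2) * ‖Y₁ x‖ ^ 2 := by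
      refine intervalIntegral.integral_congr fun x hx => ?_
      rw [uIcc_of_le zero_le_one] at hx
      simp [hηzero x hx.2]
    rw [e]
    exact intervalIntegral.integral_mono_interval le_rfl zero_le_one one_le_two
      (Eventually.of_forall hnn) i1
  have b2 : -(C * ‖(a : HalfLine)‖ ^ 2) ≤ ∫ x in (0 : ℝ)..2, K x * ‖Y x‖ ^ 2 := by
    have e1 : ∫ x in (0 : ℝ)..2, ‖Y x‖ ^ 2 ≤ ‖(a : HalfLine)‖ ^ 2 := by
      rw [norm_sq_eq_integral, intervalIntegral.integral_of_le zero_le_two]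
      have e2 : ∫ x in Ioc (0 : ℝ) 2, ‖Y x‖ ^ 2 = ∫ x in Ioc (0 : ℝ) 2, ‖(a : HalfLine) x‖ ^ 2 := by
        refine integral_congr_ae ?_
        filter_upwards [ae_mono (Measure.restrict_mono_set volume
          (Ioc_subset_Ioi_self : Ioc (0 : ℝ) 2 ⊆ Ioi 0)) hy] with x hx
        rw [hx]
      rw [e2]
      exact setIntegral_mono_set (integrable_norm_sq _)
        (Eventually.of_forall fun x => sq_nonneg _) Ioc_subset_Ioi_self.eventuallyLE
    have e3 : ∫ x in (0 : ℝ)..2, -C * ‖Y x‖ ^ 2 ≤ ∫ x in (0 : ℝ)..2, K x * ‖Y x‖ ^ 2 := by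
      refine intervalIntegral.integral_mono_on zero_le_two (i3.const_mul _) i2 fun x hx => ?_
      refine mul_le_mul_of_nonneg_right ?_ (sq_nonneg _)
      have := hC x hx
      rw [Real.norm_eq_abs] at this
      exact (abs_le.1 this).1
    rw [intervalIntegral.integral_const_mul] at e3
    nlinarith
  rw [hq']
  linarith

end Dirichlet

/-! ### The Dirichlet condition for the form domain. -/

section DirichletCondition

variable {q : ℝ → ℝ}

/-- Integrate |Y'| ≤ (√x/2)|Y'|² + 1/(2√x) over (0, x). The √x rate depends only on the Dirichlet
integral, so it survives limits in L₂. -/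
theorem norm_le_sqrt_of_integral_norm_sq_le {Y Y₁ Y₂ : ℝ → ℂ} (h : IsH2Loc Y Y₁ Y₂) (h0 : Y 0 = 0)
    {M : ℝ} (hM : ∫ x in (0 : ℝ)..1, ‖Y₁ x‖ ^ 2 ≤ M) {x : ℝ} (hx0 : 0 < x) (hx1 : x ≤ 1) :
    ‖Y x‖ ≤ (M + 1) / 2 * √x := by
  have c1 := h.continuousOn₁.mono (Icc_subset_Ici_self : Icc (0 : ℝ) 1 ⊆ Ici 0)
  have cx : ContinuousOn Y₁ (uIcc 0 x) := by
    rw [uIcc_of_le hx0.le]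
    exact c1.mono (Icc_subset_Icc_right hx1)
  have i1 : IntervalIntegrable (fun s => ‖Y₁ s‖ ^ 2) volume 0 1 := by
    refine ContinuousOn.intervalIntegrable ?_
    rw [uIcc_of_le zero_le_one]
    exact c1.norm.pow 2
  have i2 : IntervalIntegrable (fun s => ‖Y₁ s‖ ^ 2) volume 0 x :=
    (cx.norm.pow 2).intervalIntegrable
  have hM' : ∫ s in (0 : ℝ)..x, ‖Y₁ s‖ ^ 2 ≤ M :=
    (intervalIntegral.integral_mono_interval le_rfl hx0.le hx1
      (Eventually.of_forall fun s => sq_nonneg _) i1).trans hM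
  have hs : 0 < √x := Real.sqrt_pos.2 hx0
  have hsx : √x * √x = x := Real.mul_self_sqrt hx0.le
  rw [h.eq x hx0.le, h0, zero_add]
  refine (intervalIntegral.norm_integral_le_integral_norm hx0.le).trans ?_
  have hle : ∫ s in (0 : ℝ)..x, ‖Y₁ s‖ ≤
      ∫ s in (0 : ℝ)..x, (√x / 2 * ‖Y₁ s‖ ^ 2 + (√x)⁻¹ / 2) := by
    refine intervalIntegral.integral_mono_on hx0.le cx.norm.intervalIntegrable
      ((i2.const_mul _).add intervalIntegrable_const) fun s _ => ?_
    have h1 : 0 ≤ (√x)⁻¹ / 2 * (√x * ‖Y₁ s‖ - 1) ^ 2 := by positivity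
    have h2 : (√x)⁻¹ / 2 * (√x * ‖Y₁ s‖ - 1) ^ 2 =
        √x / 2 * ‖Y₁ s‖ ^ 2 - ‖Y₁ s‖ + (√x)⁻¹ / 2 := by
      field_simp
      ring
    linarith
  refine hle.trans ?_
  rw [intervalIntegral.integral_add (i2.const_mul _) intervalIntegrable_const,
    intervalIntegral.integral_const_mul, intervalIntegral.integral_const, sub_zero, smul_eq_mul]
  have h3 : x * ((√x)⁻¹ / 2) = √x / 2 :=
    calc x * ((√x)⁻¹ / 2) = √x * √x * ((√x)⁻¹ / 2) := by rw [hsx]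
      _ = √x / 2 := by field_simp
  rw [h3]
  nlinarith

/-- Elements of the form domain satisfy the Dirichlet condition at `0`. -/
theorem eq_zero_of_mem_formDomain (hq : ContinuousOn q (Ici 0))
    (hpos : IsPositiveDefinite (slOperator q)) {v : HalfLine}
    (hv : v ∈ formDomain (slOperator q) hpos) {Y : ℝ → ℂ} (hY : ContinuousOn Y (Ici 0))
    (hvY : v =ᵐ[halfLineMeasure] Y) : Y 0 = 0 := by
  obtain ⟨a, ha, hc⟩ := hv
  obtain ⟨C, hC⟩ := exists_integral_norm_sq_le hq hpos
  obtain ⟨N, hN⟩ := eventually_atTop_prod_self.1 (hc.eventually_le_const one_pos)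
  obtain ⟨B, hB⟩ := (Metric.isBounded_range_of_tendsto _ ha).exists_norm_le
  -- The parallelogram bound q(a n) ≤ 2q(a n − a N) + 2q(a N), with the first form at most 1, gives
  -- the first two terms; the last bounds the L₂ part, where the sign of `C` is not known.
  set M : ℝ := 2 + 2 * quadForm (slOperator q) (a N) + |C| * B ^ 2
  have hform : ∀ n, N ≤ n → quadForm (slOperator q) (a n) + C * ‖(a n : HalfLine)‖ ^ 2 ≤ M := by
    intro n hn
    have h1 := quadForm_add_le hpos (a n - a N) (a N)
    rw [sub_add_cancel] at h1
    have h2 := hN n N hn le_rfl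
    have h3 : ‖(a n : HalfLine)‖ ≤ B := hB _ ⟨n, rfl⟩
    have h4 : C * ‖(a n : HalfLine)‖ ^ 2 ≤ |C| * B ^ 2 :=
      mul_le_mul (le_abs_self C) (by gcongr) (sq_nonneg _) (abs_nonneg C)
    simp only [M]
    linarith
  have hrep : ∀ n, ∀ᵐ x ∂halfLineMeasure, N ≤ n → x ≤ 1 →
      ‖(a n : HalfLine) x‖ ≤ (M + 1) / 2 * √x := by
    intro n
    have hg : ((a n : HalfLine), slOperator q (a n)) ∈ slGraph q := by
      rw [← slOperator_graph]
      exact LinearPMap.mem_graph _ _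
    obtain ⟨Z, Z₁, Z₂, h, h0, h1, hy, hz⟩ := hg
    filter_upwards [hy, ae_restrict_mem measurableSet_Ioi] with x hx hx0 hn hx1
    have e : (a n : HalfLine) x = Z x := hx
    rw [e]
    exact norm_le_sqrt_of_integral_norm_sq_le h h0
      ((hC (a n) Z Z₁ Z₂ h h0 h1 hy hz).trans (hform n hn)) hx0 hx1
  obtain ⟨ns, hns, hlim⟩ := (tendstoInMeasure_of_tendsto_Lp ha).exists_seq_tendsto_ae
  have hlim' : ∀ᵐ x ∂halfLineMeasure, x ≤ 1 → ‖Y x‖ ≤ (M + 1) / 2 * √x := by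
    filter_upwards [hlim, ae_all_iff.2 hrep, hvY] with x h1 h2 h3 hx
    rw [← h3]
    refine le_of_tendsto h1.norm ?_
    filter_upwards [eventually_ge_atTop N] with n hn
    exact h2 (ns n) (hn.trans (hns.id_le n)) hx
  -- The positive part of the excess is continuous and zero almost everywhere, so the inequality
  -- holds at every point of (0, 1).
  have hpt : EqOn (fun x => max (‖Y x‖ - (M + 1) / 2 * √x) 0) (fun _ => 0) (Ioo 0 1) := by
    refine Measure.eqOn_open_of_ae_eq (μ := volume) ?_ isOpen_Ioo ?_ continuousOn_const
    · filter_upwards [ae_mono (Measure.restrict_mono_set volume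
        (Ioo_subset_Ioi_self : Ioo (0 : ℝ) 1 ⊆ Ioi 0)) hlim', ae_restrict_mem measurableSet_Ioo]
        with x h1 h2
      exact max_eq_right (by linarith [h1 h2.2.le])
    · refine ContinuousOn.sup ?_ continuousOn_const
      exact ((hY.mono fun x hx => le_of_lt hx.1).norm).sub
        (continuous_const.mul Real.continuous_sqrt).continuousOn
  have t1 : Tendsto (fun x => ‖Y x‖) (𝓝[>] 0) (𝓝 ‖Y 0‖) :=
    ((hY 0 self_mem_Ici).mono Ioi_subset_Ici_self).norm
  have t2 : Tendsto (fun x => (M + 1) / 2 * √x) (𝓝[>] 0) (𝓝 0) := by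
    have : Continuous fun x => (M + 1) / 2 * √x := continuous_const.mul Real.continuous_sqrt
    simpa using (this.tendsto 0).mono_left nhdsWithin_le_nhds
  have := le_of_tendsto_of_tendsto t1 t2 (by
    filter_upwards [Ioo_mem_nhdsGT one_pos] with x hx
    have h1 := hpt hx
    have h2 := le_max_left (‖Y x‖ - (M + 1) / 2 * √x) 0
    simp only at h1
    rw [h1] at h2
    linarith)
  exact norm_le_zero_iff.1 this

end DirichletCondition

/-! ### Truncations as a continuous curve in L₂. -/

section Truncation

variable {φ : ℝ → ℂ}

theorem memLp_indicator_Ioc (hφ : ContinuousOn φ (Ici 0)) (x : ℝ) :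
    MemLp ((Ioc 0 x).indicator φ) 2 halfLineMeasure :=
  ((memLp_indicator_iff_restrict measurableSet_Ioc).2
    (memLp_Ioc_of_continuousOn (hφ.mono Icc_subset_Ici_self))).mono_measure Measure.restrict_le_self

/-- The restriction of `φ` to `(0, x)`, as an element of `L₂(0, ∞)`. -/
noncomputable def truncation (hφ : ContinuousOn φ (Ici 0)) (x : ℝ) : HalfLine :=
  (memLp_indicator_Ioc hφ x).toLp _

theorem inner_truncation (hφ : ContinuousOn φ (Ici 0)) {x : ℝ} (hx : 0 ≤ x) (f : HalfLine) :
    ⟪truncation hφ x, f⟫_ℂ = ∫ s in (0 : ℝ)..x, star (φ s) * f s := by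
  rw [L2.inner_def, intervalIntegral.integral_of_le hx,
    ← inter_eq_self_of_subset_right (Ioc_subset_Ioi_self : Ioc (0 : ℝ) x ⊆ Ioi 0),
    ← setIntegral_indicator measurableSet_Ioc]
  refine integral_congr_ae ?_
  filter_upwards [(memLp_indicator_Ioc hφ x).coeFn_toLp] with s hs
  rw [truncation, hs]
  by_cases h : s ∈ Ioc 0 x
  · simp [indicator_of_mem h, RCLike.inner_apply, mul_comm]
  · simp [indicator_of_notMem h]

/-- Two truncations differ only between their endpoints, where φ is bounded by some C, so their
distance is at most C |x₀ − x|^{1/2}. -/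
theorem continuous_truncation (hφ : ContinuousOn φ (Ici 0)) : Continuous (truncation hφ) := by
  refine continuous_iff_continuousAt.2 fun x₀ => ?_
  obtain ⟨C, hC⟩ := isCompact_Icc.exists_bound_of_continuousOn
    (hφ.mono (Icc_subset_Ici_self : Icc (0 : ℝ) (|x₀| + 1) ⊆ Ici 0))
  have hC0 : 0 ≤ C := (norm_nonneg _).trans (hC 0 ⟨le_rfl, by positivity⟩)
  rw [ContinuousAt, tendsto_iff_norm_sub_tendsto_zero]
  have hbd : ∀ᶠ x in 𝓝 x₀, ‖truncation hφ x - truncation hφ x₀‖ ≤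
      C * |x₀ - x| ^ (1 / (2 : ENNReal).toReal) := by
    filter_upwards [Iio_mem_nhds (show x₀ < |x₀| + 1 by linarith [le_abs_self x₀])] with x hx
    have hfin : halfLineMeasure (uIoc x x₀) ≠ ⊤ :=
      ((Measure.restrict_apply_le _ _).trans_lt (by simp [uIoc])).ne
    have h1 : ‖truncation hφ x - truncation hφ x₀‖ ≤
        ‖indicatorConstLp (μ := halfLineMeasure) 2 measurableSet_uIoc hfin (C : ℂ)‖ := by
      refine Lp.norm_le_norm_of_ae_le ?_
      filter_upwards [(memLp_indicator_Ioc hφ x).coeFn_toLp,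
        (memLp_indicator_Ioc hφ x₀).coeFn_toLp, Lp.coeFn_sub (truncation hφ x) (truncation hφ x₀),
        indicatorConstLp_coeFn (μ := halfLineMeasure) (p := 2) (hs := measurableSet_uIoc)
          (hμs := hfin) (c := (C : ℂ))] with s e1 e2 e3 e4
      rw [e3, e4, Pi.sub_apply, truncation, truncation, e1, e2]
      have hφs : s ∈ Ioc 0 x ∨ s ∈ Ioc 0 x₀ → ‖φ s‖ ≤ C := by
        rintro (h | h)
        · exact hC s ⟨h.1.le, h.2.trans (le_of_lt hx)⟩
        · exact hC s ⟨h.1.le, h.2.trans (by linarith [le_abs_self x₀])⟩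
      by_cases h : s ∈ Ioc 0 x <;> by_cases h' : s ∈ Ioc 0 x₀
      · rw [indicator_of_mem h, indicator_of_mem h', sub_self, norm_zero]
        exact norm_nonneg _
      · rw [indicator_of_mem h, indicator_of_notMem h', sub_zero, indicator_of_mem]
        · rw [Complex.norm_real, Real.norm_of_nonneg hC0]
          exact hφs (Or.inl h)
        · rw [mem_uIoc]
          exact Or.inr ⟨not_le.1 fun hs => h' ⟨h.1, hs⟩, h.2⟩
      · rw [indicator_of_notMem h, indicator_of_mem h', zero_sub, norm_neg, indicator_of_mem]
        · rw [Complex.norm_real, Real.norm_of_nonneg hC0]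
          exact hφs (Or.inr h')
        · rw [mem_uIoc]
          exact Or.inl ⟨not_le.1 fun hs => h ⟨h'.1, hs⟩, h'.2⟩
      · rw [indicator_of_notMem h, indicator_of_notMem h', sub_self, norm_zero]
        exact norm_nonneg _
    refine h1.trans ?_
    rw [norm_indicatorConstLp (by norm_num) (by norm_num), Complex.norm_real,
      Real.norm_of_nonneg hC0]
    refine mul_le_mul_of_nonneg_left (Real.rpow_le_rpow measureReal_nonneg ?_ (by norm_num)) hC0
    refine (measureReal_mono (μ := volume.restrict (Ioi (0 : ℝ))) subset_rfl hfin).trans ?_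
    refine (ENNReal.toReal_mono (by simp [uIoc]) (Measure.restrict_apply_le _ _)).trans ?_
    rw [uIoc, Real.volume_Ioc, max_sub_min_eq_abs, ENNReal.toReal_ofReal (abs_nonneg _)]
  refine squeeze_zero' (Eventually.of_forall fun _ => norm_nonneg _) hbd ?_
  have hc : Continuous fun x : ℝ => C * |x₀ - x| ^ (1 / (2 : ENNReal).toReal) :=
    continuous_const.mul ((continuous_const.sub continuous_id).abs.rpow_const
      fun _ => Or.inr (by norm_num))
  have := hc.tendsto x₀
  rwa [sub_self, abs_zero, Real.zero_rpow (by norm_num), mul_zero] at this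

end Truncation

/-! ### Regularity of L⁻¹f and its derivative at 0. -/

section CauchyData

variable {q : ℝ → ℝ}

/-- The inverse of the Friedrichs extension of the Sturm-Liouville operator. -/
noncomputable abbrev slInverse (hpos : IsPositiveDefinite (slOperator q)) :
    HalfLine →L[ℂ] HalfLine :=
  boundedInverse (friedrichs (slOperator q) hpos)

/-- The range of L⁻¹ lies in the domain of the adjoint, which gives regularity and the equation, and
in the form domain, which gives Y(0) = 0. -/
theorem exists_isH2Loc_slInverse (hq : ContinuousOn q (Ici 0))
    (hpos : IsPositiveDefinite (slOperator q)) (f : HalfLine) :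
    ∃ Y Y₁ Y₂ : ℝ → ℂ, IsH2Loc Y Y₁ Y₂ ∧ Y 0 = 0 ∧ slInverse hpos f =ᵐ[halfLineMeasure] Y ∧
      ∀ x, Y₂ x = (q x : ℂ) * slInverse hpos f x - f x := by
  have hd := dense_slOperator_domain hq
  obtain ⟨y, hy, hy'⟩ := adjoint_boundedInverse (hA := hpos) hd f
  obtain ⟨Y, Y₁, Y₂, h, hY, h2⟩ := exists_isH2Loc_of_inner_eq (v := slInverse hpos f)
    (f := f) hq (by
    intro p hp
    rw [← slOperator_graph, LinearPMap.mem_graph_iff] at hp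
    obtain ⟨a, ha1, ha2⟩ := hp
    rw [← ha1, ← ha2, ← hy, ← hy']
    exact LinearPMap.adjoint_isFormalAdjoint hd y a)
  exact ⟨Y, Y₁, Y₂, h, eq_zero_of_mem_formDomain hq hpos (boundedInverse_mem_formDomain hd f)
    h.continuousOn hY, hY, h2⟩

/-- A smooth function on the half-line that equals `1` at `0` and vanishes on `[1, ∞)`. -/
noncomputable def cutoff (x : ℝ) : ℝ := Real.smoothTransition (1 - x)

theorem contDiff_cutoff : ContDiff ℝ 2 cutoff :=
  Real.smoothTransition.contDiff.comp (contDiff_const.sub contDiff_id)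

theorem cutoff_of_le {x : ℝ} (hx : 1 ≤ x) : cutoff x = 0 :=
  Real.smoothTransition.zero_of_nonpos (by linarith)

theorem deriv_cutoff_of_lt {x : ℝ} (hx : 1 < x) : deriv cutoff x = 0 := by
  have : cutoff =ᶠ[𝓝 x] fun _ => 0 := by
    filter_upwards [Ioi_mem_nhds hx] with y hy using cutoff_of_le (le_of_lt hy)
  rw [this.deriv_eq, deriv_const]

theorem deriv_deriv_cutoff_of_lt {x : ℝ} (hx : 1 < x) : deriv (deriv cutoff) x = 0 := by
  have : deriv cutoff =ᶠ[𝓝 x] fun _ => 0 := by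
    filter_upwards [Ioi_mem_nhds hx] with y hy using deriv_cutoff_of_lt hy
  rw [this.deriv_eq, deriv_const]

theorem memLp_cutoff : MemLp (fun x => (cutoff x : ℂ)) 2 halfLineMeasure :=
  memLp_halfLine_of_eq_zero (N := 2) ((isH2Loc_of_contDiff contDiff_cutoff).memLp_Ioc 2)
    fun x hx => by simp [cutoff_of_le (by linarith : (1 : ℝ) ≤ x)]

theorem memLp_slExpression_cutoff (hq : ContinuousOn q (Ici 0)) :
    MemLp (fun x => ((deriv (deriv cutoff) x : ℝ) : ℂ) - (q x : ℂ) * (cutoff x : ℂ)) 2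
      halfLineMeasure := by
  have h := isH2Loc_of_contDiff contDiff_cutoff
  refine memLp_halfLine_of_eq_zero (N := 2)
    ((h.memLp 2 two_pos).sub (memLp_Ioc_mul (continuousOn_ofReal_comp hq 2) (h.memLp_Ioc 2)))
    fun x hx => ?_
  rw [cutoff_of_le (by linarith), deriv_deriv_cutoff_of_lt (by linarith)]
  simp

/-- The element of `Ker L₀*` that represents the functional `f ↦ (L⁻¹ f)'(0)`. -/
noncomputable def deficiencyVec (hq : ContinuousOn q (Ici 0))
    (hpos : IsPositiveDefinite (slOperator q)) : HalfLine :=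
  memLp_cutoff.toLp _ + slInverse hpos ((memLp_slExpression_cutoff hq).toLp _)

theorem slInverse_inner (hq : ContinuousOn q (Ici 0)) (hpos : IsPositiveDefinite (slOperator q))
    (x y : HalfLine) : ⟪slInverse hpos x, y⟫_ℂ = ⟪x, slInverse hpos y⟫_ℂ :=
  (boundedInverse_isPositive (hA := hpos) (dense_slOperator_domain hq)).isSelfAdjoint.isSymmetric
    x y

/-- Lagrange's identity between L⁻¹f and the cutoff, which is 1 near neither end's expense: since
L⁻¹f vanishes at 0 and the cutoff with its derivative vanishes at 2, the only surviving boundary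
term is Y₁(0). -/
theorem inner_deficiencyVec (hq : ContinuousOn q (Ici 0))
    (hpos : IsPositiveDefinite (slOperator q)) {f : HalfLine} {Y Y₁ Y₂ : ℝ → ℂ}
    (h : IsH2Loc Y Y₁ Y₂) (h0 : Y 0 = 0) (hY : slInverse hpos f =ᵐ[halfLineMeasure] Y)
    (h2 : ∀ᵐ x ∂halfLineMeasure, Y₂ x = (q x : ℂ) * Y x - f x) :
    ⟪deficiencyVec hq hpos, f⟫_ℂ = Y₁ 0 := by
  have hE := isH2Loc_of_contDiff contDiff_cutoff
  have e1 := h.lagrange hE zero_le_two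
  rw [cutoff_of_le one_le_two, deriv_cutoff_of_lt one_lt_two, h0,
    show cutoff 0 = 1 from Real.smoothTransition.one_of_one_le (by norm_num)] at e1
  simp only [Complex.ofReal_zero, mul_zero, sub_zero, Complex.ofReal_one, mul_one, zero_mul,
    zero_sub] at e1
  have a1 := inner_toLp_eq f memLp_cutoff zero_le_two
    fun x hx => by simp [cutoff_of_le (by linarith : (1 : ℝ) ≤ x)]
  have a2 := inner_toLp_eq (slInverse hpos f) (memLp_slExpression_cutoff hq) zero_le_two
    fun x hx => by
      rw [cutoff_of_le (by linarith), deriv_deriv_cutoff_of_lt (by linarith)]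
      simp
  have i1 : IntervalIntegrable (fun s => star (f s) * (cutoff s : ℂ)) volume 0 2 :=
    intervalIntegrable_mul zero_le_two (memLp_Ioc f 2).star (hE.memLp_Ioc 2)
  have i2 : IntervalIntegrable (fun s => star (slInverse hpos f s) *
      (((deriv (deriv cutoff) s : ℝ) : ℂ) - (q s : ℂ) * (cutoff s : ℂ))) volume 0 2 :=
    intervalIntegrable_mul zero_le_two (memLp_Ioc _ 2).star
      ((memLp_slExpression_cutoff hq).mono_measure
        (Measure.restrict_mono_set _ Ioc_subset_Ioi_self))
  have e2 : ⟪f, deficiencyVec hq hpos⟫_ℂ = star (Y₁ 0) := by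
    rw [deficiencyVec, inner_add_right, ← slInverse_inner hq hpos, a1, a2,
      ← intervalIntegral.integral_add i1 i2, ← neg_neg (Y₁ 0), ← e1,
      ← intervalIntegral.integral_neg,
      intervalIntegral.integral_of_le zero_le_two, intervalIntegral.integral_of_le zero_le_two,
      ← starRingEnd_apply, ← integral_conj]
    refine integral_congr_ae ?_
    have hle := Measure.restrict_mono_set (volume : Measure ℝ)
      (Ioc_subset_Ioi_self : Ioc (0 : ℝ) 2 ⊆ Ioi 0)
    filter_upwards [ae_mono hle hY, ae_mono hle h2] with s hs hs2
    rw [hs, hs2]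
    simp only [← starRingEnd_apply, map_neg, map_sub, map_mul, Complex.conj_ofReal]
    ring
  rw [← inner_conj_symm, e2, ← starRingEnd_apply, Complex.conj_conj]

end CauchyData

/-! ### Vectors representing pointwise values of L⁻¹f. -/

section Evaluation

variable {q : ℝ → ℝ}

theorem continuousOn_ofReal_Ici (hq : ContinuousOn q (Ici 0)) :
    ContinuousOn (fun x => (q x : ℂ)) (Ici 0) :=
  Complex.continuous_ofReal.comp_continuousOn hq

/-- The vector that represents the functional `f ↦ (L⁻¹ f)'(x)`, extended to an even function
of `x`. -/
noncomputable def slopeVec (hq : ContinuousOn q (Ici 0)) (hpos : IsPositiveDefinite (slOperator q))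
    (x : ℝ) : HalfLine :=
  deficiencyVec hq hpos + slInverse hpos (truncation (continuousOn_ofReal_Ici hq) |x|) -
    truncation (φ := fun _ => 1) continuousOn_const |x|

/-- The vector that represents the functional `f ↦ (L⁻¹ f)(x)`, extended to an odd function
of `x`. -/
noncomputable def evalVec (hq : ContinuousOn q (Ici 0)) (hpos : IsPositiveDefinite (slOperator q))
    (x : ℝ) : HalfLine :=
  ∫ ξ in (0 : ℝ)..x, slopeVec hq hpos ξ

/-- The odd extension of a function on the half-line. -/
noncomputable def oddExt (f : ℝ → ℂ) (x : ℝ) : ℂ := if 0 < x then f x else -f (-x)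

variable (hq : ContinuousOn q (Ici 0)) (hpos : IsPositiveDefinite (slOperator q))

theorem continuous_slopeVec : Continuous (slopeVec hq hpos) :=
  (continuous_const.add ((slInverse hpos).continuous.comp
    ((continuous_truncation _).comp continuous_abs))).sub
    ((continuous_truncation _).comp continuous_abs)

theorem slopeVec_neg (x : ℝ) : slopeVec hq hpos (-x) = slopeVec hq hpos x := by
  simp only [slopeVec, abs_neg]

theorem slopeVec_zero : slopeVec hq hpos 0 = deficiencyVec hq hpos := by
  have h : ∀ {φ : ℝ → ℂ} (hφ : ContinuousOn φ (Ici 0)), truncation hφ 0 = 0 := by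
    intro φ hφ
    refine ext_inner_right ℂ fun f => ?_
    rw [inner_truncation hφ le_rfl, intervalIntegral.integral_same, inner_zero_left]
  simp only [slopeVec, abs_zero, h, map_zero, add_zero, sub_zero]

theorem hasDerivAt_evalVec (x : ℝ) :
    HasDerivAt (evalVec hq hpos) (slopeVec hq hpos x) x :=
  ((continuous_slopeVec hq hpos).integral_hasStrictDerivAt 0 x).hasDerivAt

theorem continuous_evalVec : Continuous (evalVec hq hpos) :=
  continuous_iff_continuousAt.2 fun x => (hasDerivAt_evalVec hq hpos x).continuousAt

theorem evalVec_zero : evalVec hq hpos 0 = 0 := intervalIntegral.integral_same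

theorem evalVec_neg (x : ℝ) : evalVec hq hpos (-x) = -evalVec hq hpos x := by
  have h := intervalIntegral.integral_comp_neg (a := 0) (b := x) (slopeVec hq hpos)
  simp only [slopeVec_neg, neg_zero] at h
  rw [evalVec, evalVec, h, ← intervalIntegral.integral_symm]

theorem hasDerivAt_inner_evalVec (f : HalfLine) (x : ℝ) :
    HasDerivAt (fun x => ⟪evalVec hq hpos x, f⟫_ℂ) ⟪slopeVec hq hpos x, f⟫_ℂ x := by
  simpa using (hasDerivAt_evalVec hq hpos x).inner ℂ (hasDerivAt_const x f)

/-- This is (L⁻¹f)'' = q L⁻¹f − f integrated from 0 to x. The two truncations in the definition of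
the vector represent the two integrals. -/
theorem inner_slopeVec (f : HalfLine) {x : ℝ} (hx : 0 ≤ x) : ⟪slopeVec hq hpos x, f⟫_ℂ =
    ⟪deficiencyVec hq hpos, f⟫_ℂ + ∫ s in (0 : ℝ)..x, ((q s : ℂ) * slInverse hpos f s - f s) := by
  have i1 : IntervalIntegrable (fun s => star (q s : ℂ) * slInverse hpos f s) volume 0 x := by
    refine intervalIntegrable_mul hx ?_ (memLp_Ioc _ x)
    exact (memLp_Ioc_of_continuousOn (continuousOn_ofReal_comp hq x)).star
  have i2 : IntervalIntegrable (fun s => star (1 : ℂ) * f s) volume 0 x :=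
    intervalIntegrable_mul hx (memLp_Ioc_of_continuousOn continuousOn_const) (memLp_Ioc _ x)
  rw [slopeVec, abs_of_nonneg hx, inner_sub_left, inner_add_left, slInverse_inner hq,
    inner_truncation _ hx, inner_truncation _ hx, add_sub_assoc,
    ← intervalIntegral.integral_sub i1 i2]
  simp only [← starRingEnd_apply, Complex.conj_ofReal, map_one, one_mul]

/-- Both sides have the same derivative at 0 and the same integrated equation. The pairing with
`evalVec` is thus the C¹ representative of L⁻¹f, jointly controllable in x and f. -/
theorem slInverse_ae_eq (f : HalfLine) :
    slInverse hpos f =ᵐ[halfLineMeasure] fun x => ⟪evalVec hq hpos x, f⟫_ℂ := by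
  obtain ⟨Y, Y₁, Y₂, h, h0, hY, h2⟩ := exists_isH2Loc_slInverse hq hpos f
  have hk := inner_deficiencyVec hq hpos h h0 hY (by
    filter_upwards [hY] with x hx
    rw [h2, hx])
  filter_upwards [hY, ae_restrict_mem measurableSet_Ioi] with x hx hx0
  have hx0' : (0 : ℝ) ≤ x := le_of_lt hx0
  rw [hx, h.eq x hx0', h0, zero_add]
  have e := intervalIntegral.integral_eq_sub_of_hasDerivAt
    (fun ξ (_ : ξ ∈ uIcc 0 x) => hasDerivAt_inner_evalVec hq hpos f ξ)
    (((continuous_slopeVec hq hpos).inner continuous_const).intervalIntegrable 0 x)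
  rw [evalVec_zero, inner_zero_left, sub_zero] at e
  rw [← e]
  refine intervalIntegral.integral_congr fun ξ hξ => ?_
  rw [uIcc_of_le hx0'] at hξ
  rw [inner_slopeVec hq hpos f hξ.1, hk, h.deriv_eq ξ hξ.1]
  simp only [h2]

theorem oddExt_neg {f : ℝ → ℂ} {x : ℝ} (hx : 0 < x) : oddExt f (-x) = -oddExt f x := by
  rw [oddExt, oddExt, if_neg (by linarith), if_pos hx, neg_neg]

/-- The integrated equation `-(L⁻¹ f)'' + q (L⁻¹ f) = f`, extended to the whole line. -/
theorem inner_slopeVec_eq_integral (f : HalfLine) (x : ℝ) : ⟪slopeVec hq hpos x, f⟫_ℂ =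
    ⟪deficiencyVec hq hpos, f⟫_ℂ +
      ∫ s in (0 : ℝ)..x, ((q |s| : ℂ) * ⟪evalVec hq hpos s, f⟫_ℂ - oddExt f s) := by
  have key : ∀ x, 0 ≤ x → ⟪slopeVec hq hpos x, f⟫_ℂ = ⟪deficiencyVec hq hpos, f⟫_ℂ +
      ∫ s in (0 : ℝ)..x, ((q |s| : ℂ) * ⟪evalVec hq hpos s, f⟫_ℂ - oddExt f s) := by
    intro x hx
    rw [inner_slopeVec hq hpos f hx, intervalIntegral.integral_of_le hx,
      intervalIntegral.integral_of_le hx]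
    congr 1
    refine integral_congr_ae ?_
    filter_upwards [ae_mono (Measure.restrict_mono_set volume
      (Ioc_subset_Ioi_self : Ioc (0 : ℝ) x ⊆ Ioi 0)) (slInverse_ae_eq hq hpos f),
      ae_restrict_mem measurableSet_Ioc] with s hs hs0
    rw [hs, oddExt, if_pos hs0.1, abs_of_pos hs0.1]
  rcases le_total 0 x with hx | hx
  · exact key x hx
  -- For negative x: the left side is even, and the integrand is odd away from 0, so its primitive
  -- is even too.
  · rw [← slopeVec_neg, key (-x) (by linarith)]
    congr 1
    have e := intervalIntegral.integral_comp_neg (a := 0) (b := x)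
      (fun s => (q |s| : ℂ) * ⟪evalVec hq hpos s, f⟫_ℂ - oddExt f s)
    rw [neg_zero] at e
    rw [intervalIntegral.integral_symm, ← e, ← intervalIntegral.integral_neg,
      intervalIntegral.integral_symm x 0, intervalIntegral.integral_symm x 0, neg_inj,
      intervalIntegral.integral_of_le hx, intervalIntegral.integral_of_le hx,
      integral_Ioc_eq_integral_Ioo, integral_Ioc_eq_integral_Ioo]
    refine setIntegral_congr_fun measurableSet_Ioo fun s hs => ?_
    simp only [abs_neg, evalVec_neg, inner_neg_left]
    have h1 := oddExt_neg (f := f) (x := -s) (by linarith [hs.2])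
    rw [neg_neg] at h1
    rw [h1]
    ring

theorem intervalIntegrable_oddExt (f : HalfLine) (a b : ℝ) :
    IntervalIntegrable (oddExt f) volume a b := by
  have key : ∀ N : ℝ, 0 ≤ N → IntervalIntegrable (oddExt f) volume 0 N := by
    intro N hN
    rw [intervalIntegrable_iff_integrableOn_Ioc_of_le hN]
    refine ((memLp_Ioc f N).integrable (by norm_num)).congr ?_
    filter_upwards [ae_restrict_mem measurableSet_Ioc] with s hs
    rw [oddExt, if_pos hs.1]
  have key' : ∀ N : ℝ, IntervalIntegrable (oddExt f) volume 0 N := by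
    intro N
    rcases le_total 0 N with hN | hN
    · exact key N hN
    · have h := (key (-N) (by linarith)).comp_sub_left 0
      simp only [sub_zero, zero_sub, neg_neg] at h
      refine IntervalIntegrable.symm ?_
      rw [intervalIntegrable_iff_integrableOn_Ioo_of_le hN]
      have h' := h.symm.neg
      rw [intervalIntegrable_iff_integrableOn_Ioo_of_le hN] at h'
      refine h'.congr ?_
      filter_upwards [ae_restrict_mem measurableSet_Ioo] with s hs
      have h1 := oddExt_neg (f := f) (x := -s) (by linarith [hs.2])
      rw [neg_neg] at h1
      rw [h1]
      rfl
  exact (key' a).symm.trans (key' b)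

theorem continuous_ofReal_abs (hq : ContinuousOn q (Ici 0)) : Continuous fun x : ℝ => (q |x| : ℂ) :=
  Complex.continuous_ofReal.comp (hq.comp_continuous continuous_abs fun x => abs_nonneg x)

/-- If `-f = L⁻¹ g` on an interval, then `L⁻¹ f` is twice differentiable there. -/
theorem hasDerivAt_inner_slopeVec {f g : HalfLine} {a b : ℝ}
    (h : ∀ᵐ ξ : ℝ, ξ ∈ Ioo a b → oddExt f ξ + ⟪evalVec hq hpos ξ, g⟫_ℂ = 0) {x : ℝ}
    (hx : x ∈ Ioo a b) : HasDerivAt (fun x => ⟪slopeVec hq hpos x, f⟫_ℂ)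
      ((q |x| : ℂ) * ⟪evalVec hq hpos x, f⟫_ℂ + ⟪evalVec hq hpos x, g⟫_ℂ) x := by
  set G : ℝ → ℂ := fun ξ => (q |ξ| : ℂ) * ⟪evalVec hq hpos ξ, f⟫_ℂ + ⟪evalVec hq hpos ξ, g⟫_ℂ
  have hG : Continuous G :=
    ((continuous_ofReal_abs hq).mul ((continuous_evalVec hq hpos).inner continuous_const)).add
      ((continuous_evalVec hq hpos).inner continuous_const)
  have h1 : HasDerivAt (fun y => ⟪slopeVec hq hpos x, f⟫_ℂ + ∫ s in x..y, G s) (G x) x :=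
    (hG.integral_hasStrictDerivAt x x).hasDerivAt.const_add _
  refine h1.congr_of_eventuallyEq ?_
  filter_upwards [Ioo_mem_nhds hx.1 hx.2] with y hy
  have hi : ∀ c d, IntervalIntegrable
      (fun s => (q |s| : ℂ) * ⟪evalVec hq hpos s, f⟫_ℂ - oddExt f s) volume c d := fun c d =>
    (((continuous_ofReal_abs hq).mul
      ((continuous_evalVec hq hpos).inner continuous_const)).intervalIntegrable c d).sub
      (intervalIntegrable_oddExt f c d)
  have e : ∫ s in x..y, G s =
      ∫ s in x..y, ((q |s| : ℂ) * ⟪evalVec hq hpos s, f⟫_ℂ - oddExt f s) := by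
    refine intervalIntegral.integral_congr_ae ?_
    filter_upwards [h] with s hs hs'
    have hmem : s ∈ Ioo a b := by
      rw [mem_uIoc] at hs'
      rcases hs' with hs' | hs'
      · exact ⟨hx.1.trans hs'.1, hs'.2.trans_lt hy.2⟩
      · exact ⟨hy.1.trans hs'.1, hs'.2.trans_lt hx.2⟩
    simp only [G]
    linear_combination hs hmem
  rw [e, inner_slopeVec_eq_integral hq hpos f y, inner_slopeVec_eq_integral hq hpos f x, add_assoc,
    intervalIntegral.integral_add_adjacent_intervals (hi 0 x) (hi x y)]

/-- The operator `L` is local. -/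
theorem ae_eq_zero_of_inner_evalVec_eq_zero {f : HalfLine} {a b : ℝ} (ha : 0 ≤ a)
    (h : ∀ x ∈ Ioo a b, ⟪evalVec hq hpos x, f⟫_ℂ = 0) :
    ∀ᵐ x ∂halfLineMeasure, x ∈ Ioo a b → f x = 0 := by
  have hD : ∀ x ∈ Ioo a b, ⟪slopeVec hq hpos x, f⟫_ℂ = 0 := by
    intro x hx
    refine (hasDerivAt_inner_evalVec hq hpos f x).unique ?_
    refine (hasDerivAt_const x (0 : ℂ)).congr_of_eventuallyEq ?_
    filter_upwards [Ioo_mem_nhds hx.1 hx.2] with y hy using h y hy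
  -- Rational base points keep the exceptional set of Lebesgue differentiation null while the
  -- interval may still be chosen after x.
  have hae : ∀ᵐ x : ℝ, ∀ c d : ℚ, x ∈ uIcc (c : ℝ) d →
      HasDerivAt (fun x => ∫ t in (c : ℝ)..x, oddExt f t) (oddExt f x) x :=
    ae_all_iff.2 fun c => ae_all_iff.2 fun d => by
      filter_upwards [(intervalIntegrable_oddExt f c d).ae_hasDerivAt_integral] with x hx hx'
      exact hx hx' _ left_mem_uIcc
  refine ae_restrict_of_ae ?_
  filter_upwards [hae] with x hx hxab
  obtain ⟨c, hc1, hc2⟩ := exists_rat_btwn hxab.1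
  obtain ⟨d, hd1, hd2⟩ := exists_rat_btwn hxab.2
  have h1 := hx c d (by rw [uIcc_of_le (hc2.trans hd1).le]; exact ⟨hc2.le, hd1.le⟩)
  have hc : (c : ℝ) ∈ Ioo a b := ⟨hc1, hc2.trans hxab.2⟩
  have h2 : HasDerivAt (fun x => ∫ t in (c : ℝ)..x, oddExt f t) 0 x := by
    refine (hasDerivAt_const x (0 : ℂ)).congr_of_eventuallyEq ?_
    filter_upwards [Ioo_mem_nhds hxab.1 hxab.2] with y hy
    have hi : ∀ c d, IntervalIntegrable
        (fun s => (q |s| : ℂ) * ⟪evalVec hq hpos s, f⟫_ℂ - oddExt f s) volume c d := fun c d =>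
      (((continuous_ofReal_abs hq).mul
        ((continuous_evalVec hq hpos).inner continuous_const)).intervalIntegrable c d).sub
        (intervalIntegrable_oddExt f c d)
    have e1 := inner_slopeVec_eq_integral hq hpos f y
    have e2 := inner_slopeVec_eq_integral hq hpos f c
    rw [hD y hy] at e1
    rw [hD c hc] at e2
    have e3 := intervalIntegral.integral_interval_sub_left (hi 0 y) (hi 0 c)
    have e4 : ∫ s in (c : ℝ)..y, ((q |s| : ℂ) * ⟪evalVec hq hpos s, f⟫_ℂ - oddExt f s) =
        ∫ s in (c : ℝ)..y, -oddExt f s := by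
      refine intervalIntegral.integral_congr fun s hs => ?_
      rw [h s ((ordConnected_Ioo.uIcc_subset hc hy) hs), mul_zero, zero_sub]
    rw [e4, intervalIntegral.integral_neg] at e3
    linear_combination e3 + e1 - e2
  have h3 := h1.unique h2
  rwa [oddExt, if_pos (ha.trans_lt hxab.1)] at h3

end Evaluation

/-! ### Uniqueness in a characteristic triangle. -/

section PlaneWaves

theorem hasStrictFDerivAt_of_hasDerivAt {Ω : Set (ℝ × ℝ)} (hΩ : IsOpen Ω) {g g₁ g₂ : ℝ → ℝ → ℂ}
    (h1 : ∀ a b, (a, b) ∈ Ω → HasDerivAt (fun a => g a b) (g₁ a b) a)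
    (h2 : ∀ a b, (a, b) ∈ Ω → HasDerivAt (fun b => g a b) (g₂ a b) b)
    (c1 : ContinuousOn (↿g₁) Ω) (c2 : ContinuousOn (↿g₂) Ω) {a b : ℝ} (hz : (a, b) ∈ Ω) :
    HasStrictFDerivAt (↿g) ((ContinuousLinearMap.toSpanSingleton ℝ (g₁ a b)).coprod
      (ContinuousLinearMap.toSpanSingleton ℝ (g₂ a b))) (a, b) := by
  have hmem := hΩ.mem_nhds hz
  have hc : Continuous fun w : ℂ => ContinuousLinearMap.toSpanSingleton ℝ w :=
    (ContinuousLinearMap.toSpanSingletonCLE (𝕜 := ℝ) (E := ℂ)).continuous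
  refine hasStrictFDerivAt_uncurry_coprod (u := (a, b)) (f := g)
    (f₁ := fun a b => ContinuousLinearMap.toSpanSingleton ℝ (g₁ a b))
    (f₂ := fun a b => ContinuousLinearMap.toSpanSingleton ℝ (g₂ a b)) ?_ ?_ ?_ ?_
  · filter_upwards [hmem] with z hz using (h1 z.1 z.2 hz).hasFDerivAt
  · filter_upwards [hmem] with z hz using (h2 z.1 z.2 hz).hasFDerivAt
  · exact hc.continuousAt.comp (c1.continuousAt hmem)
  · exact hc.continuousAt.comp (c2.continuousAt hmem)

theorem hasDerivAt_comp_curve {Ω : Set (ℝ × ℝ)} (hΩ : IsOpen Ω) {g g₁ g₂ : ℝ → ℝ → ℂ}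
    (h1 : ∀ a b, (a, b) ∈ Ω → HasDerivAt (fun a => g a b) (g₁ a b) a)
    (h2 : ∀ a b, (a, b) ∈ Ω → HasDerivAt (fun b => g a b) (g₂ a b) b)
    (c1 : ContinuousOn (↿g₁) Ω) (c2 : ContinuousOn (↿g₂) Ω) {γ : ℝ → ℝ} {τ d : ℝ}
    (hγ : HasDerivAt γ d τ) (hz : (τ, γ τ) ∈ Ω) :
    HasDerivAt (fun τ => g τ (γ τ)) (g₁ τ (γ τ) + d • g₂ τ (γ τ)) τ := by
  have h := (hasStrictFDerivAt_of_hasDerivAt hΩ h1 h2 c1 c2 hz).hasFDerivAt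
  have := h.comp_hasDerivAt τ ((hasDerivAt_id τ).prodMk hγ)
  refine HasDerivAt.congr_deriv this ?_
  simp

/-- Uniqueness in a characteristic triangle for the one-dimensional wave equation. -/
theorem eq_zero_of_wave {Ω : Set (ℝ × ℝ)} (hΩ : IsOpen Ω) {u u₁ u₂ u₁₁ u₁₂ u₂₂ : ℝ → ℝ → ℂ}
    {T C : ℝ} (hT : ∀ a b, 0 ≤ a → a + |b| ≤ T → (a, b) ∈ Ω)
    (h1 : ∀ a b, (a, b) ∈ Ω → HasDerivAt (fun a => u a b) (u₁ a b) a)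
    (h11 : ∀ a b, (a, b) ∈ Ω → HasDerivAt (fun a => u₁ a b) (u₁₁ a b) a)
    (h12 : ∀ a b, (a, b) ∈ Ω → HasDerivAt (fun b => u₁ a b) (u₁₂ a b) b)
    (h21 : ∀ a b, (a, b) ∈ Ω → HasDerivAt (fun a => u₂ a b) (u₁₂ a b) a)
    (h22 : ∀ a b, (a, b) ∈ Ω → HasDerivAt (fun b => u₂ a b) (u₂₂ a b) b)
    (c : ContinuousOn (↿u) Ω) (c11 : ContinuousOn (↿u₁₁) Ω) (c12 : ContinuousOn (↿u₁₂) Ω)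
    (c22 : ContinuousOn (↿u₂₂) Ω)
    (hC : ∀ a b, 0 ≤ a → a + |b| ≤ T → ‖u₁₁ a b - u₂₂ a b‖ ≤ C * ‖u a b‖)
    (d0 : ∀ b, |b| ≤ T → u 0 b = 0) (d1 : ∀ b, |b| ≤ T → u₁ 0 b = 0)
    (d2 : ∀ b, |b| ≤ T → u₂ 0 b = 0) : ∀ a b, 0 ≤ a → a + |b| ≤ T → u a b = 0 := by
  have c1 : ContinuousOn (↿u₁) Ω := fun z hz =>
    (hasStrictFDerivAt_of_hasDerivAt hΩ h11 h12 c11 c12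
      (a := z.1) (b := z.2) hz).continuousAt.continuousWithinAt
  have c2 : ContinuousOn (↿u₂) Ω := fun z hz =>
    (hasStrictFDerivAt_of_hasDerivAt hΩ h21 h22 c12 c22
      (a := z.1) (b := z.2) hz).continuousAt.continuousWithinAt
  set p : ℝ → ℝ → ℂ := fun a b => u₁ a b + u₂ a b with hp
  set m : ℝ → ℝ → ℂ := fun a b => u₁ a b - u₂ a b with hm
  -- a common bound on the triangle
  obtain ⟨K, hK⟩ : ∃ K, ∀ a b, 0 ≤ a → a + |b| ≤ T →
      ‖u a b‖ ≤ K ∧ ‖p a b‖ ≤ K ∧ ‖m a b‖ ≤ K := by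
    have hcomp : IsCompact {z : ℝ × ℝ | 0 ≤ z.1 ∧ z.1 + |z.2| ≤ T} := by
      refine (isCompact_Icc (a := ((0 : ℝ), -T)) (b := (T, T))).of_isClosed_subset ?_ ?_
      · exact (isClosed_le continuous_const continuous_fst).inter
          (isClosed_le (continuous_fst.add continuous_snd.abs) continuous_const)
      · rintro ⟨a, b⟩ ⟨ha, hab⟩
        simp only at ha hab
        have := neg_abs_le b
        have := le_abs_self b
        have := abs_nonneg b
        exact ⟨Prod.mk_le_mk.2 ⟨ha, by linarith⟩, Prod.mk_le_mk.2 ⟨by linarith, by linarith⟩⟩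
    have hsub : {z : ℝ × ℝ | 0 ≤ z.1 ∧ z.1 + |z.2| ≤ T} ⊆ Ω := fun z hz => hT z.1 z.2 hz.1 hz.2
    obtain ⟨K0, hK0⟩ := hcomp.exists_bound_of_continuousOn (c.mono hsub)
    obtain ⟨K1, hK1⟩ := hcomp.exists_bound_of_continuousOn ((c1.add c2).mono hsub)
    obtain ⟨K2, hK2⟩ := hcomp.exists_bound_of_continuousOn ((c1.sub c2).mono hsub)
    refine ⟨max K0 (max K1 K2), fun a b ha hab => ⟨(hK0 (a, b) ⟨ha, hab⟩).trans (le_max_left _ _),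
      (hK1 (a, b) ⟨ha, hab⟩).trans ((le_max_left _ _).trans (le_max_right _ _)),
      (hK2 (a, b) ⟨ha, hab⟩).trans ((le_max_right _ _).trans (le_max_right _ _))⟩⟩
  -- `C` serves the two characteristic derivatives p = u_a + u_b and m = u_a − u_b, while 1 serves u
  -- itself, since u_a = (p + m)/2. One constant lets all three share an estimate.
  set L : ℝ := max C 1 with hL
  have hL1 : 1 ≤ L := le_max_right _ _
  -- derivatives along the characteristics
  have dp : ∀ β τ, 0 ≤ τ → τ + |β - τ| ≤ T →
      HasDerivAt (fun τ => p τ (β - τ)) (u₁₁ τ (β - τ) - u₂₂ τ (β - τ)) τ := by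
    intro β τ h0 h
    have hγ : HasDerivAt (fun τ : ℝ => β - τ) (-1) τ := (hasDerivAt_id τ).const_sub β
    have := (hasDerivAt_comp_curve hΩ h11 h12 c11 c12 hγ (hT _ _ h0 h)).add
      (hasDerivAt_comp_curve hΩ h21 h22 c12 c22 hγ (hT _ _ h0 h))
    refine this.congr_deriv ?_
    simp only [neg_smul, one_smul]
    ring
  have dm : ∀ β τ, 0 ≤ τ → τ + |β + τ| ≤ T →
      HasDerivAt (fun τ => m τ (β + τ)) (u₁₁ τ (β + τ) - u₂₂ τ (β + τ)) τ := by
    intro β τ h0 h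
    have hγ : HasDerivAt (fun τ : ℝ => β + τ) 1 τ := (hasDerivAt_id τ).const_add β
    have := (hasDerivAt_comp_curve hΩ h11 h12 c11 c12 hγ (hT _ _ h0 h)).sub
      (hasDerivAt_comp_curve hΩ h21 h22 c12 c22 hγ (hT _ _ h0 h))
    refine this.congr_deriv ?_
    simp only [one_smul]
    ring
  -- one step of the iteration, along an arbitrary curve
  have step : ∀ (n : ℕ) (a : ℝ) (f f' : ℝ → ℂ), 0 ≤ a → f 0 = 0 →
      (∀ τ ∈ Icc 0 a, HasDerivAt f (f' τ) τ) →
      (∀ τ ∈ Icc 0 a, ‖f' τ‖ ≤ L * (K * (L * τ) ^ n / n.factorial)) →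
      ‖f a‖ ≤ K * (L * a) ^ (n + 1) / (n + 1).factorial := by
    intro n a f f' ha f0 hf hf'
    have hB : ∀ x, HasDerivAt (fun τ => K * (L * τ) ^ (n + 1) / (n + 1).factorial)
        (L * (K * (L * x) ^ n / n.factorial)) x := by
      intro x
      have h := ((((hasDerivAt_id x).const_mul L).pow (n + 1)).const_mul K).div_const
        ((n + 1).factorial : ℝ)
      refine h.congr_deriv ?_
      have : (n.factorial : ℝ) ≠ 0 := Nat.cast_ne_zero.2 n.factorial_ne_zero
      have : (n : ℝ) + 1 ≠ 0 := by positivity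
      simp only [id, Nat.factorial_succ]
      push_cast
      field_simp
    refine image_norm_le_of_norm_deriv_right_le_deriv_boundary (f' := f') (a := 0) (b := a)
      (fun τ hτ => (hf τ hτ).continuousAt.continuousWithinAt)
      (fun τ hτ => (hf τ ⟨hτ.1, hτ.2.le⟩).hasDerivWithinAt) ?_ hB
      (fun τ hτ => hf' τ ⟨hτ.1, hτ.2.le⟩) ⟨ha, le_rfl⟩
    rw [f0]
    simp
  -- Picard iteration: each integration from a = 0, vertically for u and along the characteristics
  -- through (a, b) for p and m, gains one power of L a and one factor of the factorial. These paths
  -- stay in the triangle.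
  have main : ∀ n : ℕ, ∀ a b, 0 ≤ a → a + |b| ≤ T → ‖u a b‖ ≤ K * (L * a) ^ n / n.factorial ∧
      ‖p a b‖ ≤ K * (L * a) ^ n / n.factorial ∧ ‖m a b‖ ≤ K * (L * a) ^ n / n.factorial := by
    intro n
    induction n with
    | zero =>
      intro a b ha hab
      simpa using hK a b ha hab
    | succ n ih =>
      intro a b ha hab
      have hu₁ : ∀ a b, u₁ a b = (p a b + m a b) / 2 := fun a b => by
        simp only [p, m]
        ring
      have bd : ∀ a b, 0 ≤ a → a + |b| ≤ T →
          ‖u₁₁ a b - u₂₂ a b‖ ≤ L * (K * (L * a) ^ n / n.factorial) := by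
        intro a b ha hab
        refine (hC a b ha hab).trans ?_
        refine (mul_le_mul_of_nonneg_right (le_max_left C 1) (norm_nonneg _)).trans ?_
        exact mul_le_mul_of_nonneg_left (ih a b ha hab).1 (by linarith)
      refine ⟨?_, ?_, ?_⟩
      · refine step n a (fun τ => u τ b) (fun τ => u₁ τ b) ha (d0 b (by linarith))
          (fun τ hτ => h1 τ b (hT τ b hτ.1 (by linarith [hτ.2]))) fun τ hτ => ?_
        obtain ⟨-, i1, i2⟩ := ih τ b hτ.1 (by linarith [hτ.2])
        have h0 : 0 ≤ K * (L * τ) ^ n / n.factorial := (norm_nonneg _).trans i1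
        rw [hu₁, norm_div, Complex.norm_ofNat]
        have := norm_add_le (p τ b) (m τ b)
        nlinarith
      · have e : p a b = (fun τ => p τ (a + b - τ)) a := by simp
        have hab' : |a + b| ≤ T := (abs_add_le a b).trans (by rwa [abs_of_nonneg ha])
        have hin : ∀ τ ∈ Icc 0 a, τ + |a + b - τ| ≤ T := fun τ hτ => by
          have : |a + b - τ| ≤ |a - τ| + |b| := by
            rw [show a + b - τ = (a - τ) + b by ring]
            exact abs_add_le _ _
          rw [abs_of_nonneg (by linarith [hτ.2] : 0 ≤ a - τ)] at this
          linarith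
        rw [e]
        refine step n a _ _ ha ?_ (fun τ hτ => dp (a + b) τ hτ.1 (hin τ hτ))
          fun τ hτ => bd τ _ hτ.1 (hin τ hτ)
        simp only [p, sub_zero]
        rw [d1 _ hab', d2 _ hab', add_zero]
      · have e : m a b = (fun τ => m τ (b - a + τ)) a := by simp
        have hab' : |b - a| ≤ T := (abs_sub b a).trans (by rw [abs_of_nonneg ha]; linarith)
        have hin : ∀ τ ∈ Icc 0 a, τ + |b - a + τ| ≤ T := fun τ hτ => by
          have : |b - a + τ| ≤ |b| + |a - τ| := by
            rw [show b - a + τ = b - (a - τ) by ring]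
            exact abs_sub _ _
          rw [abs_of_nonneg (by linarith [hτ.2] : 0 ≤ a - τ)] at this
          linarith
        rw [e]
        refine step n a _ _ ha ?_ (fun τ hτ => dm (b - a) τ hτ.1 (hin τ hτ))
          fun τ hτ => bd τ _ hτ.1 (hin τ hτ)
        simp only [m, add_zero]
        rw [d1 _ hab', d2 _ hab', sub_zero]
  intro a b ha hab
  have hlim := (FloorSemiring.tendsto_pow_div_factorial_atTop (L * a)).const_mul K
  rw [mul_zero] at hlim
  refine norm_le_zero_iff.1 (ge_of_tendsto' hlim fun n => ?_)
  rw [← mul_div_assoc]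
  exact (main n a b ha hab).1

end PlaneWaves

/-! ### Stability of linear observations under smoothing. -/

section Regularization

variable {E : Type*} [NormedAddCommGroup E] [InnerProductSpace ℂ E]

theorem hasDerivAt_apply {T : ℝ → E →L[ℂ] E} {T' : E →L[ℂ] E} {s : ℝ} (h : HasDerivAt T T' s)
    (y : E) : HasDerivAt (fun s => T s y) (T' y) s :=
  ((ContinuousLinearMap.apply ℂ E y).restrictScalars ℝ).hasFDerivAt.comp_hasDerivAt s h

variable [CompleteSpace E] {R : E →L[ℂ] E}

/-- The τ-derivative of ⟨v, S(s)S(τ)y⟩ is the mean of the observations at s + τ and s − τ. For a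
linear observation this mean is sc, independent of τ. The window shrinks by ε because s ± τ must
stay inside it. -/
theorem inner_sineFun_sineFun {v y : E} {c : ℂ} {t : ℝ}
    (h : ∀ s : ℝ, |s| ≤ t → ⟪v, sineFun R s y⟫_ℂ = s * c) {s ε : ℝ} (hε : 0 ≤ ε)
    (hs : |s| + ε ≤ t) : ⟪v, sineFun R s (sineFun R ε y)⟫_ℂ = s * (ε * c) := by
  have hd : ∀ τ ∈ Ico 0 ε, HasDerivAt
      (fun τ : ℝ => ⟪v, (sineFun R s * sineFun R τ) y⟫_ℂ - s * (τ * c)) 0 τ := by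
    intro τ hτ
    have h1 := (hasDerivAt_const τ v).inner ℂ
      (hasDerivAt_apply (hasDerivAt_sineFun_mul_sineFun (R := R) s τ) y)
    have h2 : HasDerivAt (fun τ : ℝ => (s : ℂ) * ((τ : ℂ) * c)) (s * (1 * c)) τ :=
      ((Complex.ofRealCLM.hasDerivAt (x := τ)).mul_const c).const_mul (s : ℂ)
    refine (h1.sub h2).congr_deriv ?_
    have e1 := h (s + τ) ((abs_add_le s τ).trans (by rw [abs_of_nonneg hτ.1]; linarith [hτ.2]))
    have e2 := h (s - τ) ((abs_sub s τ).trans (by rw [abs_of_nonneg hτ.1]; linarith [hτ.2]))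
    have e3 : ((1 / 2 : ℝ) • (sineFun R (s + τ) + sineFun R (s - τ))) y =
        ((1 / 2 : ℝ) : ℂ) • (sineFun R (s + τ) y + sineFun R (s - τ) y) := rfl
    simp only [add_zero, inner_zero_left, e3, inner_smul_right, inner_add_right, e1, e2]
    push_cast
    ring
  have := constant_of_has_deriv_right_zero (f := fun τ : ℝ =>
    ⟪v, (sineFun R s * sineFun R τ) y⟫_ℂ - s * (τ * c)) (a := 0) (b := ε) ?_
    (fun τ hτ => (hd τ hτ).hasDerivWithinAt) ε ⟨hε, le_rfl⟩
  · simp only [sineFun_zero, mul_zero, Complex.ofReal_zero, zero_mul, sub_zero] at this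
    have h0 : ⟪v, (0 : E →L[ℂ] E) y⟫_ℂ = 0 := by simp
    rw [h0] at this
    exact sub_eq_zero.1 this
  · have hc : Continuous fun τ : ℝ => (sineFun R s * sineFun R τ) y :=
      (continuous_const.mul continuous_sineFun).clm_apply continuous_const
    exact ((continuous_const.inner hc).sub (continuous_const.mul
      (Complex.continuous_ofReal.mul continuous_const))).continuousOn

theorem inner_sineFun_pow {v y : E} {c : ℂ} {t : ℝ}
    (h : ∀ s : ℝ, |s| ≤ t → ⟪v, sineFun R s y⟫_ℂ = s * c) {ε : ℝ} (hε : 0 ≤ ε) (j : ℕ) :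
    ∀ s : ℝ, |s| ≤ t - j * ε → ⟪v, sineFun R s ((sineFun R ε ^ j) y)⟫_ℂ = s * (ε ^ j * c) := by
  induction j with
  | zero => simpa using h
  | succ j ih =>
    intro s hs
    push_cast at hs
    have := inner_sineFun_sineFun ih hε (s := s) (by linarith)
    rw [pow_succ' (sineFun R ε)]
    refine this.trans ?_
    ring

end Regularization

/-! ### Uniqueness for waves on the half-line. -/

section WaveOnHalfLine

variable {q : ℝ → ℝ} (hq : ContinuousOn q (Ici 0)) (hpos : IsPositiveDefinite (slOperator q))

/-- Both terms are odd, so the relation reflects from positive to negative points. After reflection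
the equation holds across 0 and the boundary no longer has to be treated. -/
theorem oddExt_add_inner_evalVec {f g : HalfLine} {J : Set ℝ} (hJ : ∀ ξ ∈ J, ξ < 0 → -ξ ∈ J)
    (h : ∀ᵐ x ∂halfLineMeasure, x ∈ J → f x + ⟪evalVec hq hpos x, g⟫_ℂ = 0) :
    ∀ᵐ ξ : ℝ, ξ ∈ J → oddExt f ξ + ⟪evalVec hq hpos ξ, g⟫_ℂ = 0 := by
  rw [ae_restrict_iff' measurableSet_Ioi] at h
  have h' := (Measure.measurePreserving_neg (volume : Measure ℝ)).quasiMeasurePreserving.ae h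
  filter_upwards [h, h', Measure.ae_ne volume (0 : ℝ)] with ξ h1 h2 h0 hξ
  rcases lt_or_gt_of_ne h0 with hneg | hpos'
  · have h3 := h2 (show (0 : ℝ) < -ξ by linarith) (hJ ξ hξ hneg)
    rw [oddExt, if_neg (not_lt.2 hneg.le)]
    rw [evalVec_neg, inner_neg_left] at h3
    linear_combination -h3
  · rw [oddExt, if_pos hpos']
    exact h1 hpos' hξ

/-- A solution of the wave equation on the half-line with vanishing Cauchy data on the segment
`{x₀} × [-t, t]` vanishes in the characteristic square. -/
theorem inner_evalVec_eq_zero_of_cauchyData {F F₁ F₂ : ℝ → HalfLine}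
    (h1 : ∀ s, HasDerivAt F (F₁ s) s) (h2 : ∀ s, HasDerivAt F₁ (F₂ s) s) (hc : Continuous F₂)
    (hF : ∀ s, ∀ᵐ x ∂halfLineMeasure, F s x + ⟪evalVec hq hpos x, F₂ s⟫_ℂ = 0) {x₀ t : ℝ}
    (d0 : ∀ s, |s| ≤ t → ⟪evalVec hq hpos x₀, F s⟫_ℂ = 0)
    (d1 : ∀ s, |s| ≤ t → ⟪slopeVec hq hpos x₀, F s⟫_ℂ = 0)
    (d2 : ∀ s, |s| ≤ t → ⟪evalVec hq hpos x₀, F₁ s⟫_ℂ = 0) :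
    ∀ x s, |x - x₀| + |s| ≤ t → ⟪evalVec hq hpos x, F s⟫_ℂ = 0 := by
  have cF : Continuous F := continuous_iff_continuousAt.2 fun s => (h1 s).continuousAt
  have cF₁ : Continuous F₁ := continuous_iff_continuousAt.2 fun s => (h2 s).continuousAt
  have ce := continuous_evalVec hq hpos
  have cd := continuous_slopeVec hq hpos
  -- The distance a from x₀ is the evolution variable, and s plays the role of space. The sign σ
  -- chooses the side of x₀.
  have key : ∀ σ : ℝ, σ * σ = 1 → ∀ a s, 0 ≤ a → a + |s| ≤ t →
      ⟪evalVec hq hpos (x₀ + σ * a), F s⟫_ℂ = 0 := by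
    intro σ hσ
    have hl : ∀ a, HasDerivAt (fun a : ℝ => x₀ + σ * a) σ a := fun a => by
      simpa using ((hasDerivAt_id a).const_mul σ).const_add x₀
    have cl : Continuous fun z : ℝ × ℝ => x₀ + σ * z.1 := by fun_prop
    have hσc : (σ : ℂ) * σ = 1 := by exact_mod_cast hσ
    have c1 : Continuous fun a : ℝ => (q |x₀ + σ * a| : ℂ) :=
      (continuous_ofReal_abs hq).comp (by fun_prop)
    obtain ⟨C, hC⟩ := (isCompact_Icc (a := (0 : ℝ)) (b := t)).exists_bound_of_continuousOn
      c1.continuousOn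
    have e1 : ∀ (f : HalfLine) a, HasDerivAt (fun a => ⟪evalVec hq hpos (x₀ + σ * a), f⟫_ℂ)
        ((σ : ℂ) * ⟪slopeVec hq hpos (x₀ + σ * a), f⟫_ℂ) a := fun f a => by
      have := (hasDerivAt_inner_evalVec hq hpos f (x₀ + σ * a)).scomp a (hl a)
      rwa [Complex.real_smul] at this
    have e2 : ∀ s a, HasDerivAt (fun a => (σ : ℂ) * ⟪slopeVec hq hpos (x₀ + σ * a), F s⟫_ℂ)
        ((q |x₀ + σ * a| : ℂ) * ⟪evalVec hq hpos (x₀ + σ * a), F s⟫_ℂ +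
          ⟪evalVec hq hpos (x₀ + σ * a), F₂ s⟫_ℂ) a := fun s a => by
      have h3 := oddExt_add_inner_evalVec hq hpos (J := univ) (fun _ _ _ => mem_univ _)
        ((hF s).mono fun x hx _ => hx)
      have h4 := hasDerivAt_inner_slopeVec hq hpos (a := x₀ + σ * a - 1) (b := x₀ + σ * a + 1)
        (h3.mono fun ξ hξ _ => hξ (mem_univ ξ)) (x := x₀ + σ * a)
        ⟨by linarith, by linarith⟩
      refine ((h4.scomp a (hl a)).const_mul (σ : ℂ)).congr_deriv ?_
      rw [Complex.real_smul, ← mul_assoc, hσc, one_mul]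
    have e3 : ∀ x s, HasDerivAt (fun s => ⟪x, F s⟫_ℂ) ⟪x, F₁ s⟫_ℂ s := fun x s => by
      simpa using (hasDerivAt_const s x).inner ℂ (h1 s)
    have e4 : ∀ x s, HasDerivAt (fun s => ⟪x, F₁ s⟫_ℂ) ⟪x, F₂ s⟫_ℂ s := fun x s => by
      simpa using (hasDerivAt_const s x).inner ℂ (h2 s)
    refine eq_zero_of_wave isOpen_univ (C := C) (T := t)
      (u := fun a s => ⟪evalVec hq hpos (x₀ + σ * a), F s⟫_ℂ)
      (u₁ := fun a s => (σ : ℂ) * ⟪slopeVec hq hpos (x₀ + σ * a), F s⟫_ℂ)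
      (u₂ := fun a s => ⟪evalVec hq hpos (x₀ + σ * a), F₁ s⟫_ℂ)
      (u₁₁ := fun a s => (q |x₀ + σ * a| : ℂ) * ⟪evalVec hq hpos (x₀ + σ * a), F s⟫_ℂ +
          ⟪evalVec hq hpos (x₀ + σ * a), F₂ s⟫_ℂ)
      (u₁₂ := fun a s => (σ : ℂ) * ⟪slopeVec hq hpos (x₀ + σ * a), F₁ s⟫_ℂ)
      (u₂₂ := fun a s => ⟪evalVec hq hpos (x₀ + σ * a), F₂ s⟫_ℂ)
      (fun _ _ _ _ => mem_univ _) (fun a s _ => e1 (F s) a) (fun a s _ => e2 s a)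
      (fun a s _ => (e3 _ s).const_mul _) (fun a s _ => e1 (F₁ s) a) (fun a s _ => e4 _ s)
      ?_ ?_ ?_ ?_ ?_ ?_ ?_ ?_
    · exact ((ce.comp cl).inner (cF.comp continuous_snd)).continuousOn
    · exact (((c1.comp continuous_fst).mul ((ce.comp cl).inner (cF.comp continuous_snd))).add
        ((ce.comp cl).inner (hc.comp continuous_snd))).continuousOn
    · exact (continuous_const.mul ((cd.comp cl).inner (cF₁.comp continuous_snd))).continuousOn
    · exact ((ce.comp cl).inner (hc.comp continuous_snd)).continuousOn
    · intro a s ha has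
      rw [add_sub_cancel_right, norm_mul]
      exact mul_le_mul_of_nonneg_right (hC a ⟨ha, by linarith [abs_nonneg s]⟩) (norm_nonneg _)
    · intro s hs
      simpa using d0 s hs
    · intro s hs
      simp [d1 s hs]
    · intro s hs
      simpa using d2 s hs
  intro x s hxs
  rcases le_total x₀ x with hx | hx
  · have := key 1 (one_mul 1) (x - x₀) s (by linarith) (by rwa [abs_of_nonneg (by linarith)] at hxs)
    simpa using this
  · have := key (-1) (by norm_num) (x₀ - x) s (by linarith)
      (by rwa [abs_of_nonpos (by linarith), neg_sub] at hxs)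
    simpa using this

/-- A solution of the wave equation in `(x₀ - t, x₀ + t)` with vanishing initial data vanishes in
the characteristic triangle. -/
theorem inner_evalVec_eq_zero_of_initialData {F F₁ F₂ : ℝ → HalfLine}
    (h1 : ∀ s, HasDerivAt F (F₁ s) s) (h2 : ∀ s, HasDerivAt F₁ (F₂ s) s) (hc : Continuous F₂)
    {x₀ t : ℝ} (hx₀ : 0 ≤ x₀) (hF : ∀ s, ∀ᵐ x ∂halfLineMeasure, x ∈ Ioo (x₀ - t) (x₀ + t) →
      F s x + ⟪evalVec hq hpos x, F₂ s⟫_ℂ = 0) (d0 : F 0 = 0) (d1 : F₁ 0 = 0) :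
    ∀ x s, 0 ≤ s → s + |x - x₀| < t → ⟪evalVec hq hpos x, F s⟫_ℂ = 0 := by
  have cF : Continuous F := continuous_iff_continuousAt.2 fun s => (h1 s).continuousAt
  have cF₁ : Continuous F₁ := continuous_iff_continuousAt.2 fun s => (h2 s).continuousAt
  have ce := continuous_evalVec hq hpos
  have cd := continuous_slopeVec hq hpos
  have hl : ∀ b, HasDerivAt (fun b : ℝ => x₀ + b) 1 b := fun b => (hasDerivAt_id b).const_add x₀
  have cl : Continuous fun z : ℝ × ℝ => x₀ + z.2 := by fun_prop
  have c1 : Continuous fun b : ℝ => (q |x₀ + b| : ℂ) :=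
    (continuous_ofReal_abs hq).comp (by fun_prop)
  obtain ⟨C, hC⟩ := (isCompact_Icc (a := -t) (b := t)).exists_bound_of_continuousOn
    c1.continuousOn
  have e1 : ∀ (f : HalfLine) b, HasDerivAt (fun b => ⟪evalVec hq hpos (x₀ + b), f⟫_ℂ)
      ⟪slopeVec hq hpos (x₀ + b), f⟫_ℂ b := fun f b => by
    have := (hasDerivAt_inner_evalVec hq hpos f (x₀ + b)).scomp b (hl b)
    rwa [one_smul] at this
  have e2 : ∀ s b, |b| < t → HasDerivAt (fun b => ⟪slopeVec hq hpos (x₀ + b), F s⟫_ℂ)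
      ((q |x₀ + b| : ℂ) * ⟪evalVec hq hpos (x₀ + b), F s⟫_ℂ +
        ⟪evalVec hq hpos (x₀ + b), F₂ s⟫_ℂ) b := fun s b hb => by
    -- Since x₀ ≥ 0, the reflection of a negative point of the interval stays in it.
    have h3 := oddExt_add_inner_evalVec hq hpos (J := Ioo (x₀ - t) (x₀ + t))
      (fun ξ hξ hξ0 => ⟨by linarith [hξ.1], by linarith [hξ.1]⟩) (hF s)
    have h4 := hasDerivAt_inner_slopeVec hq hpos h3 (x := x₀ + b)
      ⟨by linarith [(abs_lt.1 hb).1], by linarith [(abs_lt.1 hb).2]⟩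
    refine (h4.scomp b (hl b)).congr_deriv ?_
    rw [one_smul]
  have e3 : ∀ x s, HasDerivAt (fun s => ⟪x, F s⟫_ℂ) ⟪x, F₁ s⟫_ℂ s := fun x s => by
    simpa using (hasDerivAt_const s x).inner ℂ (h1 s)
  have e4 : ∀ x s, HasDerivAt (fun s => ⟪x, F₁ s⟫_ℂ) ⟪x, F₂ s⟫_ℂ s := fun x s => by
    simpa using (hasDerivAt_const s x).inner ℂ (h2 s)
  -- The equation is only known in the open strip |b| < t, so uniqueness is applied in closed
  -- triangles of height T < t.
  have key : ∀ T, T < t → ∀ s b, 0 ≤ s → s + |b| ≤ T → ⟪evalVec hq hpos (x₀ + b), F s⟫_ℂ = 0 := by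
    intro T hT
    have hΩ : IsOpen {z : ℝ × ℝ | |z.2| < t} := isOpen_lt continuous_snd.abs continuous_const
    refine eq_zero_of_wave hΩ (C := C) (T := T)
      (u := fun s b => ⟪evalVec hq hpos (x₀ + b), F s⟫_ℂ)
      (u₁ := fun s b => ⟪evalVec hq hpos (x₀ + b), F₁ s⟫_ℂ)
      (u₂ := fun s b => ⟪slopeVec hq hpos (x₀ + b), F s⟫_ℂ)
      (u₁₁ := fun s b => ⟪evalVec hq hpos (x₀ + b), F₂ s⟫_ℂ)
      (u₁₂ := fun s b => ⟪slopeVec hq hpos (x₀ + b), F₁ s⟫_ℂ)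
      (u₂₂ := fun s b => (q |x₀ + b| : ℂ) * ⟪evalVec hq hpos (x₀ + b), F s⟫_ℂ +
        ⟪evalVec hq hpos (x₀ + b), F₂ s⟫_ℂ)
      (fun s b hs hsb => show |b| < t by linarith) (fun s b _ => e3 _ s) (fun s b _ => e4 _ s)
      (fun s b _ => e1 _ b) (fun s b _ => e3 _ s) (fun s b hb => e2 s b hb)
      ?_ ?_ ?_ ?_ ?_ ?_ ?_ ?_
    · exact ((ce.comp cl).inner (cF.comp continuous_fst)).continuousOn
    · exact ((ce.comp cl).inner (hc.comp continuous_fst)).continuousOn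
    · exact ((cd.comp cl).inner (cF₁.comp continuous_fst)).continuousOn
    · exact (((c1.comp continuous_snd).mul ((ce.comp cl).inner (cF.comp continuous_fst))).add
        ((ce.comp cl).inner (hc.comp continuous_fst))).continuousOn
    · intro s b hs hsb
      rw [norm_sub_rev, add_sub_cancel_right, norm_mul]
      exact mul_le_mul_of_nonneg_right (hC b (abs_le.1 (by linarith))) (norm_nonneg _)
    · intro b _
      simp [d0]
    · intro b _
      simp [d1]
    · intro b _
      simp [d0]
  intro x s hs hxs
  have := key _ hxs s (x - x₀) hs le_rfl
  simpa using this

end WaveOnHalfLine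

/-! ### Projections and lattice operations for L₂(A). -/

section SpectralSubspaces

variable {A B : Set ℝ}

theorem mem_L2On {y : HalfLine} : y ∈ L2On A ↔ ∀ᵐ x ∂halfLineMeasure, x ∉ A → y x = 0 := Iff.rfl

theorem mem_L2On_compl {y : HalfLine} :
    y ∈ L2On Aᶜ ↔ ∀ᵐ x ∂halfLineMeasure, x ∈ A → y x = 0 := by
  simp only [mem_L2On, mem_compl_iff, not_not]

theorem L2On_congr (h : A =ᵐ[halfLineMeasure] B) : L2On A = L2On B := by
  refine SetLike.ext fun y => ?_
  rw [mem_L2On, mem_L2On]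
  refine eventually_congr ?_
  filter_upwards [h] with x hx
  have hx' : x ∈ A ↔ x ∈ B := iff_of_eq hx
  rw [hx']

theorem exists_measurableSet_L2On_eq (hA : NullMeasurableSet A volume) :
    ∃ B, MeasurableSet B ∧ B =ᵐ[volume] A ∧ L2On A = L2On B := by
  obtain ⟨B, -, hB, hAB⟩ := hA.exists_measurable_subset_ae_eq
  exact ⟨B, hB, hAB, L2On_congr (ae_restrict_of_ae hAB.symm)⟩

theorem L2On_empty : L2On ∅ = ⊥ := by
  refine SetLike.ext fun y => ?_
  rw [mem_L2On, ClosedSubmodule.mem_bot]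
  simp only [mem_empty_iff_false, not_false_eq_true, forall_true_left]
  exact (Lp.eq_zero_iff_ae_eq_zero).symm

theorem L2On_eq_top (h : Ioi 0 ⊆ A) : L2On A = ⊤ := by
  refine SetLike.ext fun y => ?_
  rw [mem_L2On]
  refine iff_of_true ?_ ClosedSubmodule.mem_top
  filter_upwards [ae_restrict_mem measurableSet_Ioi] with x hx hx'
  exact absurd (h hx) hx'

theorem L2On_inf (A B : Set ℝ) : L2On A ⊓ L2On B = L2On (A ∩ B) := by
  refine SetLike.ext fun y => ?_
  simp only [ClosedSubmodule.mem_inf, mem_L2On, ← eventually_and]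
  refine eventually_congr (Eventually.of_forall fun x => ?_)
  simp only [mem_inter_iff]
  tauto

theorem mem_L2On_compl_iUnion {ι : Type*} [Countable ι] {J : ι → Set ℝ} {y : HalfLine}
    (h : ∀ i, y ∈ L2On (J i)ᶜ) : y ∈ L2On (⋃ i, J i)ᶜ := by
  simp only [mem_L2On_compl] at h ⊢
  filter_upwards [ae_all_iff.2 h] with x hx hx'
  obtain ⟨i, hi⟩ := mem_iUnion.1 hx'
  exact hx i hi

theorem L2On_mono (h : A ⊆ B) : L2On A ≤ L2On B := fun y hy => by
  have hy' : ∀ᵐ x ∂halfLineMeasure, x ∉ A → y x = 0 := hy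
  filter_upwards [hy'] with x hx hx'
  exact hx fun hA => hx' (h hA)

/-- The product of `f` and the indicator function of `A`. -/
noncomputable def restrictTo (hA : MeasurableSet A) (f : HalfLine) : HalfLine :=
  ((Lp.memLp f).indicator hA).toLp _

theorem restrictTo_ae_eq (hA : MeasurableSet A) (f : HalfLine) :
    restrictTo hA f =ᵐ[halfLineMeasure] A.indicator f := MemLp.coeFn_toLp _

theorem restrictTo_mem (hA : MeasurableSet A) (f : HalfLine) : restrictTo hA f ∈ L2On A := by
  rw [mem_L2On]
  filter_upwards [restrictTo_ae_eq hA f] with x hx hx'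
  rw [hx, indicator_of_notMem hx']

theorem sub_restrictTo_mem (hA : MeasurableSet A) (f : HalfLine) :
    f - restrictTo hA f ∈ L2On Aᶜ := by
  rw [mem_L2On_compl]
  filter_upwards [restrictTo_ae_eq hA f, Lp.coeFn_sub f (restrictTo hA f)] with x hx hx2 hx'
  rw [hx2, Pi.sub_apply, hx, indicator_of_mem hx', sub_self]

theorem inner_eq_zero_of_mem_L2On {f g : HalfLine} (hf : f ∈ L2On A) (hg : g ∈ L2On Aᶜ) :
    ⟪f, g⟫_ℂ = 0 := by
  rw [mem_L2On_compl] at hg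
  rw [mem_L2On] at hf
  rw [L2.inner_def]
  refine integral_eq_zero_of_ae ?_
  filter_upwards [hf, hg] with x h1 h2
  by_cases hx : x ∈ A
  · simp [h2 hx]
  · simp [h1 hx]

theorem starProjection_L2On (hA : MeasurableSet A) (f : HalfLine) :
    (L2On A).toSubmodule.starProjection f = restrictTo hA f :=
  Submodule.eq_starProjection_of_mem_of_inner_eq_zero (restrictTo_mem hA f) fun w hw => by
    rw [← inner_conj_symm, inner_eq_zero_of_mem_L2On hw (sub_restrictTo_mem hA f), map_zero]

theorem L2On_orthogonal (hA : MeasurableSet A) : (L2On A)ᗮ = L2On Aᶜ := by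
  refine SetLike.ext fun f => ⟨fun hf => ?_, fun hf => ?_⟩
  · have h0 : (L2On A).toSubmodule.starProjection f = 0 :=
      (Submodule.starProjection_apply_eq_zero_iff _).2 hf
    have := sub_restrictTo_mem hA f
    rwa [← starProjection_L2On, h0, sub_zero] at this
  · exact fun v hv => inner_eq_zero_of_mem_L2On hv hf

theorem mem_L2On_compl_of_inner (hA : MeasurableSet A) {f : HalfLine}
    (h : ∀ v ∈ L2On A, ⟪v, f⟫_ℂ = 0) : f ∈ L2On Aᶜ := by
  rw [← L2On_orthogonal hA]
  exact h

end SpectralSubspaces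

theorem smul_pow_apply {E : Type*} [NormedAddCommGroup E] [NormedSpace ℂ E] (a : ℝ)
    (T : E →L[ℂ] E) (n : ℕ) (y : E) : ((a • T) ^ n) y = ((a : ℂ) ^ n) • (T ^ n) y := by
  induction n with
  | zero => simp
  | succ n ih =>
    rw [pow_succ', pow_succ' T, mul_apply_eq_comp, mul_apply_eq_comp, ih]
    have e : ∀ w, (a • T) w = (a : ℂ) • T w := fun _ => rfl
    rw [e, map_smul, smul_smul, ← pow_succ']

/-! ### Finite speed of propagation and unique continuation. -/

section Propagation

variable {q : ℝ → ℝ} (hq : ContinuousOn q (Ici 0)) (hpos : IsPositiveDefinite (slOperator q))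

theorem slInverse_isPositive (hq : ContinuousOn q (Ici 0))
    (hpos : IsPositiveDefinite (slOperator q)) : (slInverse hpos).IsPositive :=
  boundedInverse_isPositive (hA := hpos) (dense_slOperator_domain hq)

theorem denseRange_slInverse (hq : ContinuousOn q (Ici 0))
    (hpos : IsPositiveDefinite (slOperator q)) : DenseRange (slInverse hpos) := by
  refine (dense_slOperator_domain hq).mono ?_
  intro y hy
  exact ⟨slOperator q ⟨y, hy⟩,
    boundedInverse_map (hA := hpos) (dense_slOperator_domain hq) ⟨y, hy⟩⟩

/-- The operator `L^{-1/2} sin (s L^{1/2})` for the Sturm-Liouville operator. -/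
noncomputable abbrev slSine (hpos : IsPositiveDefinite (slOperator q)) (s : ℝ) :
    HalfLine →L[ℂ] HalfLine :=
  sineFun (slInverse hpos) s

/-- The difference sy − S(s)y is the second time derivative of a wave with zero initial data whose
source is a multiple of y and so vanishes on the interval. That wave vanishes in the triangle, and
two differentiations in s give the claim. -/
theorem inner_evalVec_smul_sub_slSine {y : HalfLine} {x₀ t : ℝ} (hx₀ : 0 ≤ x₀)
    (hy : y ∈ L2On (Ioo (x₀ - t) (x₀ + t))ᶜ) {x s : ℝ} (hs : 0 < s) (hxs : s + |x - x₀| < t) :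
    ⟪evalVec hq hpos x, s • y - slSine hpos s y⟫_ℂ = 0 := by
  have hR := slInverse_isPositive hq hpos
  set R := slInverse hpos
  -- The cubic term makes F'' = sy − S(s)y, and the linear term cancels the initial velocity Ry.
  -- Then F + RF'' = (s³/6)y.
  set F : ℝ → HalfLine := fun s => (s ^ 3 / 6) • y - s • R y + (R * sineFun R s) y
  set F₁ : ℝ → HalfLine := fun s => (s ^ 2 / 2) • y - R y + cosFun R s y
  set F₂ : ℝ → HalfLine := fun s => s • y - sineFun R s y
  have h1 : ∀ s, HasDerivAt F (F₁ s) s := fun s => by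
    have a1 := (((hasDerivAt_pow 3 s).div_const 6).smul_const y).sub
      ((hasDerivAt_id s).smul_const (R y))
    refine (a1.add (hasDerivAt_apply (hasDerivAt_mul_sineFun hR s) y)).congr_deriv ?_
    simp only [F₁, one_smul]
    congr 3
    norm_num
    ring
  have h2 : ∀ s, HasDerivAt F₁ (F₂ s) s := fun s => by
    have a1 := (((hasDerivAt_pow 2 s).div_const 2).smul_const y).sub_const (R y)
    refine (a1.add (hasDerivAt_apply (hasDerivAt_cosFun (R := R) s) y)).congr_deriv ?_
    simp only [F₂, sub_eq_add_neg]
    congr 2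
    norm_num
  have hc : Continuous F₂ := (continuous_id.smul continuous_const).sub
    (continuous_sineFun.clm_apply continuous_const)
  have hF : ∀ s, ∀ᵐ x ∂halfLineMeasure, x ∈ Ioo (x₀ - t) (x₀ + t) →
      F s x + ⟪evalVec hq hpos x, F₂ s⟫_ℂ = 0 := by
    intro s
    have e : F s + R (F₂ s) = (s ^ 3 / 6) • y := by
      simp only [F, F₂, map_sub, mul_apply_eq_comp]
      rw [show R (s • y) = s • R y from (R.restrictScalars ℝ).map_smul s y]
      abel
    filter_upwards [slInverse_ae_eq hq hpos (F₂ s), mem_L2On_compl.1 hy,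
      Lp.coeFn_add (F s) (R (F₂ s)), Lp.coeFn_smul (s ^ 3 / 6) y] with x e1 e2 e3 e4 hx
    rw [← e1]
    rw [e, e4, Pi.smul_apply, e2 hx, smul_zero] at e3
    exact e3.symm
  have d0 : F 0 = 0 := by
    simp only [F, sineFun_zero, mul_zero]
    simp
  have d1 : F₁ 0 = 0 := by
    simp only [F₁, cosFun_zero hR]
    simp
  have main := inner_evalVec_eq_zero_of_initialData hq hpos h1 h2 hc hx₀ hF d0 d1 x
  have e3 : ∀ s, HasDerivAt (fun s => ⟪evalVec hq hpos x, F s⟫_ℂ)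
      ⟪evalVec hq hpos x, F₁ s⟫_ℂ s := fun s => by
    simpa using (hasDerivAt_const s (evalVec hq hpos x)).inner ℂ (h1 s)
  have e4 : ∀ s, HasDerivAt (fun s => ⟪evalVec hq hpos x, F₁ s⟫_ℂ)
      ⟪evalVec hq hpos x, F₂ s⟫_ℂ s := fun s => by
    simpa using (hasDerivAt_const s (evalVec hq hpos x)).inner ℂ (h2 s)
  have z1 : ∀ s ∈ Ioo 0 (t - |x - x₀|), ⟪evalVec hq hpos x, F₁ s⟫_ℂ = 0 := by
    intro s hs
    refine (e3 s).unique ((hasDerivAt_const s (0 : ℂ)).congr_of_eventuallyEq ?_)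
    filter_upwards [Ioo_mem_nhds hs.1 hs.2] with r hr
    exact main r hr.1.le (by linarith [hr.2])
  refine (e4 s).unique ((hasDerivAt_const s (0 : ℂ)).congr_of_eventuallyEq ?_)
  filter_upwards [Ioo_mem_nhds hs (by linarith : s < t - |x - x₀|)] with r hr using z1 r hr

/-- Finite speed of propagation. -/
theorem slSine_mem_L2On (hq : ContinuousOn q (Ici 0))
    (hpos : IsPositiveDefinite (slOperator q)) {y : HalfLine} {x₀ r t : ℝ} (hx₀ : 0 ≤ x₀)
    (hy : y ∈ L2On (Ioo (x₀ - t) (x₀ + t))ᶜ) {s : ℝ} (hs : 0 ≤ s) (hrs : r + s ≤ t) :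
    slSine hpos s y ∈ L2On (Ioo (x₀ - r) (x₀ + r))ᶜ := by
  rcases hs.eq_or_lt with rfl | hs
  · rw [slSine, sineFun_zero]
    exact zero_mem _
  have h := ae_eq_zero_of_inner_evalVec_eq_zero hq hpos (f := s • y - slSine hpos s y)
    -- Locality is stated on intervals inside the half-line, hence the maximum. It yields S(s)y = sy
    -- there, and y itself is zero on this smaller interval.
    (a := max (x₀ - r) 0) (b := x₀ + r) (le_max_right _ _) fun x hx => by
      refine inner_evalVec_smul_sub_slSine hq hpos hx₀ hy hs ?_
      have h1 := (le_max_left (x₀ - r) 0).trans_lt hx.1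
      have h2 := hx.2
      have : |x - x₀| < r := abs_lt.2 ⟨by linarith, by linarith⟩
      linarith
  rw [mem_L2On_compl] at hy ⊢
  filter_upwards [h, hy, ae_restrict_mem measurableSet_Ioi, Lp.coeFn_sub (s • y) (slSine hpos s y),
    Lp.coeFn_smul s y] with x h1 h2 h3 h4 h5 hx
  have hx' : x ∈ Ioo (x₀ - t) (x₀ + t) := ⟨by linarith [hx.1], by linarith [hx.2]⟩
  have e := h1 ⟨max_lt hx.1 h3, hx.2⟩
  rw [h4, Pi.sub_apply, h5, Pi.smul_apply, h2 hx', smul_zero, zero_sub, neg_eq_zero] at e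
  exact e

/-- The pairing is the derivative at 0 of L⁻¹(sy − S(s)y), which vanishes near 0 as long as 0 < s <
t. The endpoints follow by continuity in s. -/
theorem inner_deficiencyVec_slSine {y : HalfLine} {t : ℝ} (hy : y ∈ L2On (Ioo 0 t)ᶜ) {s : ℝ}
    (hs : 0 ≤ s) (hst : s ≤ t) :
    ⟪deficiencyVec hq hpos, s • y - slSine hpos s y⟫_ℂ = 0 := by
  have hy' : y ∈ L2On (Ioo (0 - t) (0 + t))ᶜ := by
    rw [mem_L2On_compl] at hy ⊢
    filter_upwards [hy, ae_restrict_mem measurableSet_Ioi] with x h1 h2 hx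
    exact h1 ⟨h2, by linarith [hx.2]⟩
  have key : ∀ s ∈ Ioo 0 t, ⟪deficiencyVec hq hpos, s • y - slSine hpos s y⟫_ℂ = 0 := by
    intro s hs
    rw [← slopeVec_zero]
    refine (hasDerivAt_inner_evalVec hq hpos _ 0).unique
      ((hasDerivAt_const (0 : ℝ) (0 : ℂ)).congr_of_eventuallyEq ?_)
    filter_upwards [Metric.ball_mem_nhds (0 : ℝ) (by linarith [hs.2] : 0 < t - s)] with x hx
    refine inner_evalVec_smul_sub_slSine hq hpos le_rfl hy' hs.1 ?_
    rw [Metric.mem_ball, Real.dist_eq] at hx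
    linarith
  rcases hs.eq_or_lt with rfl | hs0
  · simp [slSine, sineFun_zero]
  have hc : Continuous fun s : ℝ => ⟪deficiencyVec hq hpos, s • y - slSine hpos s y⟫_ℂ :=
    continuous_const.inner ((continuous_id.smul continuous_const).sub
      (continuous_sineFun.clm_apply continuous_const))
  have h2 : EqOn (fun s : ℝ => ⟪deficiencyVec hq hpos, s • y - slSine hpos s y⟫_ℂ) (fun _ => 0)
      (Ioo 0 t) := key
  have h3 := h2.closure hc continuous_const
  rw [closure_Ioo (hs0.trans_le hst).ne] at h3
  exact h3 ⟨hs, hst⟩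

/-- The wave s ↦ RS(s)z has zero Cauchy data on the time-like segment over x₀, hence vanishes in the
characteristic square. Its time derivative at s = 0 is Rz. -/
theorem inner_evalVec_slInverse_eq_zero {z : HalfLine} {x₀ t : ℝ}
    (d0 : ∀ s, |s| < t → ⟪evalVec hq hpos x₀, slInverse hpos (slSine hpos s z)⟫_ℂ = 0)
    (d1 : ∀ s, |s| < t → ⟪slopeVec hq hpos x₀, slInverse hpos (slSine hpos s z)⟫_ℂ = 0)
    {x : ℝ} (hx : |x - x₀| < t) : ⟪evalVec hq hpos x, slInverse hpos z⟫_ℂ = 0 := by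
  have hR := slInverse_isPositive hq hpos
  set R := slInverse hpos
  have h1 : ∀ s, HasDerivAt (fun s => (R * sineFun R s) z) (cosFun R s z) s := fun s =>
    hasDerivAt_apply (hasDerivAt_mul_sineFun hR s) z
  have h2 : ∀ s, HasDerivAt (fun s => cosFun R s z) (-sineFun R s z) s := fun s =>
    hasDerivAt_apply (hasDerivAt_cosFun (R := R) s) z
  have e3 : ∀ x s, HasDerivAt (fun s => ⟪evalVec hq hpos x, (R * sineFun R s) z⟫_ℂ)
      ⟪evalVec hq hpos x, cosFun R s z⟫_ℂ s := fun x s => by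
    simpa using (hasDerivAt_const s (evalVec hq hpos x)).inner ℂ (h1 s)
  obtain ⟨t', ht1, ht2⟩ := exists_between hx
  have main := inner_evalVec_eq_zero_of_cauchyData hq hpos h1 h2
    (continuous_sineFun.clm_apply continuous_const).neg (fun s => by
      filter_upwards [slInverse_ae_eq hq hpos (sineFun R s z)] with x hx
      rw [inner_neg_right, ← hx]
      exact add_neg_cancel _) (x₀ := x₀) (t := t')
      (fun s hs => d0 s (hs.trans_lt ht2)) (fun s hs => d1 s (hs.trans_lt ht2)) (fun s hs => by
        refine (e3 x₀ s).unique ((hasDerivAt_const s (0 : ℂ)).congr_of_eventuallyEq ?_)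
        filter_upwards [(isOpen_lt continuous_abs continuous_const).mem_nhds
          (show |s| < t from hs.trans_lt ht2)] with r hr using d0 r hr)
  have := (e3 x 0).unique ((hasDerivAt_const (0 : ℝ) (0 : ℂ)).congr_of_eventuallyEq (by
    filter_upwards [Metric.ball_mem_nhds (0 : ℝ) (by linarith : 0 < t' - |x - x₀|)] with s hs
    rw [Metric.mem_ball, Real.dist_eq, sub_zero] at hs
    exact main x s (by linarith)))
  rwa [cosFun_zero hR] at this

/-- Every neighbourhood of a support point meets `A` in positive measure, so zeros of g accumulate
at x₀. A nonzero value or a nonzero derivative would exclude zeros from a punctured neighbourhood.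
This supplies full Cauchy data from an arbitrary measurable set. -/
theorem eq_zero_of_mem_support {g : ℝ → ℂ} {g' : ℂ} {x₀ : ℝ} (hg : HasDerivAt g g' x₀)
    {A : Set ℝ} (hA : MeasurableSet A) (h0 : ∀ᵐ x ∂halfLineMeasure, x ∈ A → g x = 0)
    (hx₀ : x₀ ∈ (halfLineMeasure.restrict A).support) : g x₀ = 0 ∧ g' = 0 := by
  have key : ∃ᶠ x in 𝓝[≠] x₀, g x = 0 := by
    intro hne
    rw [eventually_nhdsWithin_iff] at hne
    have hpos := (Measure.mem_support_iff_forall x₀).1 hx₀ _ hne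
    refine hpos.ne' ?_
    rw [← ae_restrict_iff' hA] at h0
    have hx : ∀ᵐ x ∂(halfLineMeasure.restrict A), x ≠ x₀ := Measure.ae_ne _ x₀
    refine measure_mono_null ?_ (h0.and hx)
    intro x hx hx'
    exact hx hx'.2 hx'.1
  constructor
  · by_contra hne
    exact key ((hg.continuousAt.eventually_ne hne).filter_mono nhdsWithin_le_nhds)
  · by_contra hne
    exact key (hg.eventually_ne hne)

/-- Removes the regularization: (S(ε)/ε)⁶y → y as ε → 0, and the functions vanishing on a fixed set
form a closed subspace. The smaller intervals exhaust the full one. -/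
theorem mem_L2On_compl_of_sineFun_pow (hq : ContinuousOn q (Ici 0))
    (hpos : IsPositiveDefinite (slOperator q)) {y : HalfLine} {x₀ t : ℝ}
    (h : ∀ ε : ℝ, 0 < ε → (sineFun (slInverse hpos) ε ^ 6) y ∈
      L2On (Ioo (x₀ - (t - 6 * ε)) (x₀ + (t - 6 * ε)))ᶜ) : y ∈ L2On (Ioo (x₀ - t) (x₀ + t))ᶜ := by
  have key : ∀ n : ℕ, y ∈ L2On (Ioo (x₀ - (t - 1 / (n + 1))) (x₀ + (t - 1 / (n + 1))))ᶜ := by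
    intro n
    have hn : (0 : ℝ) < 1 / (n + 1) := by positivity
    have hlim := (tendsto_sineFun_div_pow (slInverse_isPositive hq hpos)
      (denseRange_slInverse hq hpos) y 6).mono_left
      (nhdsWithin_mono (0 : ℝ) (fun x (hx : 0 < x) => hx.ne' : Ioi (0 : ℝ) ⊆ {0}ᶜ))
    have hne : (𝓝[>] (0 : ℝ)).NeBot := inferInstance
    refine (L2On _).isClosed.mem_of_tendsto (b := 𝓝[>] (0 : ℝ)) hlim ?_
    filter_upwards [Ioo_mem_nhdsGT (by positivity : (0 : ℝ) < 1 / (n + 1) / 6)] with ε hε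
    rw [smul_pow_apply]
    have h1 : (sineFun (slInverse hpos) ε ^ 6) y ∈
        L2On (Ioo (x₀ - (t - 1 / (n + 1))) (x₀ + (t - 1 / (n + 1))))ᶜ := by
      refine L2On_mono (compl_subset_compl.2 (Ioo_subset_Ioo ?_ ?_)) (h ε hε.1)
      · linarith [hε.2]
      · linarith [hε.2]
    exact (L2On _).smul_mem _ h1
  have := mem_L2On_compl_iUnion key
  refine L2On_mono (compl_subset_compl.2 ?_) this
  intro x hx
  obtain ⟨n, hn⟩ := exists_nat_one_div_lt (show 0 < t - |x - x₀| by
    have : |x - x₀| < t := abs_lt.2 ⟨by linarith [hx.1], by linarith [hx.2]⟩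
    linarith)
  refine mem_iUnion.2 ⟨n, ?_⟩
  have h2 := abs_lt.1 (show |x - x₀| < t - 1 / (n + 1) by linarith)
  exact ⟨by linarith [h2.1], by linarith [h2.2]⟩

/-- The regularized vector is R²z, and S(s) commutes with R². One factor R gives pointwise values,
and the other is the one in the wave RS(s)z. -/
theorem exists_sineFun_pow_apply (hq : ContinuousOn q (Ici 0))
    (hpos : IsPositiveDefinite (slOperator q)) (y : HalfLine) (ε : ℝ) :
    ∃ z, (sineFun (slInverse hpos) ε ^ 6) y =
    slInverse hpos (slInverse hpos z) ∧ ∀ s, slSine hpos s ((sineFun (slInverse hpos) ε ^ 6) y) =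
      slInverse hpos (slInverse hpos (slSine hpos s z)) := by
  have hR := slInverse_isPositive hq hpos
  obtain ⟨Q, hQ⟩ := exists_sineFun_pow_eq hR ε
  refine ⟨Q y, by rw [hQ]; rfl, fun s => ?_⟩
  have hcomm : sineFun (slInverse hpos) s * (slInverse hpos * slInverse hpos) =
      slInverse hpos * slInverse hpos * sineFun (slInverse hpos) s :=
    ((commute_sineFun hR s).mul_left (commute_sineFun hR s)).eq.symm
  rw [hQ]
  exact congrArg (fun T : HalfLine →L[ℂ] HalfLine => T (Q y)) hcomm

theorem mem_L2On_of_inner_evalVec {z : HalfLine} {x₀ t : ℝ}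
    (h : ∀ x, |x - x₀| < t → ⟪evalVec hq hpos x, slInverse hpos z⟫_ℂ = 0) :
    slInverse hpos (slInverse hpos z) ∈ L2On (Ioo (x₀ - t) (x₀ + t))ᶜ := by
  rw [mem_L2On_compl]
  filter_upwards [slInverse_ae_eq hq hpos (slInverse hpos z)] with x hx hx'
  rw [hx]
  exact h x (abs_lt.2 ⟨by linarith [hx'.1], by linarith [hx'.2]⟩)

theorem abs_forall_of_nonneg {v y : HalfLine} {c : ℂ} {t : ℝ}
    (h : ∀ s, 0 ≤ s → s ≤ t → ⟪v, slSine hpos s y⟫_ℂ = s * c) :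
    ∀ s, |s| ≤ t → ⟪v, slSine hpos s y⟫_ℂ = s * c := by
  intro s hs
  rcases le_total 0 s with h0 | h0
  · exact h s h0 (by rwa [abs_of_nonneg h0] at hs)
  · have := h (-s) (by linarith) (by rwa [abs_of_nonpos h0] at hs)
    rw [slSine, sineFun_neg, neg_apply, inner_neg_right] at this
    push_cast at this
    linear_combination -this

/-- Unique continuation from a set that is observed during the time interval `[0, t]`. -/
theorem mem_L2On_compl_of_mem_support (hq : ContinuousOn q (Ici 0))
    (hpos : IsPositiveDefinite (slOperator q)) {A : Set ℝ} (hA : MeasurableSet A) {x₀ t : ℝ}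
    (hx₀ : x₀ ∈ (halfLineMeasure.restrict A).support) {y : HalfLine}
    (h : ∀ v ∈ L2On A, ∀ s, 0 ≤ s → s ≤ t → ⟪v, slSine hpos s y⟫_ℂ = 0) :
    y ∈ L2On (Ioo (x₀ - t) (x₀ + t))ᶜ := by
  refine mem_L2On_compl_of_sineFun_pow hq hpos fun ε hε => ?_
  obtain ⟨z, hz, hz'⟩ := exists_sineFun_pow_apply hq hpos y ε
  rw [hz]
  -- Each of the six smoothing factors shortens the observation window by ε. In the remaining window
  -- R²S(s)z vanishes on `A`, which is the c = 0 case of the linear observation.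
  have h0 : ∀ s, |s| < t - 6 * ε → ∀ᵐ x ∂halfLineMeasure, x ∈ A →
      ⟪evalVec hq hpos x, slInverse hpos (slSine hpos s z)⟫_ℂ = 0 := by
    intro s hs
    have hmem := mem_L2On_compl_of_inner hA
      (f := slSine hpos s ((sineFun (slInverse hpos) ε ^ 6) y)) fun v hv => by
        have h1 := abs_forall_of_nonneg hpos (v := v) (y := y) (c := 0) (t := t) fun s h0 h1 => by
          rw [h v hv s h0 h1, mul_zero]
        have := inner_sineFun_pow h1 hε.le 6 s (by push_cast; linarith)
        simpa using this
    rw [hz', mem_L2On_compl] at hmem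
    filter_upwards [hmem, slInverse_ae_eq hq hpos (slInverse hpos (slSine hpos s z))]
      with x h1 h2 hx
    rw [← h2, h1 hx]
  refine mem_L2On_of_inner_evalVec hq hpos fun x hx => ?_
  exact inner_evalVec_slInverse_eq_zero hq hpos
    (fun s hs => (eq_zero_of_mem_support (hasDerivAt_inner_evalVec hq hpos _ x₀) hA (h0 s hs)
      hx₀).1) (fun s hs => (eq_zero_of_mem_support (hasDerivAt_inner_evalVec hq hpos _ x₀) hA
      (h0 s hs) hx₀).2) hx

/-- Unique continuation from the boundary. -/
theorem mem_L2On_compl_of_inner_deficiencyVec {y : HalfLine} {c : ℂ} {t : ℝ}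
    (h : ∀ s, 0 ≤ s → s ≤ t → ⟪deficiencyVec hq hpos, slSine hpos s y⟫_ℂ = s * c) :
    y ∈ L2On (Ioo 0 t)ᶜ := by
  have hR := slInverse_isPositive hq hpos
  suffices hmem : y ∈ L2On (Ioo (0 - t) (0 + t))ᶜ by
    refine L2On_mono (compl_subset_compl.2 fun x hx => ?_) hmem
    exact ⟨by linarith [hx.1, hx.2], by linarith [hx.2]⟩
  refine mem_L2On_compl_of_sineFun_pow hq hpos fun ε hε => ?_
  obtain ⟨z, hz, hz'⟩ := exists_sineFun_pow_apply hq hpos y ε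
  rw [hz]
  set R := slInverse hpos
  set k := deficiencyVec hq hpos
  -- The observation of the regularized wave is linear in s. Two differentiations in s remove the
  -- unknown slope and leave ⟨k, RS(s)z⟩ = 0, the derivative at x = 0. The value at 0 vanishes
  -- because `evalVec` does.
  have h1 : ∀ s : ℝ, |s| < t - 6 * ε →
      ⟪k, (R * sineFun R s) (R z)⟫_ℂ = s * (ε ^ 6 * c) := by
    intro s hs
    have := inner_sineFun_pow (abs_forall_of_nonneg hpos h) hε.le 6 s (by push_cast; linarith)
    rw [← this]
    have e : (R * sineFun R s) (R z) = R (R (sineFun R s z)) :=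
      congrArg (fun T : HalfLine →L[ℂ] HalfLine => R (T z)) (commute_sineFun hR s).eq.symm
    rw [e]
    exact congrArg (fun w => ⟪k, w⟫_ℂ) (hz' s).symm
  have a1 : ∀ s, HasDerivAt (fun s => ⟪k, (R * sineFun R s) (R z)⟫_ℂ) ⟪k, cosFun R s (R z)⟫_ℂ s :=
    fun s => by
      simpa using (hasDerivAt_const s k).inner ℂ
        (hasDerivAt_apply (hasDerivAt_mul_sineFun hR s) (R z))
  have a2 : ∀ s, HasDerivAt (fun s => ⟪k, cosFun R s (R z)⟫_ℂ) ⟪k, (-sineFun R s) (R z)⟫_ℂ s :=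
    fun s => by
      simpa using (hasDerivAt_const s k).inner ℂ
        (hasDerivAt_apply (hasDerivAt_cosFun (R := R) s) (R z))
  have hnhds : ∀ s, |s| < t - 6 * ε → {r : ℝ | |r| < t - 6 * ε} ∈ 𝓝 s := fun s hs =>
    (isOpen_lt continuous_abs continuous_const).mem_nhds hs
  have h2 : ∀ s : ℝ, |s| < t - 6 * ε → ⟪k, cosFun R s (R z)⟫_ℂ = ε ^ 6 * c := by
    intro s hs
    have hd : HasDerivAt (fun s : ℝ => (s : ℂ) * (ε ^ 6 * c)) (1 * (ε ^ 6 * c)) s :=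
      (Complex.ofRealCLM.hasDerivAt (x := s)).mul_const _
    rw [one_mul] at hd
    refine (a1 s).unique (hd.congr_of_eventuallyEq ?_)
    filter_upwards [hnhds s hs] with r hr using h1 r hr
  have h3 : ∀ s : ℝ, |s| < t - 6 * ε → ⟪k, R (sineFun R s z)⟫_ℂ = 0 := by
    intro s hs
    have := (a2 s).unique ((hasDerivAt_const s (ε ^ 6 * c : ℂ)).congr_of_eventuallyEq (by
      filter_upwards [hnhds s hs] with r hr using h2 r hr))
    rw [neg_apply, inner_neg_right, neg_eq_zero] at this
    have e : R (sineFun R s z) = sineFun R s (R z) :=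
      congrArg (fun T : HalfLine →L[ℂ] HalfLine => T z) (commute_sineFun hR s).eq
    rw [e, this]
  refine mem_L2On_of_inner_evalVec hq hpos fun x hx => ?_
  refine inner_evalVec_slInverse_eq_zero hq hpos (x₀ := 0) (fun s hs => ?_) (fun s hs => ?_) hx
  · rw [evalVec_zero, inner_zero_left]
  · rw [slopeVec_zero]
    exact h3 s hs

end Propagation

/-! ### Closed spans through their orthogonal complements. -/

section ClosedSpan

variable {E : Type*} [NormedAddCommGroup E] [InnerProductSpace ℂ E]

theorem mem_orthogonal_closure_span {s : Set E} {y : E} :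
    y ∈ ((Submodule.span ℂ s).closure)ᗮ ↔ ∀ x ∈ s, ⟪x, y⟫_ℂ = 0 := by
  rw [ClosedSubmodule.orthogonal_closure']
  change y ∈ (Submodule.span ℂ s)ᗮ ↔ _
  refine ⟨fun h x hx => h x (Submodule.subset_span hx), fun h x hx => ?_⟩
  induction hx using Submodule.span_induction with
  | mem x hx => exact h x hx
  | zero => exact inner_zero_left _
  | add a b _ _ ha hb => rw [inner_add_left, ha, hb, add_zero]
  | smul c a _ ha => rw [inner_smul_left, ha, mul_zero]

/-- A closed subspace is its own double complement, so equality may be tested on complements. This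
is the duality behind both subspace computations. -/
theorem closure_span_eq_of_orthogonal [CompleteSpace E] {s : Set E} {A : ClosedSubmodule ℂ E}
    (h : ∀ y, (∀ x ∈ s, ⟪x, y⟫_ℂ = 0) ↔ y ∈ Aᗮ) : (Submodule.span ℂ s).closure = A := by
  have h1 : ((Submodule.span ℂ s).closure)ᗮ = Aᗮ :=
    SetLike.ext fun y => mem_orthogonal_closure_span.trans (h y)
  rw [← ClosedSubmodule.orthogonal_orthogonal_eq (Submodule.span ℂ s).closure, h1,
    ClosedSubmodule.orthogonal_orthogonal_eq]

end ClosedSpan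

/-! ### The isotony enlarges essential supports by t. -/

section Isotony

variable {q : ℝ → ℝ}

/-- The union may be uncountable; openness replaces countability, since a set that is null near each
of its points is null. -/
theorem mem_L2On_compl_iUnion_of_isOpen {ι : Type*} {J : ι → Set ℝ} (hJ : ∀ i, IsOpen (J i))
    {y : HalfLine} (h : ∀ i, y ∈ L2On (J i)ᶜ) : y ∈ L2On (⋃ i, J i)ᶜ := by
  simp only [mem_L2On_compl] at h ⊢
  have key : halfLineMeasure {x | x ∈ ⋃ i, J i ∧ y x ≠ 0} = 0 := by
    refine measure_null_of_locally_null _ fun x hx => ?_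
    obtain ⟨i, hi⟩ := mem_iUnion.1 hx.1
    refine ⟨{x | x ∈ J i ∧ y x ≠ 0}, ?_, ?_⟩
    · filter_upwards [mem_nhdsWithin_of_mem_nhds ((hJ i).mem_nhds hi), self_mem_nhdsWithin]
        with z hz hz' using ⟨hz, hz'.2⟩
    · have := h i
      rw [ae_iff] at this
      refine measure_mono_null (fun z hz => ?_) this
      exact fun hz' => hz.2 (hz' hz.1)
  rw [ae_iff]
  refine measure_mono_null (fun x hx => ?_) key
  simp only [mem_ofPred_eq, Classical.not_imp] at hx
  exact hx

/-- The set of points at distance less than `t` from the essential support of `A`. -/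
def waveNeighborhood (A : Set ℝ) (t : ℝ) : Set ℝ :=
  ⋃ x : (halfLineMeasure.restrict A).support, Ioo (x - t) (x + t)

theorem isOpen_waveNeighborhood (A : Set ℝ) (t : ℝ) : IsOpen (waveNeighborhood A t) :=
  isOpen_iUnion fun _ => isOpen_Ioo

theorem nonneg_of_mem_support {A : Set ℝ} {x : ℝ} (hx : x ∈ (halfLineMeasure.restrict A).support) :
    0 ≤ x := by
  by_contra hneg
  have h0 : halfLineMeasure (Iio 0) = 0 := by
    rw [Measure.restrict_apply measurableSet_Iio, Iio_inter_Ioi, Ioo_self, measure_empty]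
  refine ((Measure.mem_support_iff_forall x).1 hx (Iio 0) (Iio_mem_nhds (not_le.1 hneg))).ne' ?_
  exact nonpos_iff_eq_zero.1 ((Measure.le_iff'.1 Measure.restrict_le_self _).trans h0.le)

theorem ae_mem_support (A : Set ℝ) (hA : MeasurableSet A) :
    ∀ᵐ x ∂halfLineMeasure, x ∈ A → x ∈ (halfLineMeasure.restrict A).support := by
  rw [← ae_restrict_iff' hA]
  exact Measure.support_mem_ae

theorem eq_zero_of_integral_norm_sq_eq_zero {c : ℝ → ℂ} (hc : Continuous c) {t : ℝ} (ht : 0 < t)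
    (h : ∫ s in (0 : ℝ)..t, (star (c s) * c s) = 0) : ∀ s ∈ Icc 0 t, c s = 0 := by
  have e : ∀ s, star (c s) * c s = ((‖c s‖ ^ 2 : ℝ) : ℂ) := fun s => by
    rw [mul_comm, ← starRingEnd_apply, Complex.mul_conj, Complex.normSq_eq_norm_sq]
  simp only [e] at h
  rw [intervalIntegral.integral_ofReal, Complex.ofReal_eq_zero] at h
  intro s hs
  by_contra hne
  refine (intervalIntegral.integral_pos ht (hc.norm.pow 2).continuousOn
    (fun x _ => sq_nonneg _) ⟨s, hs, ?_⟩).ne' h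
  exact pow_pos (norm_pos_iff.2 hne) 2

/-- The wave isotony maps `L₂(A)` to the space of functions supported in the `t`-neighbourhood
of `A`. -/
theorem waveIsotony_L2On (hq : ContinuousOn q (Ici 0)) (hpos : IsPositiveDefinite (slOperator q))
    {A : Set ℝ} (hA : MeasurableSet A) {t : ℝ} (ht : 0 < t) :
    waveIsotony (slOperator q) hpos t (L2On A) = L2On (waveNeighborhood A t) := by
  rw [waveIsotony, if_neg ht.ne']
  refine closure_span_eq_of_orthogonal fun y => ?_
  rw [L2On_orthogonal (isOpen_waveNeighborhood A t).measurableSet]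
  constructor
  · intro h
    refine mem_L2On_compl_iUnion_of_isOpen (fun _ => isOpen_Ioo) fun x₀ => ?_
    refine mem_L2On_compl_of_mem_support hq hpos hA x₀.2 fun v hv s hs0 hst => ?_
    -- Using the observation itself as the amplitude of the source makes its pairing with y equal to
    -- the integral of |c|².
    set c : ℝ → ℂ := fun s => ⟪v, slSine hpos (t - s) y⟫_ℂ
    have hcS : Continuous fun s => slSine hpos (t - s) y :=
      (continuous_sineFun.comp (continuous_const.sub continuous_id)).clm_apply continuous_const
    have hc : Continuous c := continuous_const.inner hcS
    have hg : Continuous fun s => c s • v := hc.smul continuous_const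
    have hstate := h (sourceWave (slOperator q) hpos (fun s => c s • v) t)
      ⟨fun s => c s • v, fun T _ => by
        obtain ⟨C, hC⟩ := isCompact_Icc.exists_bound_of_continuousOn
          (hg.continuousOn (s := Icc 0 T))
        refine MemLp.of_bound hg.aestronglyMeasurable C ?_
        filter_upwards [ae_restrict_mem measurableSet_Ioc] with s hs using hC s ⟨hs.1.le, hs.2⟩,
        fun s _ => (L2On A).smul_mem _ hv, rfl⟩
    have hcont : Continuous fun s => slSine hpos (t - s) (c s • v) :=
      (continuous_sineFun.comp (continuous_const.sub continuous_id)).clm_apply hg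
    have e : ⟪y, sourceWave (slOperator q) hpos (fun s => c s • v) t⟫_ℂ =
        ∫ s in (0 : ℝ)..t, star (c s) * c s := by
      have e1 : sourceWave (slOperator q) hpos (fun s => c s • v) t =
          ∫ s in (0 : ℝ)..t, slSine hpos (t - s) (c s • v) := rfl
      rw [e1, intervalIntegral.integral_of_le ht.le, intervalIntegral.integral_of_le ht.le,
        ← integral_inner (hcont.integrableOn_Ioc)]
      refine integral_congr_ae (Eventually.of_forall fun s => ?_)
      simp only [c]
      rw [map_smul, inner_smul_right, ← sineFun_inner, ← inner_conj_symm y,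
        starRingEnd_apply, mul_comm]
    rw [← inner_conj_symm, hstate, map_zero] at e
    have := eq_zero_of_integral_norm_sq_eq_zero hc ht e.symm (t - s) ⟨by linarith, by linarith⟩
    simpa [c] using this
  · rintro hy _ ⟨g, -, hg, rfl⟩
    -- Finite speed leaves a margin t − τ > 0 around the essential support, and almost every point
    -- of `A` belongs to that support.
    have hS : ∀ τ, 0 ≤ τ → τ < t → slSine hpos τ y ∈ L2On Aᶜ := by
      intro τ h0 h1
      have h2 : slSine hpos τ y ∈ L2On (waveNeighborhood A (t - τ))ᶜ := by
        refine mem_L2On_compl_iUnion_of_isOpen (fun _ => isOpen_Ioo) fun x₀ => ?_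
        refine slSine_mem_L2On hq hpos (nonneg_of_mem_support x₀.2) (t := t) ?_ h0
          (by linarith)
        exact L2On_mono (compl_subset_compl.2 (subset_iUnion_of_subset x₀ subset_rfl)) hy
      rw [mem_L2On_compl] at h2 ⊢
      filter_upwards [h2, ae_mem_support A hA] with x e1 e2 hx
      exact e1 (mem_iUnion.2 ⟨⟨x, e2 hx⟩, by constructor <;> simp [h1]⟩)
    rw [← inner_conj_symm]
    have e1 : sourceWave (slOperator q) hpos g t =
        ∫ s in (0 : ℝ)..t, slSine hpos (t - s) (g s) := rfl
    have e2 : ⟪y, sourceWave (slOperator q) hpos g t⟫_ℂ = 0 := by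
      rw [e1, intervalIntegral.integral_of_le ht.le]
      by_cases hi : Integrable (fun s => slSine hpos (t - s) (g s)) (volume.restrict (Ioc 0 t))
      · rw [← integral_inner hi]
        refine integral_eq_zero_of_ae ?_
        filter_upwards [ae_restrict_mem measurableSet_Ioc] with s hs
        rw [← sineFun_inner, ← inner_conj_symm, inner_eq_zero_of_mem_L2On (hg s hs.1.le)
          (hS (t - s) (by linarith [hs.2]) (by linarith [hs.1])), map_zero]
        rfl
      -- A non-integrable integrand has integral 0 by convention, and orthogonality is then
      -- immediate.
      · rw [integral_undef hi, inner_zero_right]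
    rw [e2, map_zero]

end Isotony

/-! ### Convolutions supported on positive times. -/

section CausalConvolution

theorem locallyIntegrable_indicator_Ioi {E : Type*} [NormedAddCommGroup E] {f : ℝ → E}
    (hf : Continuous f) : LocallyIntegrable ((Ioi 0).indicator f) :=
  hf.locallyIntegrable.indicator measurableSet_Ioi

variable {E : Type*} [NormedAddCommGroup E] [NormedSpace ℝ E]

/-- The convolution `∫₀ᵗ ζ(t - τ) f(τ) dτ`. -/
noncomputable def causalConv (f : ℝ → E) (ζ : ℝ → ℝ) : ℝ → E :=
  convolution ((Ioi 0).indicator f) ζ (ContinuousLinearMap.lsmul ℝ ℝ).flip volume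

theorem iteratedDerivWithin_two (u : ℝ → E) (s : Set ℝ) (t : ℝ) :
    iteratedDerivWithin 2 u s t = derivWithin (derivWithin u s) s t := by
  rw [iteratedDerivWithin_succ, iteratedDerivWithin_one]

variable {f : ℝ → E} {ζ : ℝ → ℝ}

theorem causalConv_apply (hζ : ∀ s ≤ 0, ζ s = 0) {t : ℝ} (ht : 0 ≤ t) :
    causalConv f ζ t = ∫ τ in (0 : ℝ)..t, ζ (t - τ) • f τ := by
  rw [intervalIntegral.integral_of_le ht, ← integral_indicator measurableSet_Ioc, causalConv,
    convolution]
  congr 1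
  ext τ
  simp only [ContinuousLinearMap.flip_apply, ContinuousLinearMap.lsmul_apply]
  by_cases h0 : 0 < τ
  · rw [indicator_of_mem (mem_Ioi.2 h0)]
    by_cases h1 : τ ≤ t
    · rw [indicator_of_mem (mem_Ioc.2 ⟨h0, h1⟩)]
    · rw [indicator_of_notMem fun h => h1 h.2, hζ _ (by linarith [not_le.1 h1]), zero_smul]
  · rw [indicator_of_notMem (show τ ∉ Ioi (0 : ℝ) from h0), indicator_of_notMem fun h => h0 h.1,
      smul_zero]

theorem contDiff_causalConv (hf : Continuous f) (hζ : ContDiff ℝ ∞ ζ) (hc : HasCompactSupport ζ) :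
    ContDiff ℝ ∞ (causalConv f ζ) :=
  hc.contDiff_convolution_right (n := ⊤) _ (locallyIntegrable_indicator_Ioi hf) hζ

theorem hasDerivAt_causalConv (hf : Continuous f) (hζ : ContDiff ℝ ∞ ζ)
    (hc : HasCompactSupport ζ) (t : ℝ) :
    HasDerivAt (causalConv f ζ) (causalConv f (deriv ζ) t) t :=
  hc.hasDerivAt_convolution_right _ (locallyIntegrable_indicator_Ioi hf)
    (hζ.of_le (by exact_mod_cast le_top)) t

theorem deriv_eq_zero_of_lt {δ : ℝ} (h : ∀ s < δ, ζ s = 0) : ∀ s < δ, deriv ζ s = 0 := by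
  intro s hs
  have : ζ =ᶠ[𝓝 s] fun _ => 0 := by
    filter_upwards [Iio_mem_nhds hs] with r hr using h r hr
  rw [this.deriv_eq, deriv_const]

end CausalConvolution

/-! ### Smooth waves and their duality with free waves. -/

section AbstractWaves

variable {E : Type*} [NormedAddCommGroup E] [InnerProductSpace ℂ E] [CompleteSpace E]
  {A : E →ₗ.[ℂ] E} {hA : IsPositiveDefinite A}

/-- Two integrations by parts. The boundary terms vanish at τ = t through ζ and at τ = 0 through M.
-/
theorem integral_deriv_deriv_smul {M M₁ M₂ : ℝ → E} (h1 : ∀ τ, HasDerivAt M (M₁ τ) τ)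
    (h2 : ∀ τ, HasDerivAt M₁ (M₂ τ) τ) (hM₂ : Continuous M₂) (h0 : M 0 = 0) (h01 : M₁ 0 = 0)
    {ζ : ℝ → ℝ} (hζ : ContDiff ℝ ∞ ζ) (z0 : ζ 0 = 0) (z1 : deriv ζ 0 = 0) (t : ℝ) :
    ∫ τ in (0 : ℝ)..t, deriv (deriv ζ) (t - τ) • M τ = ∫ τ in (0 : ℝ)..t, ζ (t - τ) • M₂ τ := by
  have hζ1 : ContDiff ℝ ∞ (deriv ζ) := (contDiff_infty_iff_deriv.1 hζ).2
  have hζ2 : ContDiff ℝ ∞ (deriv (deriv ζ)) := (contDiff_infty_iff_deriv.1 hζ1).2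
  have d0 : ∀ τ, HasDerivAt (fun τ => ζ (t - τ)) (-deriv ζ (t - τ)) τ := fun τ => by
    have := ((hζ.differentiable (by simp)) (t - τ)).hasDerivAt.comp τ
      ((hasDerivAt_id τ).const_sub t)
    refine HasDerivAt.congr_deriv this ?_
    rw [mul_neg_one]
  have d1 : ∀ τ, HasDerivAt (fun τ => deriv ζ (t - τ)) (-deriv (deriv ζ) (t - τ)) τ := fun τ => by
    have := ((hζ1.differentiable (by simp)) (t - τ)).hasDerivAt.comp τ
      ((hasDerivAt_id τ).const_sub t)
    refine HasDerivAt.congr_deriv this ?_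
    rw [mul_neg_one]
  have cM : Continuous M := continuous_iff_continuousAt.2 fun τ => (h1 τ).continuousAt
  have ct : Continuous fun τ : ℝ => t - τ := continuous_const.sub continuous_id
  have i1 := ((hζ2.continuous.comp ct).smul cM).intervalIntegrable (μ := volume) 0 t
  have i2 := ((hζ.continuous.comp ct).smul hM₂).intervalIntegrable (μ := volume) 0 t
  have key := intervalIntegral.integral_eq_sub_of_hasDerivAt (a := 0) (b := t)
    (f := fun τ => -(deriv ζ (t - τ) • M τ + ζ (t - τ) • M₁ τ))
    (f' := fun τ => deriv (deriv ζ) (t - τ) • M τ - ζ (t - τ) • M₂ τ) (fun τ _ => by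
      refine (((d1 τ).smul (h1 τ)).add ((d0 τ).smul (h2 τ))).neg.congr_deriv ?_
      rw [neg_smul, neg_smul]
      abel) (i1.sub i2)
  rw [sub_self, z0, z1, h0, h01] at key
  simp only [zero_smul, smul_zero, add_zero, neg_zero, sub_zero] at key
  refine sub_eq_zero.1 (Eq.trans ?_ key)
  exact (intervalIntegral.integral_sub i1 i2).symm

/-- Waves generated by controls `η(t) k` with a fixed `k ∈ Ker A*`. -/
theorem exists_isSmoothWave (hd : Dense (A.domain : Set E)) {k : E}
    (hk : ∃ y : A.adjoint.domain, (y : E) = k ∧ A.adjoint y = 0) {ζ : ℝ → ℝ}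
    (hζ : ContDiff ℝ ∞ ζ) (hc : HasCompactSupport ζ) {δ : ℝ} (hδ : 0 < δ)
    (hz : ∀ s < δ, ζ s = 0) :
    ∃ h u : ℝ → E, IsControl A h ∧ IsSmoothWave A hA h u ∧ ∀ t, 0 ≤ t →
      u t = ∫ τ in (0 : ℝ)..t, ζ (t - τ) •
        (sineFun (boundedInverse (friedrichs A hA)) τ k - τ • k) := by
  obtain ⟨y₀, hy₀, hy₀'⟩ := hk
  set R := boundedInverse (friedrichs A hA)
  have hR : R.IsPositive := boundedInverse_isPositive hd
  set f : ℝ → E := fun τ => sineFun R τ k - τ • k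
  have hf : Continuous f := (continuous_sineFun.clm_apply continuous_const).sub
    (continuous_id.smul continuous_const)
  -- η is the double primitive of ζ, so the control is η k with η'' = ζ. Subtracting the boundary
  -- value, u + ηk solves the Dirichlet problem with source ζ k, which is Duhamel's formula for u.
  set η : ℝ → ℝ := causalConv (fun τ : ℝ => τ) ζ
  have hζ1 : ContDiff ℝ ∞ (deriv ζ) := (contDiff_infty_iff_deriv.1 hζ).2
  have hζ2 : ContDiff ℝ ∞ (deriv (deriv ζ)) := (contDiff_infty_iff_deriv.1 hζ1).2
  have hz1 := deriv_eq_zero_of_lt hz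
  have hz2 := deriv_eq_zero_of_lt hz1
  have hn : ∀ {ξ : ℝ → ℝ}, (∀ s < δ, ξ s = 0) → ∀ s ≤ 0, ξ s = 0 := fun h s hs =>
    h s (hs.trans_lt hδ)
  have hu := contDiff_causalConv hf hζ hc
  have hη : ContDiff ℝ ∞ η := contDiff_causalConv continuous_id hζ hc
  have du : ∀ t, 0 ≤ t → derivWithin (causalConv f ζ) (Ici 0) t = causalConv f (deriv ζ) t :=
    fun t ht => (hasDerivAt_causalConv hf hζ hc t).hasDerivWithinAt.derivWithin
      (uniqueDiffOn_Ici 0 t ht)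
  have ddu : ∀ t, 0 ≤ t → iteratedDerivWithin 2 (causalConv f ζ) (Ici 0) t =
      causalConv f (deriv (deriv ζ)) t := fun t ht => by
    rw [iteratedDerivWithin_two]
    refine (derivWithin_congr (f₁ := derivWithin (causalConv f ζ) (Ici 0))
      (f := causalConv f (deriv ζ)) (fun t ht => du t ht) (du t ht)).trans ?_
    exact (hasDerivAt_causalConv hf hζ1 hc.deriv t).hasDerivWithinAt.derivWithin
      (uniqueDiffOn_Ici 0 t ht)
  -- the wave equation in integrated form
  have heq : ∀ t, 0 ≤ t →
      R (causalConv f (deriv (deriv ζ)) t) + causalConv f ζ t + η t • k = 0 := by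
    intro t ht
    have e1 : R (causalConv f (deriv (deriv ζ)) t) =
        ∫ τ in (0 : ℝ)..t, deriv (deriv ζ) (t - τ) • ((R * sineFun R τ) k - τ • R k) := by
      have ct : Continuous fun τ : ℝ => t - τ := continuous_const.sub continuous_id
      have hi := ((hζ2.continuous.comp ct).smul hf).intervalIntegrable (μ := volume) 0 t
      rw [causalConv_apply (hn hz2) ht]
      refine ((R.restrictScalars ℝ).intervalIntegral_comp_comm hi).symm.trans ?_
      refine intervalIntegral.integral_congr fun τ _ => ?_
      have e : ∀ (r : ℝ) (w : E), R.restrictScalars ℝ (r • w) = r • R w := fun r w =>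
        (R.restrictScalars ℝ).map_smul r w
      refine (e _ _).trans ?_
      simp only [f, Function.comp_apply, map_sub, mul_apply_eq_comp]
      rw [show R (τ • k) = τ • R k from e τ k]
    have e2 := integral_deriv_deriv_smul (M := fun τ => (R * sineFun R τ) k - τ • R k)
      (M₁ := fun τ => cosFun R τ k - R k) (M₂ := fun τ => -sineFun R τ k)
      (fun τ => by
        have := (hasDerivAt_apply (hasDerivAt_mul_sineFun hR τ) k).sub
          ((hasDerivAt_id τ).smul_const (R k))
        refine HasDerivAt.congr_deriv this ?_
        rw [one_smul])
      (fun τ => (hasDerivAt_apply (hasDerivAt_cosFun (R := R) τ) k).sub_const (R k))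
      (continuous_sineFun.clm_apply continuous_const).neg (by simp [sineFun_zero])
      (by simp [cosFun_zero hR]) hζ (hz 0 hδ) (hz1 0 hδ) t
    rw [e1, e2, causalConv_apply (hn hz) ht, show η t = _ from causalConv_apply (hn hz) ht,
      ← intervalIntegral.integral_smul_const, ← intervalIntegral.integral_add,
      ← intervalIntegral.integral_add]
    · refine intervalIntegral.integral_zero_ae (Eventually.of_forall fun τ _ => ?_)
      simp only [f, smul_neg, smul_sub, smul_eq_mul, mul_smul]
      abel
    all_goals
      refine Continuous.intervalIntegrable ?_ _ _
      have h1 : Continuous fun τ : ℝ => ζ (t - τ) := hζ.continuous.comp (by fun_prop)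
      have h2 : Continuous fun τ : ℝ => sineFun R τ k :=
        continuous_sineFun.clm_apply continuous_const
      fun_prop
  have hadj : ∀ t, 0 ≤ t → ∃ y : A.adjoint.domain, (y : E) = causalConv f ζ t ∧
      A.adjoint y = -causalConv f (deriv (deriv ζ)) t := by
    intro t ht
    obtain ⟨y₁, hy₁, hy₁'⟩ := adjoint_boundedInverse (hA := hA) hd
      (-causalConv f (deriv (deriv ζ)) t)
    -- By the integrated equation u = −Ru'' − ηk. The first term has adjoint image −u'', and the
    -- second lies in the kernel.
    refine ⟨y₁ - (η t : ℂ) • y₀, ?_, ?_⟩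
    · rw [Submodule.coe_sub, Submodule.coe_smul, hy₁, hy₀, map_neg]
      have : ((η t : ℂ) • k : E) = η t • k := rfl
      rw [this, eq_comm, ← sub_eq_zero, ← heq t ht]
      abel
    · rw [LinearPMap.map_sub, LinearPMap.map_smul, hy₀', hy₁', smul_zero, sub_zero]
  refine ⟨fun t => η t • k, causalConv f ζ, ⟨?_, ?_, ?_⟩, ⟨hu.contDiffOn, ?_, ?_, ?_, ?_⟩, ?_⟩
  · exact (hη.smul contDiff_const).contDiffOn
  · intro t _
    refine ⟨(η t : ℂ) • y₀, ?_, ?_⟩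
    · rw [Submodule.coe_smul, hy₀]
      rfl
    · rw [LinearPMap.map_smul, hy₀', smul_zero]
  · refine ⟨δ / 2, by positivity, fun t h0 h1 => ?_⟩
    have : η t = 0 := by
      rw [show η t = _ from causalConv_apply (hn hz) h0]
      refine intervalIntegral.integral_zero_ae (Eventually.of_forall fun τ hτ => ?_)
      rw [uIoc_of_le h0] at hτ
      rw [hz _ (by linarith [hτ.1]), zero_smul]
    simp only [this, zero_smul]
  · intro t ht
    obtain ⟨y, hy, hy'⟩ := hadj t ht.le
    exact ⟨y, hy, by rw [hy', ddu t ht.le, add_neg_cancel]⟩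
  · rw [causalConv_apply (hn hz) le_rfl, intervalIntegral.integral_same]
  · rw [du 0 le_rfl, causalConv_apply (hn hz1) le_rfl, intervalIntegral.integral_same]
  · intro t ht
    obtain ⟨y, hy, hy'⟩ := hadj t ht
    refine ⟨y, hy, ?_⟩
    rw [boundaryOp, hy', hy, map_neg, ← sub_eq_zero, ← neg_eq_zero, ← heq t ht]
    abel
  · intro t ht
    exact causalConv_apply (hn hz) ht

/-- The kernel s − t computes a double primitive, so differentiating twice in s recovers φ inside
the interval, and continuity gives the endpoint T. -/
theorem eq_zero_of_integral_sub_mul_eq_zero {φ : ℝ → ℂ} (hφ : ContinuousOn φ (Ici 0)) {T : ℝ}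
    (hT : 0 < T) (h : ∀ s ∈ Icc 0 T, ∫ t in (0 : ℝ)..s, ((s - t : ℝ) : ℂ) * φ t = 0) : φ T = 0 := by
  set ψ : ℝ → ℂ := fun t => φ (max t 0)
  have hψ : Continuous ψ := hφ.comp_continuous (by fun_prop) fun t =>
    mem_Ici.2 (le_max_right _ _)
  have heq : ∀ t, 0 ≤ t → ψ t = φ t := fun t ht => by simp only [ψ, max_eq_left ht]
  have c2 : Continuous fun t : ℝ => (t : ℂ) * ψ t := Complex.continuous_ofReal.mul hψ
  have hK : ∀ s ∈ Ioo 0 T, (s : ℂ) * (∫ t in (0 : ℝ)..s, ψ t) - ∫ t in (0 : ℝ)..s, (t : ℂ) * ψ t =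
      0 := by
    intro s hs
    have c1 : Continuous fun t => (s : ℂ) * ψ t := continuous_const.mul hψ
    rw [← intervalIntegral.integral_const_mul, ← intervalIntegral.integral_sub
      (c1.intervalIntegrable _ _) (c2.intervalIntegrable _ _),
      ← h s ⟨hs.1.le, hs.2.le⟩]
    refine intervalIntegral.integral_congr fun t ht => ?_
    rw [uIcc_of_le hs.1.le] at ht
    rw [heq t ht.1]
    push_cast
    ring
  have d1 : ∀ s, HasDerivAt (fun s => ∫ t in (0 : ℝ)..s, ψ t) (ψ s) s := fun s =>
    (hψ.integral_hasStrictDerivAt 0 s).hasDerivAt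
  have d2 : ∀ s : ℝ, HasDerivAt (fun s : ℝ => ∫ t in (0 : ℝ)..s, (t : ℂ) * ψ t)
      (((s : ℝ) : ℂ) * ψ s) s :=
    fun s => (c2.integral_hasStrictDerivAt 0 s).hasDerivAt
  have hA : ∀ s ∈ Ioo 0 T, ∫ t in (0 : ℝ)..s, ψ t = 0 := by
    intro s hs
    have hd := (((Complex.ofRealCLM.hasDerivAt (x := s)).mul (d1 s)).sub (d2 s)).unique
      ((hasDerivAt_const s (0 : ℂ)).congr_of_eventuallyEq (by
        filter_upwards [Ioo_mem_nhds hs.1 hs.2] with r hr using hK r hr))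
    simp only [Complex.ofRealCLM_apply, Complex.ofReal_one, one_mul] at hd
    linear_combination hd
  have hz : EqOn ψ (fun _ => 0) (Ioo 0 T) := fun s hs =>
    (d1 s).unique ((hasDerivAt_const s (0 : ℂ)).congr_of_eventuallyEq (by
      filter_upwards [Ioo_mem_nhds hs.1 hs.2] with r hr using hA r hr))
  have := hz.closure hψ continuous_const
  rw [closure_Ioo hT.ne] at this
  rw [← heq T hT.le]
  exact this ⟨hT.le, le_rfl⟩

/-- Duality between the controlled wave and the free wave with final data `0, y`. -/
theorem IsSmoothWave.inner_eq_zero (hd : Dense (A.domain : Set E)) {h u : ℝ → E}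
    (hw : IsSmoothWave A hA h u) {y : E} {T : ℝ} (hT : 0 ≤ T)
    (hy : ∀ t σ, 0 ≤ t → 0 ≤ σ → σ ≤ T →
      ⟪h t, σ • y - sineFun (boundedInverse (friedrichs A hA)) σ y⟫_ℂ = 0) :
    ⟪u T, y⟫_ℂ = 0 := by
  rcases hT.eq_or_lt with rfl | hT0
  · rw [hw.initial, inner_zero_left]
  set R := boundedInverse (friedrichs A hA)
  have hR : R.IsPositive := boundedInverse_isPositive hd
  have hRs : ∀ a b, ⟪R a, b⟫_ℂ = ⟪a, R b⟫_ℂ := fun a b => hR.isSelfAdjoint.isSymmetric a b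
  set u₁ := derivWithin u (Ici 0)
  set u₂ := derivWithin u₁ (Ici 0)
  have hu₁ : ContDiffOn ℝ 1 u₁ (Ici 0) :=
    hw.smooth.derivWithin (uniqueDiffOn_Ici 0) (m := 1) (n := ∞) (by norm_cast)
  have du : ∀ t, 0 < t → HasDerivAt u (u₁ t) t := fun t ht =>
    ((hw.smooth.differentiableOn (by simp)) t ht.le).hasDerivWithinAt.hasDerivAt (Ici_mem_nhds ht)
  have du₁ : ∀ t, 0 < t → HasDerivAt u₁ (u₂ t) t := fun t ht =>
    ((hu₁.differentiableOn one_ne_zero) t ht.le).hasDerivWithinAt.hasDerivAt (Ici_mem_nhds ht)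
  -- The wave equation and the boundary condition combine into one identity with bounded operators
  -- only.
  have heq : ∀ t, 0 < t → R (u₂ t) = -(u t + h t) := by
    intro t ht
    obtain ⟨w, hw1, hw2⟩ := hw.equation t ht
    obtain ⟨w', hw1', hw2'⟩ := hw.boundary t ht.le
    obtain rfl : w = w' := Subtype.ext (hw1.trans hw1'.symm)
    rw [iteratedDerivWithin_two] at hw2
    have e : u₂ t = -A.adjoint w := eq_neg_of_add_eq_zero_left hw2
    rw [boundaryOp, hw1] at hw2'
    rw [e, map_neg, ← hw2']
    congr 1
    exact (add_sub_cancel (u t) (R (A.adjoint w))).symm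
  refine eq_zero_of_integral_sub_mul_eq_zero (φ := fun t => ⟪u t, y⟫_ℂ)
    (hw.smooth.continuousOn.inner continuousOn_const) hT0 fun s hs => ?_
  have e1 : ∀ t, HasDerivAt (fun t : ℝ => (s - t) • R y - (R * sineFun R (s - t)) y)
      (-(R y - cosFun R (s - t) y)) t := fun t => by
    have hl : HasDerivAt (fun t : ℝ => s - t) (-1) t := (hasDerivAt_id t).const_sub s
    have := (hl.smul_const (R y)).sub
      ((hasDerivAt_apply (hasDerivAt_mul_sineFun hR (s - t)) y).scomp t hl)
    refine this.congr_deriv ?_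
    simp only [neg_smul, one_smul]
    abel
  have e2 : ∀ t, HasDerivAt (fun t : ℝ => R y - cosFun R (s - t) y) (-sineFun R (s - t) y) t :=
    fun t => by
      have hl : HasDerivAt (fun t : ℝ => s - t) (-1) t := (hasDerivAt_id t).const_sub s
      have := ((hasDerivAt_apply (hasDerivAt_cosFun (R := R) (s - t)) y).scomp t hl).const_sub (R y)
      refine this.congr_deriv ?_
      simp
  -- A Wronskian of u with a twice integrated free wave run back from time s. Its derivative is −(s
  -- − t)⟨u, y⟩, because the control term is annihilated by `hy`, and it vanishes at t = 0 and t =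
  -- s.
  set G : ℝ → ℂ := fun t => ⟪u₁ t, (s - t) • R y - (R * sineFun R (s - t)) y⟫_ℂ +
    ⟪u t, R y - cosFun R (s - t) y⟫_ℂ
  have hG : ∀ t ∈ Ioo 0 s, HasDerivAt G (-(((s - t : ℝ) : ℂ) * ⟪u t, y⟫_ℂ)) t := by
    intro t ht
    have := ((du₁ t ht.1).inner ℂ (e1 t)).add ((du t ht.1).inner ℂ (e2 t))
    refine this.congr_deriv ?_
    have hr : (s - t) • R y - (R * sineFun R (s - t)) y =
        R ((s - t) • y - sineFun R (s - t) y) := by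
      rw [map_sub, mul_apply_eq_comp]
      congr 1
      exact ((R.restrictScalars ℝ).map_smul (s - t) y).symm
    have hz := hy t (s - t) ht.1.le (by linarith [ht.2]) (by linarith [ht.1, hs.2])
    rw [hr, ← hRs, heq t ht.1]
    simp only [inner_neg_left, inner_neg_right, inner_add_left, inner_sub_right]
    rw [inner_sub_right] at hz
    rw [show ((s - t) • y : E) = ((s - t : ℝ) : ℂ) • y from rfl] at hz ⊢
    rw [inner_smul_right] at hz ⊢
    rw [inner_smul_right]
    linear_combination -hz
  have hGc : ContinuousOn G (Icc 0 s) := by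
    have c1 : Continuous fun t : ℝ => (s - t) • R y - (R * sineFun R (s - t)) y :=
      continuous_iff_continuousAt.2 fun t => (e1 t).continuousAt
    have c2 : Continuous fun t : ℝ => R y - cosFun R (s - t) y :=
      continuous_iff_continuousAt.2 fun t => (e2 t).continuousAt
    exact ((hu₁.continuousOn.mono Icc_subset_Ici_self).inner c1.continuousOn).add
      ((hw.smooth.continuousOn.mono Icc_subset_Ici_self).inner c2.continuousOn)
  have hint := intervalIntegral.integral_eq_sub_of_hasDerivAt_of_le hs.1 hGc hG (by
    refine ContinuousOn.intervalIntegrable ?_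
    rw [uIcc_of_le hs.1]
    exact ((Complex.continuous_ofReal.comp (by fun_prop)).continuousOn.mul
      ((hw.smooth.continuousOn.mono Icc_subset_Ici_self).inner continuousOn_const)).neg)
  have g0 : G 0 = 0 := by
    simp only [G]
    rw [hw.initial, show u₁ 0 = 0 from hw.initial_deriv, inner_zero_left, inner_zero_left, add_zero]
  have gs : G s = 0 := by
    simp only [G, sub_self, sineFun_zero, cosFun_zero hR, mul_zero]
    simp
  rw [intervalIntegral.integral_neg, g0, gs, sub_zero, neg_eq_zero] at hint
  exact hint

end AbstractWaves

/-! ### Reachable subspaces of the Sturm-Liouville system. -/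

section Reachable

theorem inner_ofReal_smul_left {E : Type*} [NormedAddCommGroup E] [InnerProductSpace ℂ E]
    (r : ℝ) (x y : E) : ⟪r • x, y⟫_ℂ = (r : ℂ) * ⟪x, y⟫_ℂ := by
  rw [show r • x = (r : ℂ) • x from rfl, inner_smul_left, Complex.conj_ofReal]

variable {q : ℝ → ℝ}

/-- Pairing with the deficiency vector gives the derivative at 0 of L⁻¹(L₀a) = a, which is zero on
the domain of L₀. -/
theorem inner_deficiencyVec_slOperator (hq : ContinuousOn q (Ici 0))
    (hpos : IsPositiveDefinite (slOperator q)) (a : (slOperator q).domain) :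
    ⟪deficiencyVec hq hpos, slOperator q a⟫_ℂ = 0 := by
  have hg : ((a : HalfLine), slOperator q a) ∈ slGraph q := by
    rw [← slOperator_graph]
    exact LinearPMap.mem_graph _ a
  obtain ⟨Y, Y₁, Y₂, hY, h0, h1, e1, e2⟩ := hg
  have hR : slInverse hpos (slOperator q a) = a :=
    boundedInverse_map (hA := hpos) (dense_slOperator_domain hq) a
  rw [inner_deficiencyVec hq hpos hY h0 (by rw [hR]; exact e1) ?_, h1]
  filter_upwards [e2] with x hx
  rw [hx]
  ring

theorem exists_adjoint_deficiencyVec (hq : ContinuousOn q (Ici 0))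
    (hpos : IsPositiveDefinite (slOperator q)) :
    ∃ y : (slOperator q).adjoint.domain, (y : HalfLine) = deficiencyVec hq hpos ∧
      (slOperator q).adjoint y = 0 := by
  have hw : ∀ x : (slOperator q).domain,
      ⟪(0 : HalfLine), (x : HalfLine)⟫_ℂ = ⟪deficiencyVec hq hpos, slOperator q x⟫_ℂ := fun x => by
    rw [inner_zero_left, inner_deficiencyVec_slOperator]
  exact ⟨⟨_, LinearPMap.mem_adjoint_domain_of_exists _ ⟨0, hw⟩⟩, rfl,
    LinearPMap.adjoint_apply_eq (dense_slOperator_domain hq) _ hw⟩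

/-- If (L⁻¹f)'(0) = 0, then L⁻¹f has zero Cauchy data at 0 and lies in the domain of L₀. So f is in
the range of L₀, which is orthogonal to the kernel of the adjoint. Hence that kernel is spanned by
the deficiency vector. -/
theorem inner_eq_zero_of_inner_deficiencyVec (hq : ContinuousOn q (Ici 0))
    (hpos : IsPositiveDefinite (slOperator q)) {f : HalfLine}
    (hf : ⟪deficiencyVec hq hpos, f⟫_ℂ = 0) {y : (slOperator q).adjoint.domain}
    (hy : (slOperator q).adjoint y = 0) : ⟪(y : HalfLine), f⟫_ℂ = 0 := by
  obtain ⟨Y, Y₁, Y₂, hY, h0, e1, e2⟩ := exists_isH2Loc_slInverse hq hpos f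
  have hY₂ : ∀ᵐ x ∂halfLineMeasure, Y₂ x = q x * Y x - f x := by
    filter_upwards [e1] with x hx
    rw [e2 x, hx]
  have h1 : Y₁ 0 = 0 := by rw [← inner_deficiencyVec hq hpos hY h0 e1 hY₂, hf]
  have hg : (slInverse hpos f, f) ∈ (slOperator q).graph := by
    rw [slOperator_graph]
    refine ⟨Y, Y₁, Y₂, hY, h0, h1, e1, ?_⟩
    filter_upwards [hY₂] with x hx
    rw [hx]
    ring
  obtain ⟨a, -, ha⟩ := (LinearPMap.mem_graph_iff _).1 hg
  have := LinearPMap.adjoint_isFormalAdjoint (dense_slOperator_domain hq) y a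
  simp only at ha
  rw [← ha]
  rw [hy, inner_zero_left] at this
  exact this.symm

/-- The reachable subspace at time `T` is `L₂(0, T)`. -/
theorem reachableSubspace_slOperator (hq : ContinuousOn q (Ici 0))
    (hpos : IsPositiveDefinite (slOperator q)) {T : ℝ} (hT : 0 ≤ T) :
    reachableSubspace (slOperator q) hpos T = L2On (Ioo 0 T) := by
  have hd := dense_slOperator_domain hq
  refine closure_span_eq_of_orthogonal fun y => ?_
  rw [L2On_orthogonal measurableSet_Ioo]
  constructor
  · intro h
    set k := deficiencyVec hq hpos
    set F : ℝ → ℂ := fun τ => ⟪slSine hpos τ k - τ • k, y⟫_ℂ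
    have hF : Continuous F := ((continuous_sineFun.clm_apply continuous_const).sub
      (continuous_id.smul continuous_const)).inner continuous_const
    have hae : ∀ᵐ τ : ℝ, τ ∈ Ioo 0 T → F τ = 0 := by
      -- Taking ζ(s) = g(T − s) makes the state at time T equal to the integral of g(τ)(S(τ)k − τk),
      -- so orthogonality to states tests `F` against all bump functions on (0, T).
      refine isOpen_Ioo.ae_eq_zero_of_integral_contDiff_smul_eq_zero
        (hF.locallyIntegrable.locallyIntegrableOn _) fun g hg hgc hgs => ?_
      have hg0 : ∀ τ, τ ∉ Ioo 0 T → g τ = 0 := fun τ hτ =>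
        image_eq_zero_of_notMem_tsupport fun h => hτ (hgs h)
      -- The support of g is a compact subset of (0, T); its distance to T is the time during which
      -- the control is off.
      obtain ⟨δ, hδ, hz⟩ : ∃ δ > 0, ∀ s < δ, g (T - s) = 0 := by
        rcases (tsupport g).eq_empty_or_nonempty with h0 | h0
        · exact ⟨1, one_pos, fun s _ => image_eq_zero_of_notMem_tsupport (by simp [h0])⟩
        · obtain ⟨b, hb, hb'⟩ := hgc.isCompact.exists_isGreatest h0
          refine ⟨T - b, sub_pos.2 (hgs hb).2, fun s hs =>
            image_eq_zero_of_notMem_tsupport fun h => ?_⟩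
          linarith [hb' h]
      obtain ⟨c, u, hc, hu, hut⟩ := exists_isSmoothWave (hA := hpos) hd
        (exists_adjoint_deficiencyVec hq hpos) (ζ := fun s => g (T - s))
        (hg.comp (contDiff_const.sub contDiff_id))
        (hgc.comp_homeomorph (Homeomorph.subLeft T)) hδ hz
      have := h _ ⟨c, u, hc, hu, rfl⟩
      rw [hut T hT] at this
      have hcont : Continuous fun τ : ℝ => g (T - (T - τ)) • (slSine hpos τ k - τ • k) := by
        have h1 : Continuous fun τ : ℝ => slSine hpos τ k :=
          continuous_sineFun.clm_apply continuous_const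
        have h2 := hg.continuous
        fun_prop
      rw [intervalIntegral.integral_of_le hT] at this
      have e : ∀ v : HalfLine, ⟪v, y⟫_ℂ = starRingEnd ℂ ⟪y, v⟫_ℂ := fun v =>
        (inner_conj_symm v y).symm
      rw [e, map_eq_zero] at this
      replace this := (integral_inner (𝕜 := ℂ) hcont.integrableOn_Ioc y).trans this
      rw [← setIntegral_eq_integral_of_forall_compl_eq_zero (s := Ioc 0 T) fun τ hτ => by
        rw [hg0 τ fun h => hτ ⟨h.1, h.2.le⟩, zero_smul]]
      have e' : ∀ τ, g τ • F τ = starRingEnd ℂ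
          ⟪y, g (T - (T - τ)) • (slSine hpos τ k - τ • k)⟫_ℂ := fun τ => by
        rw [← e, sub_sub_cancel]
        exact (inner_ofReal_smul_left _ _ _).symm
      simp only [e']
      rw [integral_conj, this, map_zero]
    have hF0 : ∀ τ, 0 ≤ τ → τ ≤ T → F τ = 0 := by
      intro τ h0 h1
      rcases hT.eq_or_lt with rfl | hT0
      · obtain rfl : τ = 0 := le_antisymm h1 h0
        simp [F, sineFun_zero]
      have h2 : EqOn F (fun _ => 0) (Ioo 0 T) :=
        Measure.eqOn_open_of_ae_eq ((ae_restrict_iff' measurableSet_Ioo).2 hae) isOpen_Ioo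
          hF.continuousOn continuousOn_const
      have h3 := h2.closure hF continuous_const
      rw [closure_Ioo hT0.ne] at h3
      exact h3 ⟨h0, h1⟩
    -- `F` = 0 says that ⟨k, S(s)y⟩ = s⟨k, y⟩, a linear boundary observation.
    refine mem_L2On_compl_of_inner_deficiencyVec hq hpos (c := ⟪k, y⟫_ℂ) fun s h0 h1 => ?_
    have := hF0 s h0 h1
    simp only [F] at this
    rw [inner_sub_left, sub_eq_zero, sineFun_inner] at this
    rw [this]
    exact inner_ofReal_smul_left _ _ _
  · rintro hy x ⟨c, u, hc, hu, rfl⟩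
    refine hu.inner_eq_zero hd hT fun t σ ht h0 h1 => ?_
    obtain ⟨w, hw, hw'⟩ := hc.2.1 t ht
    rw [← hw]
    exact inner_eq_zero_of_inner_deficiencyVec hq hpos
      (inner_deficiencyVec_slSine hq hpos hy h0 h1) hw'

end Reachable

/-! ### Strong convergence as local convergence in measure. -/

section Convergence

theorem tendsto_strongTopology {E ι : Type*} [NormedAddCommGroup E] [InnerProductSpace ℂ E]
    [CompleteSpace E] {l : Filter ι} {A : ι → ClosedSubmodule ℂ E} {B : ClosedSubmodule ℂ E} :
    Tendsto A l (𝓝 B) ↔ ∀ x : E, Tendsto (fun i => (A i).toSubmodule.starProjection x) l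
      (𝓝 (B.toSubmodule.starProjection x)) := by
  rw [(IsInducing.mk rfl : IsInducing fun (A : ClosedSubmodule ℂ E) (x : E) =>
    A.toSubmodule.starProjection x).tendsto_nhds_iff, tendsto_pi_nhds]
  rfl

theorem continuous_starProjection_apply {E : Type*} [NormedAddCommGroup E]
    [InnerProductSpace ℂ E] [CompleteSpace E] (x : E) :
    Continuous fun A : ClosedSubmodule ℂ E => A.toSubmodule.starProjection x :=
  (continuous_apply x).comp continuous_induced_dom

variable {A B : Set ℝ}

theorem enorm_sq_eq_lintegral (f : HalfLine) :
    ‖f‖ₑ ^ 2 = ∫⁻ x, ‖f x‖ₑ ^ 2 ∂halfLineMeasure := by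
  have := eLpNorm_nnreal_pow_eq_lintegral (f := f) (p := 2) (μ := halfLineMeasure) two_ne_zero
  rw [Lp.enorm_def]
  simpa using this

theorem enorm_restrictTo_sub_sq (hA : MeasurableSet A) (hB : MeasurableSet B) (f : HalfLine) :
    ‖restrictTo hA f - restrictTo hB f‖ₑ ^ 2 =
      ∫⁻ x in symmDiff A B, ‖f x‖ₑ ^ 2 ∂halfLineMeasure := by
  rw [enorm_sq_eq_lintegral, ← lintegral_indicator (hA.symmDiff hB)]
  refine lintegral_congr_ae ?_
  filter_upwards [restrictTo_ae_eq hA f, restrictTo_ae_eq hB f,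
    Lp.coeFn_sub (restrictTo hA f) (restrictTo hB f)] with x h1 h2 h3
  rw [h3, Pi.sub_apply, h1, h2]
  by_cases ha : x ∈ A <;> by_cases hb : x ∈ B <;>
    simp [ha, hb, indicator, mem_symmDiff]

theorem tendsto_restrictTo_iff {F : ℕ → Set ℝ} (hF : ∀ n, MeasurableSet (F n))
    (hA : MeasurableSet A) (f : HalfLine) :
    Tendsto (fun n => restrictTo (hF n) f) atTop (𝓝 (restrictTo hA f)) ↔
      Tendsto (fun n => ∫⁻ x in symmDiff (F n) A, ‖f x‖ₑ ^ 2 ∂halfLineMeasure) atTop (𝓝 0) := by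
  simp only [fun n => (enorm_restrictTo_sub_sq (hF n) hA f).symm]
  rw [tendsto_iff_edist_tendsto_0]
  have e : ∀ n, edist (restrictTo (hF n) f) (restrictTo hA f) =
      ‖restrictTo (hF n) f - restrictTo hA f‖ₑ := fun n => edist_eq_enorm_sub _ _
  simp only [e]
  constructor
  · intro h
    simpa using ENNReal.Tendsto.pow (n := 2) h
  · intro h
    have := (ENNReal.continuous_rpow_const (y := (1 / 2 : ℝ))).tendsto 0 |>.comp h
    simp only [Function.comp_def] at this
    rw [ENNReal.zero_rpow_of_pos (by norm_num)] at this
    refine this.congr fun n => ?_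
    rw [← ENNReal.rpow_natCast, ← ENNReal.rpow_mul]
    norm_num

/-- The squared distance of the projections of f is the integral of |f|² over the symmetric
difference. Indicators of (0, R) test necessity. For sufficiency the tail of f is small, and on a
bounded interval the integral is absolutely continuous. -/
theorem tendsto_L2On_iff_of_measurableSet {F : ℕ → Set ℝ} (hF : ∀ n, MeasurableSet (F n))
    (hA : MeasurableSet A) :
    Tendsto (fun n => L2On (F n)) atTop (𝓝 (L2On A)) ↔
      ∀ R : ℝ, 0 < R → Tendsto (fun n => volume (symmDiff (F n) A ∩ Ioo 0 R)) atTop (𝓝 0) := by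
  simp only [tendsto_strongTopology, starProjection_L2On hA, starProjection_L2On (hF _),
    tendsto_restrictTo_iff hF hA]
  have hD : ∀ n, MeasurableSet (symmDiff (F n) A) := fun n => (hF n).symmDiff hA
  constructor
  · intro h R hR
    have hfin : halfLineMeasure (Ioo 0 R) ≠ ⊤ :=
      ((Measure.restrict_apply_le _ _).trans_lt measure_Ioo_lt_top).ne
    refine (h (indicatorConstLp 2 measurableSet_Ioo hfin 1)).congr fun n => ?_
    have e : ∀ᵐ x ∂halfLineMeasure.restrict (symmDiff (F n) A),
        ‖indicatorConstLp 2 (measurableSet_Ioo (a := (0 : ℝ)) (b := R)) hfin (1 : ℂ) x‖ₑ ^ 2 =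
          (Ioo 0 R).indicator (1 : ℝ → ENNReal) x := by
      filter_upwards [ae_restrict_of_ae (indicatorConstLp_coeFn (p := 2)
        (hs := measurableSet_Ioo) (hμs := hfin) (c := (1 : ℂ)))] with x hx
      rw [hx]
      by_cases hx' : x ∈ Ioo 0 R <;> simp [hx']
    rw [lintegral_congr_ae e, lintegral_indicator_one measurableSet_Ioo,
      Measure.restrict_apply measurableSet_Ioo, Measure.restrict_apply
      (measurableSet_Ioo.inter (hD n)), inter_comm (Ioo 0 R), inter_assoc,
      inter_eq_self_of_subset_left Ioo_subset_Ioi_self]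
  · intro h f
    have hfin : ∫⁻ x, ‖f x‖ₑ ^ 2 ∂halfLineMeasure ≠ ⊤ := by
      rw [← enorm_sq_eq_lintegral]
      exact ENNReal.pow_ne_top enorm_ne_top
    have htail : Tendsto (fun m : ℕ => ∫⁻ x in Ici (m : ℝ), ‖f x‖ₑ ^ 2 ∂halfLineMeasure) atTop
        (𝓝 0) := by
      have hanti : Antitone fun m : ℕ => Ici (m : ℝ) := fun a b hab =>
        Ici_subset_Ici.2 (Nat.cast_le.2 hab)
      have hinter : ⋂ m : ℕ, Ici (m : ℝ) = ∅ := by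
        refine eq_empty_of_forall_notMem fun x hx => ?_
        obtain ⟨m, hm⟩ := exists_nat_gt x
        exact absurd (mem_iInter.1 hx m) (not_le.2 hm)
      have := tendsto_measure_iInter_atTop
        -- The tail estimate is continuity from above of the finite measure with density |f|².
        (μ := halfLineMeasure.withDensity fun x => ‖f x‖ₑ ^ 2)
        (fun m : ℕ => (measurableSet_Ici (a := (m : ℝ))).nullMeasurableSet) hanti
        ⟨0, by
          rw [withDensity_apply _ measurableSet_Ici]
          exact ((setLIntegral_le_lintegral _ _).trans_lt hfin.lt_top).ne⟩
      rw [hinter, measure_empty] at this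
      simpa only [Function.comp_def, withDensity_apply _ measurableSet_Ici] using this
    rw [ENNReal.tendsto_nhds_zero] at htail ⊢
    intro ε hε
    have hε2 : 0 < ε / 2 := ENNReal.half_pos hε.ne'
    obtain ⟨m, hm, hm1⟩ := ((htail _ hε2).and (eventually_ge_atTop 1)).exists
    have hloc : Tendsto (fun n => ∫⁻ x in symmDiff (F n) A ∩ Ioo 0 (m : ℝ), ‖f x‖ₑ ^ 2
        ∂halfLineMeasure) atTop (𝓝 0) := by
      refine tendsto_setLIntegral_zero hfin ?_
      refine tendsto_of_tendsto_of_tendsto_of_le_of_le tendsto_const_nhds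
        (h m (by exact_mod_cast hm1)) (fun _ => zero_le) fun n => Measure.restrict_apply_le _ _
    filter_upwards [ENNReal.tendsto_nhds_zero.1 hloc _ hε2] with n hn
    have hsub : ∀ᵐ x ∂halfLineMeasure, x ∈ symmDiff (F n) A →
        x ∈ (symmDiff (F n) A ∩ Ioo 0 (m : ℝ)) ∪ Ici (m : ℝ) := by
      filter_upwards [ae_restrict_mem measurableSet_Ioi] with x hx hxD
      rcases lt_or_ge x m with h1 | h1
      exacts [Or.inl ⟨hxD, hx, h1⟩, Or.inr h1]
    calc ∫⁻ x in symmDiff (F n) A, ‖f x‖ₑ ^ 2 ∂halfLineMeasure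
        ≤ ∫⁻ x in (symmDiff (F n) A ∩ Ioo 0 (m : ℝ)) ∪ Ici (m : ℝ), ‖f x‖ₑ ^ 2 ∂halfLineMeasure :=
          lintegral_mono' (Measure.restrict_mono' hsub le_rfl) le_rfl
      _ ≤ _ := lintegral_union_le _ _ _
      _ ≤ ε / 2 + ε / 2 := add_le_add hn hm
      _ = ε := ENNReal.add_halves ε

theorem tendsto_L2On_iff {F : ℕ → Set ℝ} (hF : ∀ n, NullMeasurableSet (F n) volume)
    (hA : NullMeasurableSet A volume) :
    Tendsto (fun n => L2On (F n)) atTop (𝓝 (L2On A)) ↔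
      ∀ R : ℝ, 0 < R → Tendsto (fun n => volume (symmDiff (F n) A ∩ Ioo 0 R)) atTop (𝓝 0) := by
  choose G hG hGF hGL using fun n => exists_measurableSet_L2On_eq (hF n)
  obtain ⟨B, hB, hBA, hBL⟩ := exists_measurableSet_L2On_eq hA
  simp only [hGL, hBL]
  rw [tendsto_L2On_iff_of_measurableSet hG hB]
  have e : ∀ n R, volume (symmDiff (G n) B ∩ Ioo 0 R) = volume (symmDiff (F n) A ∩ Ioo 0 R) :=
    fun n R => measure_congr (((hGF n).symmDiff hBA).inter (ae_eq_refl _))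
  simp only [e]

end Convergence

/-! ### Approximation by the generated algebra of sets. -/

section Density

variable {E : Type*} [NormedAddCommGroup E] [InnerProductSpace ℂ E]

theorem isSubspaceLattice_minimalLattice (I : ℝ → ClosedSubmodule ℂ E → ClosedSubmodule ℂ E)
    (M : Set (ClosedSubmodule ℂ E)) : IsSubspaceLattice (minimalLattice I M) where
  bot_mem := mem_sInter.2 fun _ hS => hS.1.bot_mem
  top_mem := mem_sInter.2 fun _ hS => hS.1.top_mem
  sup_mem A hA B hB := mem_sInter.2 fun S hS =>
    hS.1.sup_mem A (mem_sInter.1 hA S hS) B (mem_sInter.1 hB S hS)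
  inf_mem A hA B hB := mem_sInter.2 fun S hS =>
    hS.1.inf_mem A (mem_sInter.1 hA S hS) B (mem_sInter.1 hB S hS)
  orthogonal_mem A hA := mem_sInter.2 fun S hS => hS.1.orthogonal_mem A (mem_sInter.1 hA S hS)

theorem subset_minimalLattice (I : ℝ → ClosedSubmodule ℂ E → ClosedSubmodule ℂ E)
    (M : Set (ClosedSubmodule ℂ E)) : M ⊆ minimalLattice I M := fun _ hA =>
  mem_sInter.2 fun _ hS => hS.2.1 hA

theorem sup_eq_orthogonal [CompleteSpace E] (A B : ClosedSubmodule ℂ E) : A ⊔ B = (Aᗮ ⊓ Bᗮ)ᗮ := by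
  rw [ClosedSubmodule.inf_orthogonal, ClosedSubmodule.orthogonal_orthogonal_eq]

theorem L2On_sup {A B : Set ℝ} (hA : MeasurableSet A) (hB : MeasurableSet B) :
    L2On A ⊔ L2On B = L2On (A ∪ B) := by
  rw [sup_eq_orthogonal, L2On_orthogonal hA, L2On_orthogonal hB, L2On_inf,
    L2On_orthogonal (hA.compl.inter hB.compl), compl_inter, compl_compl, compl_compl]

/-- Closed sums and orthogonal complements of the subspaces correspond to unions and set
complements, so lattice closure becomes Boolean closure. -/
theorem isSetAlgebra_of_isSubspaceLattice {S : Set (ClosedSubmodule ℂ HalfLine)}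
    (hS : IsSubspaceLattice S) : IsSetAlgebra {A : Set ℝ | MeasurableSet A ∧ L2On A ∈ S} where
  empty_mem := ⟨MeasurableSet.empty, L2On_empty ▸ hS.bot_mem⟩
  compl_mem _ hA := ⟨hA.1.compl, L2On_orthogonal hA.1 ▸ hS.orthogonal_mem _ hA.2⟩
  union_mem _ _ hA hB := ⟨hA.1.union hB.1, L2On_sup hA.1 hB.1 ▸ hS.sup_mem _ hA.2 _ hB.2⟩

theorem L2On_Iio (T : ℝ) : L2On (Iio T) = L2On (Ioo 0 T) := by
  refine L2On_congr ?_
  filter_upwards [ae_restrict_mem measurableSet_Ioi] with x hx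
  exact propext ⟨fun h => ⟨hx, h⟩, fun h => h.2⟩

/-- A lattice of closed subspaces that contains all `L₂(0, T)` is dense in the family of all
subspaces `L₂(A)`. -/
theorem L2On_mem_closure {S : Set (ClosedSubmodule ℂ HalfLine)} (hS : IsSubspaceLattice S)
    (hT : ∀ T : ℝ, 0 ≤ T → L2On (Ioo 0 T) ∈ S) {A : Set ℝ} (hA : MeasurableSet A) :
    L2On A ∈ closure S := by
  -- Rays (−∞, T) generate the Borel sets, and only their part in (0, T) is visible on the
  -- half-line.
  have hgen : borel ℝ = MeasurableSpace.generateFrom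
      {A : Set ℝ | MeasurableSet A ∧ L2On A ∈ S} := by
    refine le_antisymm ?_ (MeasurableSpace.generateFrom_le fun B hB => ?_)
    · rw [borel_eq_generateFrom_Iio]
      refine MeasurableSpace.generateFrom_mono ?_
      rintro _ ⟨T, rfl⟩
      refine ⟨measurableSet_Iio, ?_⟩
      rw [L2On_Iio]
      rcases le_total 0 T with h | h
      · exact hT T h
      · rw [Ioo_eq_empty (not_lt.2 h), L2On_empty]
        exact hS.bot_mem
    · rw [← BorelSpace.measurable_eq (α := ℝ)]
      exact hB.1
  have happ : ∀ n : ℕ, ∃ B : Set ℝ, (MeasurableSet B ∧ L2On B ∈ S) ∧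
      volume (symmDiff B A ∩ Ioo 0 (n : ℝ)) ≤ ENNReal.ofReal (1 / (n + 1)) := by
    intro n
    -- Approximation by an algebra is available for finite measures. Taking the window (0, n) and
    -- the error 1/(n + 1) together gives one sequence that works for every R.
    have : IsFiniteMeasure (volume.restrict (Ioo 0 (n : ℝ))) :=
      ⟨by simp [Real.volume_Ioo]⟩
    obtain ⟨B, hB, hB'⟩ := (Measure.MeasureDense.of_generateFrom_isSetAlgebra_finite
      (μ := volume.restrict (Ioo 0 (n : ℝ))) (isSetAlgebra_of_isSubspaceLattice hS)
      ((BorelSpace.measurable_eq (α := ℝ)).trans hgen)).approx A hA (measure_ne_top _ _)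
      (1 / (n + 1)) Nat.one_div_pos_of_nat
    refine ⟨B, hB, ?_⟩
    rw [symmDiff_comm, ← Measure.restrict_apply (hA.symmDiff hB.1)]
    exact hB'.le
  choose F hF hFv using happ
  refine mem_closure_of_tendsto ((tendsto_L2On_iff_of_measurableSet (fun n => (hF n).1) hA).2 ?_)
    (Eventually.of_forall fun n => (hF n).2)
  intro R _
  have h0 : Tendsto (fun n : ℕ => ENNReal.ofReal (1 / ((n : ℝ) + 1))) atTop (𝓝 0) := by
    simpa using ENNReal.tendsto_ofReal tendsto_one_div_add_atTop_nhds_zero_nat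
  refine tendsto_of_tendsto_of_tendsto_of_le_of_le' tendsto_const_nhds h0
    (Eventually.of_forall fun _ => zero_le) ?_
  obtain ⟨m, hm⟩ := exists_nat_ge R
  filter_upwards [eventually_ge_atTop m] with n hn
  refine (measure_mono (inter_subset_inter_right _ (Ioo_subset_Ioo_right ?_))).trans (hFv n)
  exact hm.trans (Nat.cast_le.2 hn)

end Density

/-! ### Subspaces commuting with multiplication by indicators. -/

section Closed

theorem inner_restrictTo {B : Set ℝ} (hB : MeasurableSet B) (y f : HalfLine) :
    ⟪y, restrictTo hB f⟫_ℂ = ∫ x in B, ⟪y x, f x⟫_ℂ ∂halfLineMeasure := by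
  rw [L2.inner_def, ← integral_indicator hB]
  refine integral_congr_ae ?_
  filter_upwards [restrictTo_ae_eq hB f] with x hx
  rw [hx]
  by_cases h : x ∈ B <;> simp [h]

/-- Orthogonality to every restriction of f means that the pointwise inner product has zero integral
over every measurable set, hence is zero almost everywhere. -/
theorem ae_eq_zero_or_of_inner_restrictTo {y f : HalfLine}
    (h : ∀ (B : Set ℝ) (hB : MeasurableSet B), ⟪y, restrictTo hB f⟫_ℂ = 0) :
    ∀ᵐ x ∂halfLineMeasure, y x = 0 ∨ f x = 0 := by
  have := (L2.integrable_inner (𝕜 := ℂ) y f).ae_eq_zero_of_forall_setIntegral_eq_zero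
    fun B hB _ => by rw [← inner_restrictTo hB, h B hB]
  filter_upwards [this] with x hx
  rw [RCLike.inner_apply] at hx
  rcases mul_eq_zero.1 hx with h1 | h1
  · exact Or.inr h1
  · exact Or.inl ((map_eq_zero _).1 h1)

theorem restrictTo_comm {A B : Set ℝ} (hA : MeasurableSet A) (hB : MeasurableSet B)
    (f : HalfLine) : restrictTo hA (restrictTo hB f) = restrictTo hB (restrictTo hA f) := by
  refine Lp.ext ?_
  filter_upwards [restrictTo_ae_eq hA f, restrictTo_ae_eq hB f,
    restrictTo_ae_eq hA (restrictTo hB f), restrictTo_ae_eq hB (restrictTo hA f)] with x h1 h2 h3 h4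
  rw [h3, h4]
  by_cases ha : x ∈ A <;> by_cases hb : x ∈ B <;> simp [ha, hb, h1, h2]

theorem restrictTo_sub {B : Set ℝ} (hB : MeasurableSet B) (f g : HalfLine) :
    restrictTo hB (f - g) = restrictTo hB f - restrictTo hB g := by
  simp only [← starProjection_L2On, map_sub]

theorem exists_halfLine_ne_zero : ∃ f : HalfLine, ∀ᵐ x ∂halfLineMeasure, f x ≠ 0 := by
  have hm : MemLp (fun x : ℝ => (Real.exp (-x) : ℂ)) 2 halfLineMeasure := by
    have hc : Continuous fun x : ℝ => (Real.exp (-x) : ℂ) := by fun_prop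
    rw [memLp_two_iff_integrable_sq_norm hc.aestronglyMeasurable]
    refine (exp_neg_integrableOn_Ioi 0 two_pos).congr (Eventually.of_forall fun x => ?_)
    simp only [Complex.norm_real, Real.norm_eq_abs, sq_abs]
    rw [← Real.exp_nat_mul]
    congr 1
    push_cast
    ring
  refine ⟨hm.toLp _, ?_⟩
  filter_upwards [hm.coeFn_toLp] with x hx
  rw [hx]
  exact Complex.ofReal_ne_zero.2 (Real.exp_pos _).ne'

/-- A closed subspace whose projection commutes with all multiplications by indicator functions
is a subspace `L₂(A)`. -/
theorem exists_eq_L2On_of_commute {K : ClosedSubmodule ℂ HalfLine}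
    (h : ∀ (B : Set ℝ) (hB : MeasurableSet B) (f : HalfLine),
      K.toSubmodule.starProjection (restrictTo hB f) =
        restrictTo hB (K.toSubmodule.starProjection f)) :
    ∃ A, MeasurableSet A ∧ K = L2On A := by
  obtain ⟨f, hf⟩ := exists_halfLine_ne_zero
  set P := K.toSubmodule.starProjection
  have hsymm : ∀ u v, ⟪P u, v⟫_ℂ = ⟪u, P v⟫_ℂ := K.toSubmodule.starProjection_isSymmetric
  have hP : ∀ u ∈ K, P u = u := fun u hu => Submodule.starProjection_eq_self_iff.2 hu
  have hPK : ∀ u, P u ∈ K := fun u => K.toSubmodule.starProjection_apply_mem u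
  set φ := P f
  -- f − φ is orthogonal to `K`, and commutation keeps this true after restriction to any `B`. Where
  -- φ = 0 one has f − φ = f ≠ 0, so elements of `K` vanish there.
  have hle : ∀ y ∈ K, ∀ᵐ x ∂halfLineMeasure, y x = 0 ∨ (f - φ) x = 0 := fun y hy =>
    ae_eq_zero_or_of_inner_restrictTo fun B hB => by
      rw [restrictTo_sub, inner_sub_right, ← h B hB f, ← hsymm, hP y hy, sub_self]
  have hA : MeasurableSet {x | φ x ≠ 0} :=
    (Lp.stronglyMeasurable φ).measurable (measurableSet_singleton 0).compl
  have hsub : K ≤ L2On {x | φ x ≠ 0} := fun y hy => by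
    change ∀ᵐ x ∂halfLineMeasure, x ∉ {x | φ x ≠ 0} → y x = 0
    filter_upwards [hle y hy, hf, Lp.coeFn_sub f φ] with x h1 h2 h3 h4
    refine h1.resolve_right fun h5 => h2 ?_
    rw [h3, Pi.sub_apply, sub_eq_zero] at h5
    rw [h5]
    exact not_not.1 h4
  refine ⟨_, hA, le_antisymm hsub fun y hy => ?_⟩
  have hz : y - P y ∈ L2On {x | φ x ≠ 0} := 
    (L2On _).toSubmodule.sub_mem hy (hsub (hPK y))
  -- y − Py is orthogonal to `K`, and commutation puts every restriction of φ in `K`. So y − Py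
  -- vanishes where φ ≠ 0, and it is already known to vanish elsewhere.
  have h0 : ∀ᵐ x ∂halfLineMeasure, (y - P y) x = 0 ∨ φ x = 0 :=
    ae_eq_zero_or_of_inner_restrictTo fun B hB => by
      rw [← h B hB f, ← hsymm, map_sub, hP _ (hPK y), sub_self, inner_zero_left]
  have hz0 : y - P y = 0 := by
    rw [Lp.eq_zero_iff_ae_eq_zero]
    rw [mem_L2On] at hz
    filter_upwards [h0, hz] with x h1 h2
    by_cases h3 : φ x = 0
    · exact h2 (not_not.2 h3)
    · exact h1.resolve_right h3
  rw [sub_eq_zero.1 hz0]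
  exact hPK y

end Closed

/-! ### The closure of the operator lattice. -/

section Spectrum

/-- Commutation with each indicator, tested on each f, equates two continuous functions of the
subspace, so the family is an intersection of closed sets. -/
theorem isClosed_L2On_family :
    IsClosed {K : ClosedSubmodule ℂ HalfLine | ∃ A, MeasurableSet A ∧ K = L2On A} := by
  have e : {K : ClosedSubmodule ℂ HalfLine | ∃ A, MeasurableSet A ∧ K = L2On A} =
      ⋂ (B : {B : Set ℝ // MeasurableSet B}) (f : HalfLine),
        {K | K.toSubmodule.starProjection (restrictTo B.2 f) =
          restrictTo B.2 (K.toSubmodule.starProjection f)} := by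
    ext K
    simp only [mem_iInter]
    constructor
    · rintro ⟨A, hA, rfl⟩ B f
      change (L2On A).toSubmodule.starProjection _ = restrictTo B.2
        ((L2On A).toSubmodule.starProjection _)
      rw [starProjection_L2On hA, starProjection_L2On hA, restrictTo_comm]
    · exact fun h => exists_eq_L2On_of_commute fun B hB f => h ⟨B, hB⟩ f
  rw [e]
  refine isClosed_iInter fun B => isClosed_iInter fun f => ?_
  simp only [← starProjection_L2On B.2]
  exact isClosed_eq (continuous_starProjection_apply _)
    ((ContinuousLinearMap.continuous _).comp (continuous_starProjection_apply f))

/-- Only the class of A modulo null sets in (0, ∞) matters, so Lebesgue sets of the half-line and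
Borel sets of the line give the same subspaces. -/
theorem setOf_L2On_halfLineLeb : {K | ∃ A ∈ halfLineLeb, K = L2On A} =
    {K : ClosedSubmodule ℂ HalfLine | ∃ A, MeasurableSet A ∧ K = L2On A} := by
  ext K
  constructor
  · rintro ⟨A, hA, rfl⟩
    obtain ⟨B, hB, -, h⟩ := exists_measurableSet_L2On_eq hA.1
    exact ⟨B, hB, h⟩
  · rintro ⟨A, hA, rfl⟩
    refine ⟨A ∩ Ici 0, ⟨(hA.inter measurableSet_Ici).nullMeasurableSet, inter_subset_right⟩,
      L2On_congr ?_⟩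
    filter_upwards [ae_restrict_mem measurableSet_Ioi] with x hx
    exact propext ⟨fun h => ⟨h, Ioi_subset_Ici_self hx⟩, fun h => h.1⟩

theorem isSubspaceLattice_L2On_family :
    IsSubspaceLattice {K : ClosedSubmodule ℂ HalfLine | ∃ A, MeasurableSet A ∧ K = L2On A} where
  bot_mem := ⟨∅, MeasurableSet.empty, L2On_empty.symm⟩
  top_mem := ⟨univ, MeasurableSet.univ, (L2On_eq_top (subset_univ _)).symm⟩
  sup_mem := by
    rintro _ ⟨A, hA, rfl⟩ _ ⟨B, hB, rfl⟩
    exact ⟨_, hA.union hB, L2On_sup hA hB⟩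
  inf_mem := by
    rintro _ ⟨A, hA, rfl⟩ _ ⟨B, hB, rfl⟩
    exact ⟨_, hA.inter hB, L2On_inf A B⟩
  orthogonal_mem := by
    rintro _ ⟨A, hA, rfl⟩
    exact ⟨_, hA.compl, L2On_orthogonal hA⟩

variable {q : ℝ → ℝ}

/-- Minimality: the family of all L₂(A) is itself one of the invariant lattices being intersected.
-/
theorem operatorLattice_subset (hq : ContinuousOn q (Ici 0))
    (hpos : IsPositiveDefinite (slOperator q)) :
    operatorLattice (slOperator q) hpos ⊆ {K | ∃ A, MeasurableSet A ∧ K = L2On A} := by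
  refine sInter_subset_of_mem ⟨isSubspaceLattice_L2On_family, ?_, ?_⟩
  · rintro _ ⟨T, hT, rfl⟩
    exact ⟨_, measurableSet_Ioo, reachableSubspace_slOperator hq hpos hT⟩
  · rintro t ht _ ⟨A, hA, rfl⟩
    rcases ht.eq_or_lt with rfl | ht
    · exact ⟨A, hA, if_pos rfl⟩
    · exact ⟨_, (isOpen_waveNeighborhood A t).measurableSet, waveIsotony_L2On hq hpos hA ht⟩

theorem closure_operatorLattice (hq : ContinuousOn q (Ici 0))
    (hpos : IsPositiveDefinite (slOperator q)) :
    closure (operatorLattice (slOperator q) hpos) =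
      {K | ∃ A, MeasurableSet A ∧ K = L2On A} := by
  refine Subset.antisymm
    (closure_minimal (operatorLattice_subset hq hpos) isClosed_L2On_family) ?_
  rintro _ ⟨A, hA, rfl⟩
  refine L2On_mem_closure (isSubspaceLattice_minimalLattice _ _) (fun T hT => ?_) hA
  exact subset_minimalLattice _ _ ⟨T, hT, (reachableSubspace_slOperator hq hpos hT).symm⟩

end Spectrum

end WaveSpectrum

/-- The closure of the lattice of the operator `L₀ = -d²/dx² + q` consists of the subspaces
`L₂(E)`, and convergence of these subspaces is local convergence in measure.  The limit point
hypothesis need not be used separately: `L₀` carries no condition at infinity, so its positive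
definiteness already contains the symmetry that the limit point case provides. -/
theorem lemma5 (q : ℝ → ℝ) (hq : ContDiffOn ℝ ∞ q (Ici 0)) (hlp : WaveSpectrum.IsLimitPoint q)
    (hpos : WaveSpectrum.IsPositiveDefinite (WaveSpectrum.slOperator q)) :
    closure (WaveSpectrum.operatorLattice (WaveSpectrum.slOperator q) hpos) =
        {A | ∃ E ∈ WaveSpectrum.halfLineLeb, A = WaveSpectrum.L2On E} ∧
      ∀ (F : ℕ → Set ℝ) (E : Set ℝ), (∀ n, F n ∈ WaveSpectrum.halfLineLeb) →
        E ∈ WaveSpectrum.halfLineLeb →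
        (Tendsto (fun n => WaveSpectrum.L2On (F n)) atTop (𝓝 (WaveSpectrum.L2On E)) ↔
          ∀ R : ℝ, 0 < R →
            Tendsto (fun n => volume (symmDiff (F n) E ∩ Ioo 0 R)) atTop (𝓝 0)) :=
  ⟨(WaveSpectrum.closure_operatorLattice hq.continuousOn hpos).trans
    WaveSpectrum.setOf_L2On_halfLineLeb.symm,
    fun _ _ hF hE => WaveSpectrum.tendsto_L2On_iff (fun n => (hF n).1) hE.1⟩
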